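/- Let $W$ be the group of order two. Let $dg\mathbb{Q}$-mod be the category of unbounded chain complexes of rational vector spaces and $dg\mathbb{Q}W$-mod the category of such complexes with a $W$-action; regard a $dg\mathbb{Q}$-module as a $dg\mathbb{Q}W$-module with trivial action. An object $V$ of the category $\mathcal{A}(\mathcal{D})$ consists of a $dg\mathbb{Q}$-module $V_\infty$, of $dg\mathbb{Q}W$-modules $V_k$ for $k\geq 1$, and of a map of $dg\mathbb{Q}W$-modules $\sigma_V\colon V_\infty\to \operatorname{colim}_n\prod_{k\geq n}V_k$. A map $f\colon V\to V'$ consists of a map $f_\infty\colon V_\infty\to V'_\infty$ of $dg\mathbb{Q}$-modules and maps $f_k\colon V_k\to V'_k$ of $dg\mathbb{Q}W$-modules with $\sigma_{V'}\circ f_\infty=(\operatorname{colim}_n\prod_{k\geq n}f_k)\circ\sigma_V$. The category is symmetric monoidal under the stalkwise tensor product over $\mathbb{Q}$: $(V\otimes V')_\infty=V_\infty\otimes V'_\infty$ and $(V\otimes V')_k=V_k\otimes V'_k$ (diagonal action), with the evident structure map and with the symmetry given by the Koszul sign rule. Let $c\colon dg\mathbb{Q}\text{-mod}\to\mathcal{A}(\mathcal{D})$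 be the functor with $(cM)_\infty=M$, $(cM)_k=M$ for all $k$, and structure map induced by the diagonal $M\to\prod_{k\geq1}M$. For $k\geq 1$ let $i_k\colon dg\mathbb{Q}W\text{-mod}\to\mathcal{A}(\mathcal{D})$ be the functor with $(i_kR)_k=R$, $(i_kR)_l=0$ for $l\neq k$, and $(i_kR)_\infty=0$. For $R=\mathbb{Q}$ or $R=\mathbb{Q}W$ let $S^nR$ be the complex with $R$ in degree $n$ and $0$ elsewhere, let $D^nR$ be the complex with $R$ in degrees $n$ and $n-1$, $0$ elsewhere, and the identity as differential, and put $I_R=\{S^{n-1}R\to D^nR : n\in\mathbb{Z}\}$ and $J_R=\{0\to D^nR : n\in\mathbb{Z}\}$. **Theorem.** Call a map $f$ of $\mathcal{A}(\mathcal{D})$ a weak equivalence (respectively a fibration) if $f_\infty$ and every $f_k$, $k\geq1$, is a homology isomorphism (respectively surjective in every degree), that is, a weak equivalence (respectively a fibration) in the projective model structure. Then: 1. These classes are the weak equivalences and the fibrations of a model structure on $\mathcal{A}(\mathcal{D})$ (all small limits and colimits exist, and the two factorizations can be chosen functorially). 2. With the stalkwise tensor product, this is a monoidal model category: the symmetric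 monoidal structure is closed; the pushout-product of two cofibrations is a cofibration, which is a weak equivalence if one of the two is; and if $Q\to\mathbb{1}$ is a weak equivalence to the unit with $Q$ cofibrant, then $Q\otimes X\to \mathbb{1}\otimes X$ and $X\otimes Q\to X\otimes\mathbb{1}$ are weak equivalences for every cofibrant $X$. 3. It is cofibrantly generated, with generating cofibrations $I=cI_{\mathbb{Q}}\cup\bigcup_{k\geq1}i_kI_{\mathbb{Q}W}$ and generating acyclic cofibrations $J=cJ_{\mathbb{Q}}\cup\bigcup_{k\geq1}i_kJ_{\mathbb{Q}W}$: the domains of the maps of $I$ (of $J$) are small relative to the transfinite compositions of pushouts of maps of $I$ (of $J$), the fibrations are the maps with the right lifting property with respect to $J$, and the acyclic fibrations are the maps with the right lifting property with respect to $I$. 4. It is proper: pushouts of weak equivalences along cofibrations, and pullbacks of weak equivalences along fibrations, are weak equivalences. 5. It satisfies the monoid axiom: every transfinite composition of pushouts of maps of the form $j\otimes Z$, with $j$ an acyclic cofibration and $Z$ an object of $\mathcal{A}(\mathcal{D})$, is a weak equivalence. -/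

import Mathlib

open CategoryTheory Limits
open scoped MonoidalCategory

noncomputable section

namespace DihedralModel

/-- Rational vector spaces. -/
abbrev VectQ := ModuleCat.{0} ℚ

namespace Koszul

open GradedObject.Monoidal

variable (X Y Z : GradedObject ℤ VectQ)

/-- The Koszul braiding `x ⊗ y ↦ (-1)^(|x||y|) y ⊗ x` of graded rational vector spaces. -/
def braid : tensorObj X Y ⟶ tensorObj Y X :=
  fun k ↦ tensorObjDesc fun i j hij ↦
    (i * j).negOnePow • ((β_ (X i) (Y j)).hom ≫ ιTensorObj Y X j i k (by rw [add_comm]; exact hij))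

lemma ι_braid (i j k : ℤ) (hij : i + j = k) :
    ιTensorObj X Y i j k hij ≫ braid X Y k = (i * j).negOnePow •
      ((β_ (X i) (Y j)).hom ≫ ιTensorObj Y X j i k (by rw [add_comm]; exact hij)) := by
  simp [braid]

lemma ι_braid' (i j k : ℤ) (hij : i + j = k) :
    ιTensorObj X Y i j k hij ≫ braid X Y k = (i * j).negOnePow •
      (ιTensorObj X Y i j k hij ≫ (braiding X Y).hom k) := by
  rw [ι_braid]
  simp [braiding]

variable {X Y Z} in
lemma braid_naturality {X' Y' : GradedObject ℤ VectQ} (f : X ⟶ X') (g : Y ⟶ Y') :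
    tensorHom f g ≫ braid X' Y' = braid X Y ≫ tensorHom g f := by
  funext k
  apply tensorObj_ext
  intro i j h
  rw [GradedObject.categoryOfGradedObjects_comp, GradedObject.categoryOfGradedObjects_comp,
    ι_tensorHom_assoc, ι_braid, ← Category.assoc (ιTensorObj X Y i j k h), ι_braid]
  simp only [Linear.comp_units_smul, Linear.units_smul_comp, Category.assoc,
    ι_tensorHom, BraidedCategory.braiding_naturality_assoc]

lemma braid_braid : braid X Y ≫ braid Y X = 𝟙 _ := by
  funext k
  apply tensorObj_ext
  intro i j hij
  rw [GradedObject.categoryOfGradedObjects_comp, ← Category.assoc, ι_braid]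
  simp only [Linear.comp_units_smul, Linear.units_smul_comp, Category.assoc, ι_braid]
  rw [← Category.assoc, SymmetricCategory.symmetry, smul_smul, mul_comm j i,
    Int.units_mul_self, one_smul]
  simp

lemma ι₃_braid (i₁ i₂ i₃ j : ℤ) (h : i₁ + i₂ + i₃ = j) :
    ιTensorObj₃ X Y Z i₁ i₂ i₃ j h ≫ braid X (tensorObj Y Z) j =
      (i₁ * (i₂ + i₃)).negOnePow • (ιTensorObj₃ X Y Z i₁ i₂ i₃ j h ≫
        (braiding X (tensorObj Y Z)).hom j) := by
  rw [ιTensorObj₃_eq X Y Z i₁ i₂ i₃ j h _ rfl, Category.assoc, ι_braid', Linear.comp_units_smul,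
    Category.assoc]

lemma ι₃'_whiskerRight_braid (i₁ i₂ i₃ j : ℤ) (h : i₁ + i₂ + i₃ = j) :
    ιTensorObj₃' X Y Z i₁ i₂ i₃ j h ≫ whiskerRight (braid X Y) Z j =
      (i₁ * i₂).negOnePow • (((β_ (X i₁) (Y i₂)).hom ▷ Z i₃) ≫
        ιTensorObj₃' Y X Z i₂ i₁ i₃ j (by rw [add_comm i₂ i₁, h])) := by
  rw [ιTensorObj₃'_eq X Y Z i₁ i₂ i₃ j h _ rfl,
    ιTensorObj₃'_eq Y X Z i₂ i₁ i₃ j _ (i₁ + i₂) (add_comm _ _), Category.assoc, ι_tensorHom,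
    GradedObject.categoryOfGradedObjects_id, MonoidalCategory.tensorHom_id, ← MonoidalCategory.comp_whiskerRight_assoc, ι_braid]
  have := ((MonoidalCategory.tensorRight (Z i₃)).map_units_smul (i₁ * i₂).negOnePow ((β_ (X i₁) (Y i₂)).hom ≫
    ιTensorObj Y X i₂ i₁ (i₁ + i₂) (add_comm _ _)))
  change _ ▷ _ = _ • (_ ▷ _) at this
  rw [this, Linear.units_smul_comp, MonoidalCategory.comp_whiskerRight, Category.assoc]

lemma ι₃_whiskerLeft_braid (i₁ i₂ i₃ j : ℤ) (h : i₁ + i₂ + i₃ = j) :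
    ιTensorObj₃ X Y Z i₁ i₂ i₃ j h ≫ whiskerLeft X (braid Y Z) j =
      (i₂ * i₃).negOnePow • ((X i₁ ◁ (β_ (Y i₂) (Z i₃)).hom) ≫
        ιTensorObj₃ X Z Y i₁ i₃ i₂ j (by lia)) := by
  rw [ιTensorObj₃_eq X Y Z i₁ i₂ i₃ j h _ rfl,
    ιTensorObj₃_eq X Z Y i₁ i₃ i₂ j _ (i₂ + i₃) (add_comm _ _), Category.assoc, ι_tensorHom,
    GradedObject.categoryOfGradedObjects_id, MonoidalCategory.id_tensorHom, ← MonoidalCategory.whiskerLeft_comp_assoc, ι_braid]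
  have := ((MonoidalCategory.tensorLeft (X i₁)).map_units_smul (i₂ * i₃).negOnePow ((β_ (Y i₂) (Z i₃)).hom ≫
    ιTensorObj Z Y i₃ i₂ (i₂ + i₃) (add_comm _ _)))
  change _ ◁ _ = _ • (_ ◁ _) at this
  rw [this, Linear.units_smul_comp, MonoidalCategory.whiskerLeft_comp, Category.assoc]

lemma hexagon :
    (associator X Y Z).hom ≫ braid X (tensorObj Y Z) ≫ (associator Y Z X).hom =
      whiskerRight (braid X Y) Z ≫ (associator Y X Z).hom ≫ whiskerLeft Y (braid X Z) := by
  funext j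
  apply tensorObj₃'_ext
  intro i₁ i₂ i₃ h
  simp only [GradedObject.categoryOfGradedObjects_comp]
  conv_lhs => rw [ιTensorObj₃'_associator_hom_assoc, ← Category.assoc (ιTensorObj₃ X Y Z i₁ i₂ i₃ j h),
    ι₃_braid, ιTensorObj₃_eq X Y Z i₁ i₂ i₃ j h _ rfl, Category.assoc]
  dsimp [braiding]
  conv_lhs => rw [
    ι_tensorObjDesc, ← MonoidalCategory.id_tensorHom,
    BraidedCategory.braiding_naturality_assoc,
    BraidedCategory.braiding_tensor_right_hom]
  simp only [Category.assoc, Linear.comp_units_smul, Linear.units_smul_comp, Iso.hom_inv_id_assoc]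
  conv_lhs => rw [
    MonoidalCategory.tensorHom_id,
    ← ιTensorObj₃'_eq_assoc Y Z X i₂ i₃ i₁ j (by rw [add_comm _ i₁, ← add_assoc, h]) _ rfl,
    ιTensorObj₃'_associator_hom, Iso.inv_hom_id_assoc]
  conv_rhs => rw [← Category.assoc, ι₃'_whiskerRight_braid, Linear.units_smul_comp, Category.assoc,
    ιTensorObj₃'_associator_hom_assoc, ι₃_whiskerLeft_braid]
  simp only [Linear.comp_units_smul, smul_smul]
  rw [mul_add, Int.negOnePow_add]

end Koszul

/-- The sign convention `d (x ⊗ y) = d x ⊗ y + (-1)^|x| x ⊗ d y` for chain complexes. -/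
instance : (ComplexShape.down ℤ).TensorSigns where
  ε' := MonoidHom.mk' (fun n : Multiplicative ℤ ↦ Int.negOnePow n.toAdd)
    fun a b ↦ Int.negOnePow_add a.toAdd b.toAdd
  rel_add p q r hpq := by
    have : q + 1 = p := hpq
    change q + r + 1 = p + r
    lia
  add_rel p q r hpq := by
    have : q + 1 = p := hpq
    change r + q + 1 = r + p
    lia
  ε'_succ p q hpq := by
    have : q + 1 = p := hpq
    subst this
    change Int.negOnePow q = - Int.negOnePow (q+1)
    rw [Int.negOnePow_succ, neg_neg]

/-- Differential graded rational vector spaces: unbounded chain complexes. The monoidal structure is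
Mathlib's tensor product of complexes. -/
abbrev DgQ := ChainComplex VectQ ℤ

namespace DgQ
open HomologicalComplex

variable (K L : DgQ)

/-- The Koszul braiding in degree `n`. -/
def braidX (n : ℤ) : (tensorObj K L).X n ⟶ (tensorObj L K).X n := Koszul.braid K.X L.X n

lemma ι_braidX (i j n : ℤ) (h : i + j = n) :
    ιTensorObj K L i j n h ≫ braidX K L n = (i * j).negOnePow •
      ((β_ (K.X i) (L.X j)).hom ≫ ιTensorObj L K j i n (by rw [add_comm]; exact h)) :=
  Koszul.ι_braid K.X L.X i j n h

lemma ι_d (i j p q : ℤ) (hpq : q + 1 = p) (h : i + j = p) :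
    ιTensorObj K L i j p h ≫ (tensorObj K L).d p q =
      (K.d i (i - 1) ▷ L.X j) ≫ ιTensorObj K L (i - 1) j q (by lia) +
      i.negOnePow • ((K.X i ◁ L.d j (j - 1)) ≫ ιTensorObj K L i (j - 1) q (by lia)) := by
  have h₁ : (ComplexShape.down ℤ).Rel i (i - 1) := by simp
  have h₂ : (ComplexShape.down ℤ).Rel j (j - 1) := by simp
  rw [mapBifunctor.d_eq, Preadditive.comp_add, mapBifunctor.ι_D₁, mapBifunctor.ι_D₂,
    mapBifunctor.d₁_eq K L _ _ h₁ j q (by change i - 1 + j = q; lia),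
    mapBifunctor.d₂_eq K L _ _ i h₂ q (by change i + (j - 1) = q; lia)]
  congr 1
  exact one_smul _ _

/-- The Koszul braiding of differential graded rational vector spaces. -/
def braidHom : tensorObj K L ⟶ tensorObj L K where
  f n := braidX K L n
  comm' p q hpq := by
    have hpq' : q + 1 = p := hpq
    apply mapBifunctor.hom_ext
    intro i j h
    change i + j = p at h
    rw [← Category.assoc, ← Category.assoc]
    change (ιTensorObj K L i j p h ≫ _) ≫ _ = (ιTensorObj K L i j p h ≫ _) ≫ _
    rw [ι_braidX, ι_d K L i j p q hpq' h, Linear.units_smul_comp, Category.assoc,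
      ι_d L K j i p q hpq' (by lia), Preadditive.add_comp, Linear.units_smul_comp,
      Category.assoc, Category.assoc, ι_braidX, ι_braidX]
    simp only [Preadditive.comp_add, Linear.comp_units_smul, smul_add, smul_smul,
      BraidedCategory.braiding_naturality_left_assoc,
      BraidedCategory.braiding_naturality_right_assoc]
    rw [add_comm]
    congr 2
    · rw [sub_mul, one_mul, Int.negOnePow_sub]
    · rw [mul_sub, mul_one, Int.negOnePow_sub, mul_comm i j, mul_left_comm,
        Int.units_mul_self, mul_one]

variable {K L} in
lemma braidHom_naturality {K' L' : DgQ} (f : K ⟶ K') (g : L ⟶ L') :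
    tensorHom f g ≫ braidHom K' L' = braidHom K L ≫ tensorHom g f := by
  ext n : 1
  exact congrFun (Koszul.braid_naturality f.f g.f) n

lemma braidHom_braidHom : braidHom K L ≫ braidHom L K = 𝟙 _ := by
  ext n : 1
  exact congrFun (Koszul.braid_braid K.X L.X) n

lemma hexagon (M : DgQ) :
    (associator K L M).hom ≫ braidHom K (tensorObj L M) ≫ (associator L M K).hom =
      tensorHom (braidHom K L) (𝟙 M) ≫ (associator L K M).hom ≫
        tensorHom (𝟙 L) (braidHom K M) := by
  ext n : 1
  exact congrFun (Koszul.hexagon K.X L.X M.X) n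

/-- The Koszul braiding as an isomorphism. -/
def braidIso : K ⊗ L ≅ L ⊗ K where
  hom := braidHom K L
  inv := braidHom L K
  hom_inv_id := braidHom_braidHom K L
  inv_hom_id := braidHom_braidHom L K

instance : SymmetricCategory DgQ where
  braiding := braidIso
  braiding_naturality_right X _ _ f := braidHom_naturality (𝟙 X) f
  braiding_naturality_left f Z := braidHom_naturality f (𝟙 Z)
  hexagon_forward := hexagon
  hexagon_reverse X Y Z := by
    have h : α_ Z X Y ≪≫ braidIso Z (X ⊗ Y) ≪≫ α_ X Y Z =
        MonoidalCategory.whiskerRightIso (braidIso Z X) Y ≪≫ α_ X Z Y ≪≫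
          MonoidalCategory.whiskerLeftIso X (braidIso Z Y) := Iso.ext (hexagon Z X Y)
    have h' := congrArg Iso.inv h
    simp only [Iso.trans_inv, Category.assoc] at h'
    exact h'
  symmetry := braidHom_braidHom

end DgQ

namespace DgQ

variable {J : Type} [SmallCategory J]

instance preservesColimits_tensorLeft (K : DgQ) :
    PreservesColimitsOfShape J (MonoidalCategory.tensorLeft K) := by
  refine HomologicalComplex.preservesColimitsOfShape_of_eval _ fun n ↦
    ⟨fun {F} ↦ ⟨fun {c} hc ↦ ⟨?_⟩⟩⟩
  have hc' (i j : ℤ) := isColimitOfPreserves (HomologicalComplex.eval VectQ _ j ⋙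
    MonoidalCategory.tensorLeft (K.X i)) hc
  have key {L L' : DgQ} (f : L ⟶ L') (i j : ℤ) (h : i + j = n) :
      HomologicalComplex.ιTensorObj K L i j n h ≫ (K ◁ f).f n =
        (K.X i ◁ f.f j) ≫ HomologicalComplex.ιTensorObj K L' i j n h := by
    refine (GradedObject.Monoidal.ι_tensorHom (𝟙 K.X) f.f i j n h).trans ?_
    rw [GradedObject.categoryOfGradedObjects_id, MonoidalCategory.id_tensorHom]
    rfl
  let t (s : Cocone (F ⋙ MonoidalCategory.tensorLeft K ⋙ HomologicalComplex.eval VectQ _ n))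
      (i j : ℤ) (h : i + j = n) : Cocone (F ⋙ HomologicalComplex.eval VectQ _ j ⋙
        MonoidalCategory.tensorLeft (K.X i)) :=
    ⟨s.pt, { app a := HomologicalComplex.ιTensorObj K (F.obj a) i j n h ≫ s.ι.app a
             naturality a b f := by
               have h₁ := key (F.map f) i j h
               have h₂ := s.w f
               change (K.X i ◁ (F.map f).f j) ≫ _ = _ ≫ 𝟙 _
               refine (Category.assoc _ _ _).symm.trans ?_
               refine (congrArg (· ≫ s.ι.app b) h₁.symm).trans ?_
               refine (Category.assoc _ _ _).trans ?_
               exact (congrArg (_ ≫ ·) h₂).trans (Category.comp_id _).symm }⟩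
  exact
    { desc s := GradedObject.Monoidal.tensorObjDesc fun i j h ↦ (hc' i j).desc (t s i j h)
      fac s a := by
        apply GradedObject.Monoidal.tensorObj_ext
        intro i j h
        refine (Category.assoc _ _ _).symm.trans ?_
        refine (congrArg (· ≫ _) (key (c.ι.app a) i j h)).trans ?_
        refine (Category.assoc _ _ _).trans ?_
        refine (congrArg (_ ≫ ·) (GradedObject.Monoidal.ι_tensorObjDesc _ i j h)).trans ?_
        exact (hc' i j).fac (t s i j h) a
      uniq s m hm := by
        apply GradedObject.Monoidal.tensorObj_ext
        intro i j h
        refine Eq.trans ?_ (GradedObject.Monoidal.ι_tensorObjDesc _ i j h).symm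
        refine (hc' i j).uniq (t s i j h) _ fun a ↦ ?_
        refine (Category.assoc _ _ _).symm.trans ?_
        refine (congrArg (· ≫ m) (key (c.ι.app a) i j h).symm).trans ?_
        refine (Category.assoc _ _ _).trans ?_
        exact congrArg (_ ≫ ·) (hm a) }

instance preservesColimits_tensorRight (K : DgQ) :
    PreservesColimitsOfShape J (MonoidalCategory.tensorRight K) :=
  preservesColimitsOfShape_of_natIso (BraidedCategory.tensorLeftIsoTensorRight K)
end DgQ

/-- The group `W` of order two. -/
abbrev W₂ := Multiplicative (ZMod 2)
/-- Differential graded `ℚ[W]`-modules, as chain complexes of rational vector spaces with an action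
of `W`. The tensor product is over `ℚ`, with diagonal action. -/
abbrev DgQW := Action DgQ W₂

namespace DgQW
variable {J : Type} [SmallCategory J]
instance preservesColimits_tensorLeft (K : DgQW) :
    PreservesColimitsOfShape J (MonoidalCategory.tensorLeft K) :=
  Action.preservesColimitsOfShape_of_preserves _
    (inferInstanceAs (PreservesColimitsOfShape J (Action.forget DgQ W₂ ⋙ MonoidalCategory.tensorLeft K.V)))

instance preservesColimits_tensorRight (K : DgQW) :
    PreservesColimitsOfShape J (MonoidalCategory.tensorRight K) :=
  preservesColimitsOfShape_of_natIso (BraidedCategory.tensorLeftIsoTensorRight K)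
end DgQW

section Colim

variable {D : Type*} [Category* D] [MonoidalCategory D] [HasColimitsOfShape ℕ+ D]

variable (D) in
/-- The canonical map `𝟙 ⟶ colim 𝟙`. -/
def colimEps : 𝟙_ D ⟶ colimit (𝟙_ (ℕ+ ⥤ D)) := colimit.ι (𝟙_ (ℕ+ ⥤ D)) 1

variable (D) in
lemma colimEps_eq (j : ℕ+) : colimEps D = colimit.ι (𝟙_ (ℕ+ ⥤ D)) j := by
  have h := colimit.w (𝟙_ (ℕ+ ⥤ D)) (homOfLE (one_le (a := j)))
  exact h.symm.trans (Category.id_comp _)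

variable [∀ X : D, PreservesColimitsOfShape ℕ+ (MonoidalCategory.tensorLeft X)]
  [∀ X : D, PreservesColimitsOfShape ℕ+ (MonoidalCategory.tensorRight X)]

/-- The canonical map `colim F ⊗ colim G ⟶ colim (F ⊗ G)`. -/
def colimMu (F G : ℕ+ ⥤ D) : colimit F ⊗ colimit G ⟶ colimit (F ⊗ G) :=
  ((colimit.isColimit F).tensor (colimit.isColimit G)).desc (colimit.cocone (F ⊗ G))

lemma ι_colimMu (F G : ℕ+ ⥤ D) (j : ℕ+) : (colimit.ι F j ⊗ₘ colimit.ι G j) ≫ colimMu F G =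
    colimit.ι (F ⊗ G) j :=
  ((colimit.isColimit F).tensor (colimit.isColimit G)).fac _ j

lemma ι_colimMu_assoc (F G : ℕ+ ⥤ D) (j : ℕ+) {Z : D} (h : colimit (F ⊗ G) ⟶ Z) :
    (colimit.ι F j ⊗ₘ colimit.ι G j) ≫ colimMu F G ≫ h = colimit.ι (F ⊗ G) j ≫ h := by
  rw [← Category.assoc, ι_colimMu]
  rfl

lemma colimTensor_ext {F G : ℕ+ ⥤ D} {Z : D} {f g : colimit F ⊗ colimit G ⟶ Z}
    (h : ∀ j, (colimit.ι F j ⊗ₘ colimit.ι G j) ≫ f = (colimit.ι F j ⊗ₘ colimit.ι G j) ≫ g) :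
    f = g :=
  ((colimit.isColimit F).tensor (colimit.isColimit G)).hom_ext h

lemma colimTensor₃_ext {F G H : ℕ+ ⥤ D} {Z : D} {f g : (colimit F ⊗ colimit G) ⊗ colimit H ⟶ Z}
    (h : ∀ j, ((colimit.ι F j ⊗ₘ colimit.ι G j) ⊗ₘ colimit.ι H j) ≫ f =
      ((colimit.ι F j ⊗ₘ colimit.ι G j) ⊗ₘ colimit.ι H j) ≫ g) : f = g :=
  (((colimit.isColimit F).tensor (colimit.isColimit G)).tensor (colimit.isColimit H)).hom_ext h

lemma colimMu_natural {F F' G G' : ℕ+ ⥤ D} (f : F ⟶ F') (g : G ⟶ G') :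
    (colimMap f ⊗ₘ colimMap g) ≫ colimMu F' G' = colimMu F G ≫ colimMap (f ⊗ₘ g) := by
  refine colimTensor_ext fun j ↦ ?_
  rw [MonoidalCategory.tensorHom_comp_tensorHom_assoc, ι_colimMu_assoc, ι_colimMap, ι_colimMap,
    ← MonoidalCategory.tensorHom_comp_tensorHom_assoc, ι_colimMu]
  exact (ι_colimMap (f ⊗ₘ g) j).symm

instance colimLaxMonoidal : (colim : (ℕ+ ⥤ D) ⥤ D).LaxMonoidal where
  ε := colimEps D
  μ := colimMu
  μ_natural_left f G := by
    have h := colimMu_natural f (𝟙 G)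
    simp only [MonoidalCategory.tensorHom_id] at h
    rw [← MonoidalCategory.tensorHom_id]
    exact (congrArg (· ≫ _) (congrArg (_ ⊗ₘ ·) (colim.map_id G).symm)).trans h
  μ_natural_right F f := by
    have h := colimMu_natural (𝟙 F) f
    simp only [MonoidalCategory.id_tensorHom] at h
    rw [← MonoidalCategory.id_tensorHom]
    exact (congrArg (· ≫ _) (congrArg (· ⊗ₘ _) (colim.map_id F).symm)).trans h
  associativity F G H := colimTensor₃_ext fun j ↦ by
    have e₁ : ((colimit.ι F j ⊗ₘ colimit.ι G j) ⊗ₘ colimit.ι H j) ≫ colimMu F G ▷ colimit H =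
        colimit.ι (F ⊗ G) j ⊗ₘ colimit.ι H j := by
      rw [← MonoidalCategory.tensorHom_id, MonoidalCategory.tensorHom_comp_tensorHom, ι_colimMu,
        Category.comp_id]
      rfl
    have e₂ : (colimit.ι F j ⊗ₘ colimit.ι G j ⊗ₘ colimit.ι H j) ≫ colimit F ◁ colimMu G H =
        colimit.ι F j ⊗ₘ colimit.ι (G ⊗ H) j := by
      rw [← MonoidalCategory.id_tensorHom, MonoidalCategory.tensorHom_comp_tensorHom, ι_colimMu,
        Category.comp_id]
      rfl
    change _ ≫ colimMu F G ▷ colimit H ≫ colimMu (F ⊗ G) H ≫ colimMap (α_ F G H).hom =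
      _ ≫ (α_ (colimit F) (colimit G) (colimit H)).hom ≫ colimit F ◁ colimMu G H ≫
        colimMu F (G ⊗ H)
    rw [reassoc_of% e₁, MonoidalCategory.associator_naturality_assoc, reassoc_of% e₂]
    refine (ι_colimMu_assoc (F ⊗ G) H j _).trans ?_
    refine (ι_colimMap _ _).trans ?_
    exact congrArg (_ ≫ ·) (ι_colimMu F (G ⊗ H) j).symm
  left_unitality F := by
    rw [← cancel_epi (λ_ _).inv, Iso.inv_hom_id]
    refine colimit.hom_ext fun j ↦ ?_
    change _ = colimit.ι F j ≫ (λ_ (colimit F)).inv ≫ colimEps D ▷ colimit F ≫ colimMu _ F ≫ colimMap (λ_ F).hom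
    rw [MonoidalCategory.leftUnitor_inv_naturality_assoc, colimEps_eq D j,
      ← MonoidalCategory.id_tensorHom, ← MonoidalCategory.tensorHom_id,
      MonoidalCategory.tensorHom_comp_tensorHom_assoc, Category.id_comp, Category.comp_id]
    refine Eq.trans ?_ (congrArg (_ ≫ ·) (ι_colimMu_assoc (𝟙_ _) F j _).symm)
    refine Eq.trans ?_ (congrArg (_ ≫ ·) (ι_colimMap (λ_ F).hom j).symm)
    refine (Category.comp_id _).trans ?_
    exact ((λ_ (F.obj j)).inv_hom_id_assoc _).symm
  right_unitality F := by
    rw [← cancel_epi (ρ_ _).inv, Iso.inv_hom_id]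
    refine colimit.hom_ext fun j ↦ ?_
    change _ = colimit.ι F j ≫ (ρ_ (colimit F)).inv ≫ colimit F ◁ colimEps D ≫ colimMu F _ ≫ colimMap (ρ_ F).hom
    rw [MonoidalCategory.rightUnitor_inv_naturality_assoc, colimEps_eq D j,
      ← MonoidalCategory.id_tensorHom, ← MonoidalCategory.tensorHom_id,
      MonoidalCategory.tensorHom_comp_tensorHom_assoc, Category.id_comp, Category.comp_id]
    refine Eq.trans ?_ (congrArg (_ ≫ ·) (ι_colimMu_assoc F (𝟙_ _) j _).symm)
    refine Eq.trans ?_ (congrArg (_ ≫ ·) (ι_colimMap (ρ_ F).hom j).symm)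
    refine (Category.comp_id _).trans ?_
    exact ((ρ_ (F.obj j)).inv_hom_id_assoc _).symm

lemma colimMu_braiding [BraidedCategory D] (F G : ℕ+ ⥤ D) :
    colimMu F G ≫ colimMap (β_ F G).hom =
      (β_ (colimit F) (colimit G)).hom ≫ colimMu G F := by
  refine colimTensor_ext fun j ↦ ?_
  rw [ι_colimMu_assoc, BraidedCategory.braiding_naturality_assoc, ι_colimMu]
  exact ι_colimMap (β_ F G).hom j

instance colimLaxBraided [BraidedCategory D] : (colim : (ℕ+ ⥤ D) ⥤ D).LaxBraided where
  braided F G := colimMu_braiding F G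

end Colim

section Tails

variable {D : Type*} [Category* D] [HasCountableProducts D]

/-- The product `∏_{k ≥ n} V k`. -/
def tailProd (V : ℕ+ → D) (n : ℕ+) : D := ∏ᶜ fun k : {k : ℕ+ // n ≤ k} ↦ V k.1

/-- The projection `∏_{k ≥ n} V k ⟶ V k`. -/
def tailπ (V : ℕ+ → D) (n : ℕ+) (k : {k : ℕ+ // n ≤ k}) : tailProd V n ⟶ V k.1 := Pi.π _ k

/-- Constructor for maps to `∏_{k ≥ n} V k`. -/
def tailLift {V : ℕ+ → D} {n : ℕ+} {X : D} (f : ∀ k : {k : ℕ+ // n ≤ k}, X ⟶ V k.1) :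
    X ⟶ tailProd V n := Pi.lift f

lemma tailLift_π {V : ℕ+ → D} {n : ℕ+} {X : D} (f : ∀ k : {k : ℕ+ // n ≤ k}, X ⟶ V k.1)
    (k : {k : ℕ+ // n ≤ k}) : tailLift f ≫ tailπ V n k = f k := Pi.lift_π _ _

lemma tailLift_π_assoc {V : ℕ+ → D} {n : ℕ+} {X : D} (f : ∀ k : {k : ℕ+ // n ≤ k}, X ⟶ V k.1)
    (k : {k : ℕ+ // n ≤ k}) {Z : D} (h : V k.1 ⟶ Z) :
    tailLift f ≫ tailπ V n k ≫ h = f k ≫ h := by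
  rw [← Category.assoc, tailLift_π]

lemma tail_ext {V : ℕ+ → D} {n : ℕ+} {X : D} {f g : X ⟶ tailProd V n}
    (h : ∀ k, f ≫ tailπ V n k = g ≫ tailπ V n k) : f = g := Pi.hom_ext _ _ h

/-- The map `∏_{k ≥ n} V k ⟶ ∏_{k ≥ n} V' k` induced by a family of maps. -/
def tailMap {V V' : ℕ+ → D} (f : ∀ k, V k ⟶ V' k) (n : ℕ+) : tailProd V n ⟶ tailProd V' n :=
  tailLift fun k ↦ tailπ V n k ≫ f k.1

lemma tailMap_π {V V' : ℕ+ → D} (f : ∀ k, V k ⟶ V' k) (n : ℕ+) (k : {k : ℕ+ // n ≤ k}) :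
    tailMap f n ≫ tailπ V' n k = tailπ V n k ≫ f k.1 := tailLift_π _ _

lemma tailMap_π_assoc {V V' : ℕ+ → D} (f : ∀ k, V k ⟶ V' k) (n : ℕ+) (k : {k : ℕ+ // n ≤ k})
    {Z : D} (h : V' k.1 ⟶ Z) :
    tailMap f n ≫ tailπ V' n k ≫ h = tailπ V n k ≫ f k.1 ≫ h := by
  rw [← Category.assoc, tailMap_π, Category.assoc]

/-- The projection `∏_{k ≥ n} V k ⟶ ∏_{k ≥ m} V k` for `n ≤ m`. -/
def tailRes (V : ℕ+ → D) {n m : ℕ+} (h : n ≤ m) : tailProd V n ⟶ tailProd V m :=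
  tailLift fun k ↦ tailπ V n ⟨k.1, h.trans k.2⟩

lemma tailRes_π (V : ℕ+ → D) {n m : ℕ+} (h : n ≤ m) (k : {k : ℕ+ // m ≤ k}) :
    tailRes V h ≫ tailπ V m k = tailπ V n ⟨k.1, h.trans k.2⟩ := tailLift_π _ _

lemma tailRes_π_assoc (V : ℕ+ → D) {n m : ℕ+} (h : n ≤ m) (k : {k : ℕ+ // m ≤ k})
    {Z : D} (g : V k.1 ⟶ Z) :
    tailRes V h ≫ tailπ V m k ≫ g = tailπ V n ⟨k.1, h.trans k.2⟩ ≫ g := by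
  rw [← Category.assoc, tailRes_π]

variable (D) in
/-- The functor sending `V` to the tower `n ↦ ∏_{k ≥ n} V k` with the projections. -/
def tails : (ℕ+ → D) ⥤ (ℕ+ ⥤ D) where
  obj V :=
    { obj n := tailProd V n
      map f := tailRes V (leOfHom f)
      map_id n := tail_ext fun k ↦ by simp [tailRes_π]
      map_comp f g := tail_ext fun k ↦ by simp [tailRes_π] }
  map f :=
    { app n := tailMap f n
      naturality n m g := tail_ext fun k ↦ by
        simp only [Category.assoc, tailMap_π, tailRes_π, tailRes_π_assoc] }
  map_id V := by
    ext n : 2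
    exact tail_ext fun k ↦ by simp [tailMap_π]
  map_comp f g := by
    ext n : 2
    exact tail_ext fun k ↦ by simp [tailMap_π, tailMap_π_assoc]

variable [MonoidalCategory D]

variable (D) in
/-- The diagonal map `𝟙 ⟶ ∏_{k ≥ n} 𝟙`. -/
def tailEps (n : ℕ+) : 𝟙_ D ⟶ tailProd (fun _ ↦ 𝟙_ D) n := tailLift fun _ ↦ 𝟙 _

/-- The map `(∏_{k ≥ n} V k) ⊗ (∏_{k ≥ n} V' k) ⟶ ∏_{k ≥ n} V k ⊗ V' k`. -/
def tailMu (V V' : ℕ+ → D) (n : ℕ+) :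
    tailProd V n ⊗ tailProd V' n ⟶ tailProd (fun k ↦ V k ⊗ V' k) n :=
  tailLift fun k ↦ tailπ V n k ⊗ₘ tailπ V' n k

lemma tailMu_π (V V' : ℕ+ → D) (n : ℕ+) (k : {k : ℕ+ // n ≤ k}) :
    tailMu V V' n ≫ tailπ (fun k ↦ V k ⊗ V' k) n k = tailπ V n k ⊗ₘ tailπ V' n k := tailLift_π _ _

lemma tailMu_π_assoc (V V' : ℕ+ → D) (n : ℕ+) (k : {k : ℕ+ // n ≤ k}) {Z : D}
    (h : V k.1 ⊗ V' k.1 ⟶ Z) :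
    tailMu V V' n ≫ tailπ (fun k ↦ V k ⊗ V' k) n k ≫ h = (tailπ V n k ⊗ₘ tailπ V' n k) ≫ h := by
  rw [← Category.assoc, tailMu_π]

open MonoidalCategory

instance tailsLaxMonoidal : (tails D).LaxMonoidal where
  ε :=
    { app n := tailEps D n
      naturality n m f := by
        refine (Category.id_comp (tailEps D m)).trans ?_
        change tailEps D m = tailEps D n ≫ tailRes (fun _ ↦ 𝟙_ D) (leOfHom f)
        exact tail_ext fun k ↦ by simp only [Category.assoc, tailEps, tailLift_π, tailRes_π] }
  μ V V' :=
    { app n := tailMu V V' n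
      naturality n m f := by
        change (tailRes V (leOfHom f) ⊗ₘ tailRes V' (leOfHom f)) ≫ tailMu V V' m =
          tailMu V V' n ≫ tailRes (fun k ↦ V k ⊗ V' k) (leOfHom f)
        exact tail_ext fun k ↦ by
          simp only [Category.assoc, tailMu_π, tailRes_π, tensorHom_comp_tensorHom] }
  μ_natural_left {V V'} f G := by
    ext n : 2
    change tailMap f n ▷ tailProd G n ≫ tailMu V' G n =
      tailMu V G n ≫ tailMap (fun k ↦ f k ▷ G k) n
    exact tail_ext fun k ↦ by
      simp only [Category.assoc, tailMu_π, tailMap_π, tailMu_π_assoc, ← tensorHom_id,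
        tensorHom_comp_tensorHom, Category.id_comp, Category.comp_id]
  μ_natural_right {V V'} G f := by
    ext n : 2
    change tailProd G n ◁ tailMap f n ≫ tailMu G V' n =
      tailMu G V n ≫ tailMap (fun k ↦ G k ◁ f k) n
    exact tail_ext fun k ↦ by
      simp only [Category.assoc, tailMu_π, tailMap_π, tailMu_π_assoc, ← id_tensorHom,
        tensorHom_comp_tensorHom, Category.id_comp, Category.comp_id]
  associativity F G H := by
    ext n : 2
    change tailMu F G n ▷ tailProd H n ≫ tailMu (fun k ↦ F k ⊗ G k) H n ≫
        tailMap (fun k ↦ (α_ (F k) (G k) (H k)).hom) n =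
      (α_ _ _ _).hom ≫ tailProd F n ◁ tailMu G H n ≫ tailMu F (fun k ↦ G k ⊗ H k) n
    exact tail_ext fun k ↦ by
      simp only [Category.assoc, tailMu_π, tailMap_π, tailMu_π_assoc, ← id_tensorHom,
        ← tensorHom_id, tensorHom_comp_tensorHom, tensorHom_comp_tensorHom_assoc,
        Category.id_comp, associator_naturality]
  left_unitality F := by
    ext n : 2
    change (λ_ (tailProd F n)).hom = tailEps D n ▷ tailProd F n ≫ tailMu (fun _ ↦ 𝟙_ D) F n ≫
      tailMap (fun k ↦ (λ_ (F k)).hom) n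
    exact tail_ext fun k ↦ by
      simp only [Category.assoc, tailMap_π, tailMu_π_assoc, ← tensorHom_id,
        tensorHom_comp_tensorHom_assoc, Category.id_comp, tailEps, tailLift_π]
      simp
  right_unitality F := by
    ext n : 2
    change (ρ_ (tailProd F n)).hom = tailProd F n ◁ tailEps D n ≫ tailMu F (fun _ ↦ 𝟙_ D) n ≫
      tailMap (fun k ↦ (ρ_ (F k)).hom) n
    exact tail_ext fun k ↦ by
      simp only [Category.assoc, tailMap_π, tailMu_π_assoc, ← id_tensorHom,
        tensorHom_comp_tensorHom_assoc, Category.id_comp, tailEps, tailLift_π]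
      simp

instance tailsLaxBraided [BraidedCategory D] : (tails D).LaxBraided where
  braided F G := by
    ext n : 2
    change tailMu F G n ≫ tailMap (fun k ↦ (β_ (F k) (G k)).hom) n =
      (β_ _ _).hom ≫ tailMu G F n
    exact tail_ext fun k ↦ by
      simp only [Category.assoc, tailMu_π, tailMap_π, tailMu_π_assoc,
        BraidedCategory.braiding_naturality]

end Tails

section CommaMonoidal

variable {A B T : Type*} [Category* A] [Category* B] [Category* T]
  [MonoidalCategory A] [MonoidalCategory B] [MonoidalCategory T]
  {L : A ⥤ T} {R : B ⥤ T} [L.OplaxMonoidal] [R.LaxMonoidal]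

open MonoidalCategory Functor.LaxMonoidal Functor.OplaxMonoidal

/-- The componentwise tensor product `(a, b, σ) ⊗ (a', b', σ') = (a ⊗ a', b ⊗ b', -)` with structure
map `L (a ⊗ a') ⟶ L a ⊗ L a' ⟶ R b ⊗ R b' ⟶ R (b ⊗ b')`. -/
abbrev commaTensor (X Y : Comma L R) : Comma L R where
  left := X.left ⊗ Y.left
  right := X.right ⊗ Y.right
  hom := δ L X.left Y.left ≫ (X.hom ⊗ₘ Y.hom) ≫ μ R X.right Y.right

/-- The tensor product of two maps in a comma category. -/
abbrev commaTensorHom {X X' Y Y' : Comma L R} (f : X ⟶ X') (g : Y ⟶ Y') :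
    commaTensor X Y ⟶ commaTensor X' Y' where
  left := f.left ⊗ₘ g.left
  right := f.right ⊗ₘ g.right
  w := by
    rw [← δ_natural_assoc, tensorHom_comp_tensorHom_assoc, f.w, g.w,
      ← tensorHom_comp_tensorHom_assoc, μ_natural, Category.assoc, Category.assoc]

/-- The componentwise associator. -/
abbrev commaAssociator (X Y Z : Comma L R) :
    commaTensor (commaTensor X Y) Z ≅ commaTensor X (commaTensor Y Z) :=
  Comma.isoMk (α_ _ _ _) (α_ _ _ _) (by
    have h₁ : ((δ L X.left Y.left ≫ (X.hom ⊗ₘ Y.hom) ≫ μ R X.right Y.right) ⊗ₘ Z.hom) =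
        δ L X.left Y.left ▷ _ ≫ ((X.hom ⊗ₘ Y.hom) ⊗ₘ Z.hom) ≫ μ R X.right Y.right ▷ _ := by
      simp only [← tensorHom_id, tensorHom_comp_tensorHom, Category.id_comp, Category.comp_id]
    have h₂ : (X.hom ⊗ₘ (δ L Y.left Z.left ≫ (Y.hom ⊗ₘ Z.hom) ≫ μ R Y.right Z.right)) =
        _ ◁ δ L Y.left Z.left ≫ (X.hom ⊗ₘ (Y.hom ⊗ₘ Z.hom)) ≫ _ ◁ μ R Y.right Z.right := by
      simp only [← id_tensorHom, tensorHom_comp_tensorHom, Category.id_comp, Category.comp_id]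
    dsimp only
    rw [h₁, h₂]
    simp only [Category.assoc]
    rw [Functor.LaxMonoidal.associativity, associator_naturality_assoc, Functor.OplaxMonoidal.associativity_assoc])

/-- The unit, with structure map `L 𝟙 ⟶ 𝟙 ⟶ R 𝟙`. -/
abbrev commaUnit : Comma L R where
  left := 𝟙_ A
  right := 𝟙_ B
  hom := η L ≫ ε R

/-- The componentwise left unitor. -/
abbrev commaLeftUnitor (X : Comma L R) : commaTensor commaUnit X ≅ X :=
  Comma.isoMk (λ_ _) (λ_ _) (by
    have h : ((η L ≫ ε R) ⊗ₘ X.hom) = η L ▷ _ ≫ _ ◁ X.hom ≫ ε R ▷ _ := by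
      rw [MonoidalCategory.tensorHom_def, comp_whiskerRight, Category.assoc, whisker_exchange]
    dsimp only
    rw [h]
    simp only [Category.assoc]
    rw [← Functor.LaxMonoidal.left_unitality, leftUnitor_naturality, ← Functor.OplaxMonoidal.left_unitality_hom]
    simp only [Category.assoc])

/-- The componentwise right unitor. -/
abbrev commaRightUnitor (X : Comma L R) : commaTensor X commaUnit ≅ X :=
  Comma.isoMk (ρ_ _) (ρ_ _) (by
    have h : (X.hom ⊗ₘ (η L ≫ ε R)) = _ ◁ η L ≫ X.hom ▷ _ ≫ _ ◁ ε R := by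
      rw [MonoidalCategory.tensorHom_def', whiskerLeft_comp, Category.assoc, whisker_exchange]
    dsimp only
    rw [h]
    simp only [Category.assoc]
    rw [← Functor.LaxMonoidal.right_unitality, rightUnitor_naturality, ← Functor.OplaxMonoidal.right_unitality_hom]
    simp only [Category.assoc])

variable (L R)

/-- The componentwise tensor product on a comma category. -/
abbrev commaMonoidal : MonoidalCategory (Comma L R) where
  tensorObj := commaTensor
  tensorHom := commaTensorHom
  whiskerLeft X Y Y' f :=
    { left := X.left ◁ f.left
      right := X.right ◁ f.right
      w := by simpa using (commaTensorHom (𝟙 X) f).w }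
  whiskerRight f Y :=
    { left := f.left ▷ Y.left
      right := f.right ▷ Y.right
      w := by simpa using (commaTensorHom f (𝟙 Y)).w }
  tensorUnit := commaUnit
  associator := commaAssociator
  leftUnitor := commaLeftUnitor
  rightUnitor := commaRightUnitor
  tensorHom_def f g := by ext <;> simp [MonoidalCategory.tensorHom_def]
  id_tensorHom_id _ _ := by ext <;> simp
  tensorHom_comp_tensorHom _ _ _ _ := by ext <;> simp
  whiskerLeft_id _ _ := by ext <;> simp
  id_whiskerRight _ _ := by ext <;> simp
  associator_naturality _ _ _ := by ext <;> simp
  leftUnitor_naturality _ := by ext <;> simp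
  rightUnitor_naturality _ := by ext <;> simp
  pentagon _ _ _ _ := by ext <;> simp
  triangle _ _ := by ext <;> simp

variable [SymmetricCategory A] [SymmetricCategory B] [SymmetricCategory T]

/-- The componentwise symmetry on a comma category. -/
abbrev commaSymmetric
    (hL : ∀ X Y, δ L X Y ≫ (β_ (L.obj X) (L.obj Y)).hom = L.map (β_ X Y).hom ≫ δ L Y X)
    (hR : ∀ X Y, μ R X Y ≫ R.map (β_ X Y).hom = (β_ (R.obj X) (R.obj Y)).hom ≫ μ R Y X) :
    letI := commaMonoidal L R
    SymmetricCategory (Comma L R) :=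
  letI := commaMonoidal L R
  { braiding X Y := Comma.isoMk (β_ X.left Y.left) (β_ X.right Y.right) (by
      change L.map (β_ X.left Y.left).hom ≫
          δ L Y.left X.left ≫ (Y.hom ⊗ₘ X.hom) ≫ μ R Y.right X.right =
        (δ L X.left Y.left ≫ (X.hom ⊗ₘ Y.hom) ≫ μ R X.right Y.right) ≫
          R.map (β_ X.right Y.right).hom
      rw [Category.assoc, Category.assoc, hR X.right Y.right,
        BraidedCategory.braiding_naturality_assoc, ← Category.assoc, ← hL, Category.assoc])
    braiding_naturality_right X _ _ f := CommaMorphism.ext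
      (BraidedCategory.braiding_naturality_right X.left f.left)
      (BraidedCategory.braiding_naturality_right X.right f.right)
    braiding_naturality_left f X := CommaMorphism.ext
      (BraidedCategory.braiding_naturality_left f.left X.left)
      (BraidedCategory.braiding_naturality_left f.right X.right)
    hexagon_forward X Y Z := CommaMorphism.ext
      (BraidedCategory.hexagon_forward X.left Y.left Z.left)
      (BraidedCategory.hexagon_forward X.right Y.right Z.right)
    hexagon_reverse X Y Z := CommaMorphism.ext
      (BraidedCategory.hexagon_reverse X.left Y.left Z.left)
      (BraidedCategory.hexagon_reverse X.right Y.right Z.right)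
    symmetry X Y := CommaMorphism.ext
      (SymmetricCategory.symmetry X.left Y.left)
      (SymmetricCategory.symmetry X.right Y.right) }

end CommaMonoidal

/-- The inclusion of dg rational vector spaces as dg `ℚ[W]`-modules with trivial action. -/
@[simps]
def trivW : DgQ ⥤ DgQW where
  obj M := Action.trivial W₂ M
  map f := { hom := f }

instance : MonoidalCategory DgQW := inferInstance
instance : SymmetricCategory DgQW := inferInstance
instance : MonoidalCategory (ℕ+ → DgQW) := Pi.monoidalCategory
instance : SymmetricCategory (ℕ+ → DgQW) := Pi.symmetricCategory

instance : trivW.OplaxMonoidal where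
  η := { hom := 𝟙 _ }
  δ X Y :=
    { hom := 𝟙 _
      comm g := by
        change 𝟙 _ ≫ 𝟙 _ = 𝟙 _ ≫ (𝟙 X ⊗ₘ 𝟙 Y)
        simp }
  δ_natural_left f Z := Action.Hom.ext ((Category.id_comp _).trans (Category.comp_id _).symm)
  δ_natural_right f Z := Action.Hom.ext ((Category.id_comp _).trans (Category.comp_id _).symm)
  oplax_associativity X Y Z := Action.Hom.ext (by
    simp only [Action.comp_hom, Action.associator_hom_hom, Action.whiskerLeft_hom,
      Action.whiskerRight_hom]
    change 𝟙 _ ≫ 𝟙 _ ▷ Z ≫ (α_ X Y Z).hom = (α_ X Y Z).hom ≫ 𝟙 _ ≫ X ◁ 𝟙 _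
    simp)
  oplax_left_unitality X := Action.Hom.ext (by
    rw [Action.leftUnitor_inv_hom, Action.comp_hom, Action.comp_hom, Action.whiskerRight_hom]
    change (λ_ X).inv = (λ_ X).inv ≫ 𝟙 _ ≫ 𝟙 _ ▷ X
    simp)
  oplax_right_unitality X := Action.Hom.ext (by
    rw [Action.rightUnitor_inv_hom, Action.comp_hom, Action.comp_hom, Action.whiskerLeft_hom]
    change (ρ_ X).inv = (ρ_ X).inv ≫ 𝟙 _ ≫ X ◁ 𝟙 _
    simp)

/-- `V ↦ colim_n ∏_{k ≥ n} V k`. -/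
def germs : (ℕ+ → DgQW) ⥤ DgQW := tails DgQW ⋙ colim

instance : (colim : (ℕ+ ⥤ DgQW) ⥤ DgQW).LaxMonoidal := colimLaxMonoidal
instance : (tails DgQW).LaxMonoidal := tailsLaxMonoidal
instance : germs.LaxMonoidal := inferInstanceAs (tails DgQW ⋙ colim).LaxMonoidal
instance : germs.LaxBraided := inferInstanceAs (tails DgQW ⋙ colim).LaxBraided

/-- The category `𝒜(𝒟)`: an object `V` consists of `V.left = V_∞`, of `V.right k = V_k` for `k ≥ 1`
and of `V.hom = σ_V : V_∞ ⟶ colim_n ∏_{k ≥ n} V_k`; a map consists of maps `f_∞` and `f_k`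
commuting with the structure maps. -/
abbrev AD := Comma trivW germs

/-- The stalkwise tensor product on `𝒜(𝒟)`. -/
instance : MonoidalCategory AD := commaMonoidal trivW germs

instance : SymmetricCategory AD := commaSymmetric trivW germs
  (fun _ _ ↦ Action.Hom.ext ((Category.id_comp _).trans (Category.comp_id _).symm))
  (fun X Y ↦ Functor.LaxBraided.braided X Y)

section Generators

open ZeroObject HomologicalComplex

lemma down_rel (n : ℤ) : (ComplexShape.down ℤ).Rel n (n - 1) := sub_add_cancel n 1

lemma ne_sub_one (n : ℤ) : n ≠ n - 1 := by lia

/-- `S^n M`: the complex with `M` in degree `n` and `0` elsewhere. -/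
abbrev sphere (n : ℤ) : VectQ ⥤ DgQ := single VectQ (ComplexShape.down ℤ) n

/-- `D^n M`: the complex with `M` in degrees `n` and `n - 1` and `0` elsewhere, the differential
from degree `n` to degree `n - 1` being the identity. -/
def disc (n : ℤ) : VectQ ⥤ DgQ where
  obj M := double (𝟙 M) (down_rel n)
  map {M N} f := mkHomFromDouble (down_rel n) (ne_sub_one n)
    (f ≫ (doubleXIso₀ (𝟙 N) (down_rel n)).inv)
    (f ≫ (doubleXIso₁ (𝟙 N) (down_rel n) (ne_sub_one n)).inv)
    (by simp [double_d _ _ (ne_sub_one n)])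
    (fun k _ ↦ by rw [double_d_eq_zero₀ _ _ _ _ (ne_sub_one n).symm, comp_zero])
  map_id M := by ext <;> simp
  map_comp f g := by ext <;> simp

/-- The inclusion `S^{n-1} M ⟶ D^n M`. -/
def sphereToDiscApp (n : ℤ) (M : VectQ) :
    (sphere (n - 1)).obj M ⟶ double (𝟙 M) (down_rel n) :=
  mkHomFromSingle (doubleXIso₁ (𝟙 M) (down_rel n) (ne_sub_one n)).inv
    (fun k _ ↦ by rw [double_d_eq_zero₀ _ _ _ _ (ne_sub_one n).symm, comp_zero])

/-- The inclusions `S^{n-1} M ⟶ D^n M` are natural in `M`. -/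
def sphereToDisc (n : ℤ) : sphere (n - 1) ⟶ disc n where
  app M := sphereToDiscApp n M
  naturality M N f := by
    apply from_single_hom_ext
    simp [disc, sphereToDiscApp, mkHomFromSingle_f, single_map_f_self]

/-- The elements `S^{n-1} ℚ ⟶ D^n ℚ` of `I_ℚ`. -/
def genCofQ (n : ℤ) :
    (sphere (n - 1)).obj (ModuleCat.of ℚ ℚ) ⟶ (disc n).obj (ModuleCat.of ℚ ℚ) :=
  (sphereToDisc n).app _

/-- The elements `0 ⟶ D^n ℚ` of `J_ℚ`. -/
def genTrivCofQ (n : ℤ) : (0 : DgQ) ⟶ (disc n).obj (ModuleCat.of ℚ ℚ) := 0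

/-- The group ring `ℚ[W]`, as a `ℚ[W]`-module. -/
def groupRingQW : Action VectQ W₂ :=
  ((ModuleCat.free ℚ).mapAction W₂).obj (Action.leftRegular W₂)

/-- The elements `S^{n-1} ℚ[W] ⟶ D^n ℚ[W]` of `I_{ℚ[W]}`. -/
def genCofQW (n : ℤ) :
    ((sphere (n - 1)).mapAction W₂).obj groupRingQW ⟶ ((disc n).mapAction W₂).obj groupRingQW where
  hom := (sphereToDisc n).app _
  comm g := (sphereToDisc n).naturality (groupRingQW.ρ g)

/-- The elements `0 ⟶ D^n ℚ[W]` of `J_{ℚ[W]}`. -/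
def genTrivCofQW (n : ℤ) : (0 : DgQW) ⟶ ((disc n).mapAction W₂).obj groupRingQW := 0

/-- The canonical map `∏_{k ≥ n} V k ⟶ colim_n ∏_{k ≥ n} V k`. -/
def toGerms (V : ℕ+ → DgQW) (n : ℕ+) : tailProd V n ⟶ germs.obj V :=
  colimit.ι ((tails DgQW).obj V) n

lemma toGerms_naturality {V V' : ℕ+ → DgQW} (f : V ⟶ V') (n : ℕ+) :
    tailMap f n ≫ toGerms V' n = toGerms V n ≫ germs.map f :=
  (ι_colimMap ((tails DgQW).map f) n).symm

/-- The map `M ⟶ ∏_{k ≥ 1} M ⟶ colim_n ∏_{k ≥ n} M` induced by the diagonal. -/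
def diagGerm (M : DgQ) : trivW.obj M ⟶ germs.obj (fun _ ↦ trivW.obj M) :=
  tailLift (V := fun _ ↦ trivW.obj M) (n := 1) (fun _ ↦ 𝟙 (trivW.obj M)) ≫
    toGerms (fun _ ↦ trivW.obj M) 1

lemma diagGerm_naturality {M N : DgQ} (f : M ⟶ N) :
    trivW.map f ≫ diagGerm N = diagGerm M ≫ germs.map (X := fun _ ↦ trivW.obj M)
      (Y := fun _ ↦ trivW.obj N) (fun _ ↦ trivW.map f) := by
  have h : trivW.map f ≫ tailLift (V := fun _ ↦ trivW.obj N) (n := 1) (fun _ ↦ 𝟙 (trivW.obj N)) =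
      tailLift (V := fun _ ↦ trivW.obj M) (n := 1) (fun _ ↦ 𝟙 (trivW.obj M)) ≫
        tailMap (fun _ ↦ trivW.map f) 1 := tail_ext fun k ↦ by
    simp only [Category.assoc, tailMap_π, tailLift_π, tailLift_π_assoc, Category.comp_id,
      Category.id_comp]
  unfold diagGerm
  rw [reassoc_of% h, Category.assoc]
  exact congrArg (_ ≫ ·) (toGerms_naturality (V := fun _ ↦ trivW.obj M)
    (V' := fun _ ↦ trivW.obj N) (fun _ ↦ trivW.map f) 1)

/-- The constant object functor `c`: `(c M)_∞ = M`, `(c M)_k = M`, with structure map induced by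
the diagonal. -/
def constAD : DgQ ⥤ AD where
  obj M :=
    { left := M
      right := fun _ ↦ trivW.obj M
      hom := diagGerm M }
  map f :=
    { left := f
      right := fun _ ↦ trivW.map f
      w := diagGerm_naturality f }

/-- The functor `i_k`: `(i_k R)_k = R`, and `(i_k R)_l = 0` for `l ≠ k`, including `l = ∞`. -/
def skyAD (k : ℕ+) : DgQW ⥤ AD where
  obj R :=
    { left := 0
      right := (GradedObject.single k).obj R
      hom := 0 }
  map f :=
    { left := 0
      right := (GradedObject.single k).map f
      w := by simp }

/-- The set `I = c I_ℚ ∪ ⋃_k i_k I_{ℚ[W]}`. -/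
def genCof : MorphismProperty AD :=
  MorphismProperty.ofHoms (fun n : ℤ ↦ constAD.map (genCofQ n)) ⊔
    MorphismProperty.ofHoms (fun p : ℕ+ × ℤ ↦ (skyAD p.1).map (genCofQW p.2))

/-- The set `J = c J_ℚ ∪ ⋃_k i_k J_{ℚ[W]}`. -/
def genTrivCof : MorphismProperty AD :=
  MorphismProperty.ofHoms (fun n : ℤ ↦ constAD.map (genTrivCofQ n)) ⊔
    MorphismProperty.ofHoms (fun p : ℕ+ × ℤ ↦ (skyAD p.1).map (genTrivCofQW p.2))

end Generators

/-- Weak equivalences of the projective model structure on dg `ℚ`-modules. -/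
def weqQ : MorphismProperty DgQ := fun _ _ f ↦ QuasiIso f

/-- Fibrations of the projective model structure on dg `ℚ`-modules: degreewise surjections. -/
def fibQ : MorphismProperty DgQ := fun _ _ f ↦ ∀ n : ℤ, Function.Surjective (f.f n)

/-- Weak equivalences of the projective model structure on dg `ℚ[W]`-modules. -/
def weqQW : MorphismProperty DgQW := fun _ _ f ↦ weqQ f.hom

/-- Fibrations of the projective model structure on dg `ℚ[W]`-modules. -/
def fibQW : MorphismProperty DgQW := fun _ _ f ↦ fibQ f.hom

/-- Stalkwise weak equivalences. -/
def stalkWeq : MorphismProperty AD := fun _ _ f ↦ weqQ f.left ∧ ∀ k : ℕ+, weqQW (f.right k)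

/-- Stalkwise fibrations. -/
def stalkFib : MorphismProperty AD := fun _ _ f ↦ fibQ f.left ∧ ∀ k : ℕ+, fibQW (f.right k)

section ModelPredicates

open HomotopicalAlgebra MonoidalCategory

universe u

variable (C : Type u) [Category.{0} C]

variable {C} in
/-- `I`-cell: transfinite compositions of pushouts of maps in `I`. -/
def relCell (I : MorphismProperty C) : MorphismProperty C :=
  MorphismProperty.transfiniteCompositions.{0} I.pushouts

variable {C} in
/-- `A` is small relative to `P`: for some cardinal `κ`, mapping out of `A` commutes with the
colimits of all `λ`-sequences of maps in `P`, for all `κ`-filtered limit ordinals `λ`. Ordinals are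
represented by well-ordered types. -/
def IsSmallRel (A : C) (P : MorphismProperty C) : Prop :=
  ∃ κ : Cardinal.{0}, ∀ (J : Type) [LinearOrder J] [SuccOrder J] [OrderBot J] [WellFoundedLT J]
    [NoMaxOrder J], (∀ S : Set J, Cardinal.mk S ≤ κ → BddAbove S) →
    ∀ (X Y : C) (f : X ⟶ Y) (h : P.TransfiniteCompositionOfShape J f),
      PreservesColimit h.F (coyoneda.obj (Opposite.op A))

variable [ModelCategory C]

/-- All small limits and colimits exist, and the factorizations can be chosen functorially. -/
structure IsCompleteFunctorial : Prop where
  hasLimits : HasLimitsOfSize.{0, 0} C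
  hasColimits : HasColimitsOfSize.{0, 0} C
  factor_cof : MorphismProperty.HasFunctorialFactorization (cofibrations C) (trivialFibrations C)
  factor_trivCof :
    MorphismProperty.HasFunctorialFactorization (trivialCofibrations C) (fibrations C)

variable {C} in
/-- The model category `C` is cofibrantly generated, with generating cofibrations `I` and
generating trivial cofibrations `J`. -/
structure IsCofibrantlyGeneratedBy (I J : MorphismProperty C) : Prop where
  isSmall_cof : MorphismProperty.IsSmall.{0} I
  isSmall_trivCof : MorphismProperty.IsSmall.{0} J
  small_cof : ∀ ⦃A B : C⦄ (f : A ⟶ B), I f → IsSmallRel A (relCell I)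
  small_trivCof : ∀ ⦃A B : C⦄ (f : A ⟶ B), J f → IsSmallRel A (relCell J)
  fibrations_eq : fibrations C = J.rlp
  trivialFibrations_eq : trivialFibrations C = I.rlp

/-- Left and right properness. -/
structure IsProperModel : Prop where
  left : ∀ ⦃X Y X' Y' : C⦄ (f : X ⟶ Y) (i : X ⟶ X') (i' : Y ⟶ Y') (f' : X' ⟶ Y'),
    IsPushout f i i' f' → WeakEquivalence f → Cofibration i → WeakEquivalence f'
  right : ∀ ⦃X Y X' Y' : C⦄ (f' : X' ⟶ Y') (p' : X' ⟶ X) (p : Y' ⟶ Y) (f : X ⟶ Y),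
    IsPullback f' p' p f → WeakEquivalence f → Fibration p → WeakEquivalence f'

variable [MonoidalCategory C] [SymmetricCategory C]

/-- The (symmetric) monoidal model category axioms: the monoidal structure is closed, the
pushout-product axiom holds, and tensoring a cofibrant object with a cofibrant replacement of the
unit is a weak equivalence. -/
structure IsMonoidalModel : Prop where
  closed : Nonempty (MonoidalClosed C)
  pushoutProduct_cof : ∀ ⦃X₁ X₂ Y₁ Y₂ : C⦄ (i : X₁ ⟶ X₂) (j : Y₁ ⟶ Y₂)
    (sq : (curriedTensor C).PushoutObjObj i j), Cofibration i → Cofibration j → Cofibration sq.ι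
  pushoutProduct_weq : ∀ ⦃X₁ X₂ Y₁ Y₂ : C⦄ (i : X₁ ⟶ X₂) (j : Y₁ ⟶ Y₂)
    (sq : (curriedTensor C).PushoutObjObj i j), Cofibration i → Cofibration j →
      WeakEquivalence i ∨ WeakEquivalence j → WeakEquivalence sq.ι
  unit_left : ∀ ⦃Q : C⦄ (q : Q ⟶ 𝟙_ C) (X : C), IsCofibrant Q → WeakEquivalence q →
    IsCofibrant X → WeakEquivalence (q ▷ X)
  unit_right : ∀ ⦃Q : C⦄ (q : Q ⟶ 𝟙_ C) (X : C), IsCofibrant Q → WeakEquivalence q →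
    IsCofibrant X → WeakEquivalence (X ◁ q)

/-- The class of maps `j ⊗ Z` with `j` a trivial cofibration and `Z` any object. -/
inductive trivCofTensor : MorphismProperty C
  | whiskerRight {X Y : C} (j : X ⟶ Y) (Z : C) (hj : trivialCofibrations C j) :
    trivCofTensor (j ▷ Z)

/-- The monoid axiom: transfinite compositions of pushouts of maps `j ⊗ Z`, with `j` a trivial
cofibration, are weak equivalences. -/
def MonoidAxiom : Prop := relCell (trivCofTensor C) ≤ weakEquivalences C

end ModelPredicates

end DihedralModel

end

open DihedralModel HomotopicalAlgebra

/-!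
Over `ℚ` an acyclic complex is contractible, so a monomorphism of complexes lifts against every
surjective quasi-isomorphism, and averaging over `W` gives the same for complexes with action.
Hence in both categories of stalks the cofibrations are the monomorphisms, and everything in
`𝒜(𝒟)` that only involves colimits and tensor products can be checked on stalks: the stalk functors
preserve both, and they have right adjoints that preserve fibrations, so that maps with a left
lifting property in `𝒜(𝒟)` have it on every stalk.

What is left is lifting in `𝒜(𝒟)` itself. The functor `i_k` is left adjoint to the stalk at `k`.
If `M` is finitely presentable, a map `cM ⟶ X` consists of a map `M ⟶ X_∞` and of equivariant maps
`M ⟶ X_k` which represent its germ from some stage on. A lifting problem against `c(M ⟶ N)` is thus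
solved by first lifting at `∞`, then representing the germ of that lift, and finally choosing lifts
at the finitely many remaining stalks. The same description shows that the domains of `I` and `J`
are finitely presentable, so the small object argument applies.

For the pushout-product axiom it suffices to treat the generators: `c` is strong monoidal and
preserves pushouts, and a tensor product with an object concentrated at `k` is concentrated at `k`.
Limits and internal homs come from the special adjoint functor theorem: the objects `c(D^n ℚ)` and
`i_k(D^n ℚ[W])` form a small separating set, there is a small coseparating set as well, and the
tensor product preserves colimits.
-/

noncomputable section

namespace DihedralModel

open scoped ZeroObject

/-! ### Acyclic complexes, and complexes over a semisimple category -/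

section Contractible

open HomologicalComplex

variable {C ι : Type*} [Category* C] [Preadditive C] {c : ComplexShape ι}
  {P K L A B : HomologicalComplex C c}

/-- A complex is contractible if its identity is homotopic to zero. -/
def Contractible (K : HomologicalComplex C c) : Prop := Nonempty (Homotopy (𝟙 K) 0)

lemma Contractible.of_iso (hK : Contractible K) (e : K ≅ L) : Contractible L := by
  obtain ⟨H⟩ := hK
  exact ⟨(Homotopy.ofEq (by simp)).trans (((H.compLeft e.inv).compRight e.hom).trans
    (Homotopy.ofEq (by simp)))⟩

lemma Contractible.exists_nullHomotopicMap_eq_id (hP : Contractible P) :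
    ∃ h : ∀ i j, P.X i ⟶ P.X j, Homotopy.nullHomotopicMap h = 𝟙 P := by
  obtain ⟨H⟩ := hP
  refine ⟨H.hom, ?_⟩
  ext n
  exact ((H.comm n).trans (add_zero _)).symm

lemma Contractible.exists_lift (hP : Contractible P) (p : K ⟶ L) (v : P ⟶ L)
    (hv : ∀ n, ∃ g, g ≫ p.f n = v.f n) : ∃ h : P ⟶ K, h ≫ p = v := by
  obtain ⟨H, hH⟩ := hP.exists_nullHomotopicMap_eq_id
  choose g hg using hv
  refine ⟨Homotopy.nullHomotopicMap fun i j ↦ H i j ≫ g j, ?_⟩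
  rw [Homotopy.nullHomotopicMap_comp]
  simp only [Category.assoc, hg]
  rw [← Homotopy.nullHomotopicMap_comp, hH, Category.id_comp]

lemma Contractible.exists_extension (hP : Contractible P) (i : A ⟶ B) (u : A ⟶ P)
    (hu : ∀ n, ∃ g, i.f n ≫ g = u.f n) : ∃ h : B ⟶ P, i ≫ h = u := by
  obtain ⟨H, hH⟩ := hP.exists_nullHomotopicMap_eq_id
  choose g hg using hu
  refine ⟨Homotopy.nullHomotopicMap fun i j ↦ g i ≫ H i j, ?_⟩
  rw [Homotopy.comp_nullHomotopicMap]
  simp only [← Category.assoc, hg]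
  rw [← Homotopy.comp_nullHomotopicMap, hH, Category.comp_id]

lemma Contractible.homotopyEquivalences_of_section (hP : Contractible P) {p : K ⟶ L} {s : L ⟶ K}
    {r : K ⟶ P} {j : P ⟶ K} (hs : s ≫ p = 𝟙 L) (hK : r ≫ j + p ≫ s = 𝟙 K) :
    homotopyEquivalences C c p := by
  obtain ⟨H⟩ := hP
  have hrj : Homotopy (r ≫ j) 0 := (Homotopy.ofEq (by simp)).trans
    (((H.compLeft r).compRight j).trans (Homotopy.ofEq (by simp)))
  exact ⟨{
    hom := p
    inv := s
    homotopyHomInvId := (Homotopy.ofEq (zero_add _).symm).trans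
      ((hrj.symm.add (Homotopy.refl (p ≫ s))).trans (Homotopy.ofEq hK))
    homotopyInvHomId := Homotopy.ofEq hs }, rfl⟩

lemma Contractible.homotopyEquivalences_of_isZero (hP : Contractible P) (hL : IsZero L)
    (p : P ⟶ L) : homotopyEquivalences C c p :=
  hP.homotopyEquivalences_of_section (s := hL.to_ P) (r := 𝟙 P) (j := 𝟙 P)
    (hL.eq_of_src _ _) (by rw [hL.eq_of_tgt p 0]; simp)

lemma Contractible.homotopyEquivalences_inl
    [HasBinaryBiproducts C] (hP : Contractible P) :
    homotopyEquivalences C c (biprod.inl : A ⟶ A ⊞ P) :=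
  (homotopyEquivalences C c).of_postcomp _ (biprod.fst : A ⊞ P ⟶ A)
    (hP.homotopyEquivalences_of_section (s := biprod.inl) (r := biprod.snd) (j := biprod.inr)
      (by simp) ((add_comm _ _).trans biprod.total))
    (by rw [biprod.inl_fst]; exact .of_isIso _)

lemma Contractible.quasiIso_inl [HasBinaryBiproducts C] [CategoryWithHomology C]
    (hP : Contractible P) : QuasiIso (biprod.inl : A ⟶ A ⊞ P) :=
  homotopyEquivalences_le_quasiIso C c _ hP.homotopyEquivalences_inl

end Contractible

section FiveLemma

open HomologicalComplex HomologySequence ComposableArrows Abelian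

variable {C ι : Type*} [Category* C] [Abelian C] {c : ComplexShape ι}

section

variable {S₁ S₂ : ShortComplex (HomologicalComplex C c)} (φ : S₁ ⟶ S₂)

lemma mono_homologyMap_τ₂ (hS₁ : S₁.ShortExact) (hS₂ : S₂.ShortExact)
    (h₁ : QuasiIso φ.τ₁) (h₃ : QuasiIso φ.τ₃) (j : ι) : Mono (homologyMap φ.τ₂ j) := by
  by_cases! hj : ∃ i, c.Rel i j
  · obtain ⟨i, hij⟩ := hj
    apply mono_of_epi_of_mono_of_mono
      ((δ₀Functor ⋙ δ₀Functor).map (mapComposableArrows₅ φ hS₁ hS₂ i j hij))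
    · exact (composableArrows₅_exact hS₁ i j hij).δ₀.δ₀
    · exact (composableArrows₅_exact hS₂ i j hij).δ₀.δ₀
    · exact inferInstanceAs (Epi (homologyMap φ.τ₃ i))
    · exact inferInstanceAs (Mono (homologyMap φ.τ₁ j))
    · exact inferInstanceAs (Mono (homologyMap φ.τ₃ j))
  · have := hS₁.mono_f
    have := hS₂.mono_f
    have : Mono ((homologyFunctor C c j).mapShortComplex.obj S₁).f :=
      mono_homologyMap_of_mono_of_not_rel S₁.f j hj
    have : Mono ((homologyFunctor C c j).mapShortComplex.obj S₂).f :=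
      mono_homologyMap_of_mono_of_not_rel S₂.f j hj
    have : Mono ((homologyFunctor C c j).mapShortComplex.map φ).τ₁ :=
      inferInstanceAs (Mono (homologyMap φ.τ₁ j))
    have : Mono ((homologyFunctor C c j).mapShortComplex.map φ).τ₃ :=
      inferInstanceAs (Mono (homologyMap φ.τ₃ j))
    exact ShortComplex.mono_τ₂_of_exact_of_mono
      ((homologyFunctor C c j).mapShortComplex.map φ) (hS₁.homology_exact₂ j)

lemma epi_homologyMap_τ₂ (hS₁ : S₁.ShortExact) (hS₂ : S₂.ShortExact)
    (h₁ : QuasiIso φ.τ₁) (h₃ : QuasiIso φ.τ₃) (i : ι) : Epi (homologyMap φ.τ₂ i) := by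
  by_cases! hi : ∃ j, c.Rel i j
  · obtain ⟨j, hij⟩ := hi
    apply epi_of_epi_of_epi_of_mono
      ((δlastFunctor ⋙ δlastFunctor).map (mapComposableArrows₅ φ hS₁ hS₂ i j hij))
    · exact (composableArrows₅_exact hS₁ i j hij).δlast.δlast
    · exact (composableArrows₅_exact hS₂ i j hij).δlast.δlast
    · exact inferInstanceAs (Epi (homologyMap φ.τ₁ i))
    · exact inferInstanceAs (Epi (homologyMap φ.τ₃ i))
    · exact inferInstanceAs (Mono (homologyMap φ.τ₁ j))
  · have := hS₁.epi_g
    have := hS₂.epi_g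
    have : Epi ((homologyFunctor C c i).mapShortComplex.obj S₁).g :=
      epi_homologyMap_of_epi_of_not_rel S₁.g i hi
    have : Epi ((homologyFunctor C c i).mapShortComplex.obj S₂).g :=
      epi_homologyMap_of_epi_of_not_rel S₂.g i hi
    have : Epi ((homologyFunctor C c i).mapShortComplex.map φ).τ₁ :=
      inferInstanceAs (Epi (homologyMap φ.τ₁ i))
    have : Epi ((homologyFunctor C c i).mapShortComplex.map φ).τ₃ :=
      inferInstanceAs (Epi (homologyMap φ.τ₃ i))
    exact ShortComplex.epi_τ₂_of_exact_of_epi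
      ((homologyFunctor C c i).mapShortComplex.map φ) (hS₂.homology_exact₂ i)

lemma quasiIso_τ₂ (hS₁ : S₁.ShortExact) (hS₂ : S₂.ShortExact)
    (h₁ : QuasiIso φ.τ₁) (h₃ : QuasiIso φ.τ₃) : QuasiIso φ.τ₂ where
  quasiIsoAt n := by
    have := mono_homologyMap_τ₂ φ hS₁ hS₂ h₁ h₃ n
    have := epi_homologyMap_τ₂ φ hS₁ hS₂ h₁ h₃ n
    rw [quasiIsoAt_iff_isIso_homologyMap]
    exact isIso_of_mono_of_epi _

end

lemma shortExact_cokernel {A B : C} (i : A ⟶ B) [Mono i] :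
    (ShortComplex.mk i (cokernel.π i) (cokernel.condition i)).ShortExact :=
  .mk' (ShortComplex.exact_cokernel i) ‹_› inferInstance

lemma shortExact_kernel {A B : C} (p : A ⟶ B) [Epi p] :
    (ShortComplex.mk (kernel.ι p) p (kernel.condition p)).ShortExact :=
  .mk' (ShortComplex.exact_kernel p) inferInstance ‹_›

variable {X Y X' Y' : HomologicalComplex C c}

lemma quasiIso_of_isPushout_of_mono {f : X ⟶ Y} {i : X ⟶ X'} {i' : Y ⟶ Y'} {f' : X' ⟶ Y'}
    (sq : IsPushout f i i' f') [Mono i] [QuasiIso f] : QuasiIso f' := by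
  have : Mono i' := (MorphismProperty.monomorphisms _).of_isPushout sq ‹Mono i›
  have := isIso_cokernel_map_of_isPushout sq.flip
  let φ : ShortComplex.mk i _ (cokernel.condition i) ⟶
      ShortComplex.mk i' _ (cokernel.condition i') :=
    { τ₁ := f, τ₂ := f', τ₃ := cokernel.map _ _ _ _ sq.flip.w, comm₁₂ := sq.w }
  exact quasiIso_τ₂ φ (shortExact_cokernel i) (shortExact_cokernel i') ‹_›
    (inferInstanceAs (QuasiIso (cokernel.map _ _ _ _ sq.flip.w)))

lemma quasiIso_of_isPullback_of_epi {f' : X' ⟶ Y'} {p' : X' ⟶ X} {p : Y' ⟶ Y} {f : X ⟶ Y}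
    (sq : IsPullback f' p' p f) [Epi p] [QuasiIso f] : QuasiIso f' := by
  have : Epi p' := (MorphismProperty.epimorphisms _).of_isPullback sq ‹Epi p›
  have := isIso_kernel_map_of_isPullback sq.flip
  let φ : ShortComplex.mk _ p' (kernel.condition p') ⟶
      ShortComplex.mk _ p (kernel.condition p) :=
    { τ₁ := kernel.map _ _ _ _ sq.flip.w, τ₂ := f', τ₃ := f, comm₂₃ := sq.w }
  exact quasiIso_τ₂ φ (shortExact_kernel p') (shortExact_kernel p)
    (inferInstanceAs (QuasiIso (kernel.map _ _ _ _ sq.flip.w))) ‹_›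

lemma quasiIso_of_epi_of_acyclic_kernel (p : X ⟶ Y) [Epi p] (h : (kernel p).Acyclic) :
    QuasiIso p := by
  let φ : ShortComplex.mk _ p (kernel.condition p) ⟶
      ShortComplex.mk (0 : 0 ⟶ Y) (𝟙 Y) zero_comp :=
    { τ₁ := 0, τ₂ := p, τ₃ := 𝟙 Y, comm₁₂ := by simp, comm₂₃ := by simp }
  have hY : (ShortComplex.mk (0 : 0 ⟶ Y) (𝟙 Y) zero_comp).ShortExact :=
    (ShortComplex.Splitting.ofIsZeroOfIsIso _ (Limits.isZero_zero _)
      (inferInstanceAs (IsIso (𝟙 Y)))).shortExact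
  exact quasiIso_τ₂ φ (shortExact_kernel p) hY
    ⟨fun n ↦ (quasiIsoAt_iff_exactAt _ n (h n)).2 (acyclic_of_isZero _ (Limits.isZero_zero _) n)⟩
    (inferInstanceAs (QuasiIso (𝟙 Y)))

end FiveLemma

section Semisimple

open HomologicalComplex

lemma shortExact_cycles {C ι : Type*} [Category* C] [Abelian C] {c : ComplexShape ι}
    (K : HomologicalComplex C c) {i j : ι} (hij : c.Rel i j) (hj : K.ExactAt j) :
    (ShortComplex.mk (K.iCycles i) (K.toCycles i j)
      (by simp [← cancel_mono (K.iCycles j)])).ShortExact := by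
  obtain rfl := c.prev_eq' hij
  refine .mk' ?_ inferInstance ((K.sc j).exact_iff_epi_toCycles.1 hj)
  refine ShortComplex.exact_of_f_is_kernel _ (KernelFork.IsLimit.ofι' _ _ fun k hk ↦
    ⟨K.liftCycles k j (c.next_eq' hij) ?_, K.liftCycles_i k j _ _⟩)
  rw [← K.toCycles_i, reassoc_of% hk, zero_comp]

variable {C : Type*} [Category* C] [Abelian C] [∀ X : C, Projective X]
  {A B K L P : ChainComplex C ℤ}

/-- With splittings `r` and `s` of `Z n ⟶ K n ⟶ Z (n - 1)`, a contraction is `r ≫ s`. -/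
lemma contractible_of_acyclic (hK : K.Acyclic) : Contractible K := by
  let σ (i j : ℤ) (hij : (ComplexShape.down ℤ).Rel i j) :=
    (shortExact_cycles K hij (hK j)).splittingOfProjective
  let h (j i : ℤ) (hij : (ComplexShape.down ℤ).Rel i j) : K.X j ⟶ K.X i :=
    (σ j (j - 1) (down_rel j)).r ≫ (σ i j hij).s
  have key : Homotopy.nullHomotopicMap' h = 𝟙 K := by
    ext n
    rw [Homotopy.nullHomotopicMap'_f (k₂ := n + 1) (k₁ := n) (k₀ := n - 1) rfl (down_rel n)]
    have hr : K.toCycles n (n - 1) ≫ K.iCycles (n - 1) ≫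
        (σ (n - 1) (n - 1 - 1) (down_rel _)).r = K.toCycles n (n - 1) :=
      (congrArg _ (σ (n - 1) (n - 1 - 1) (down_rel _)).f_r).trans (Category.comp_id _)
    have hs : (σ (n + 1) n rfl).s ≫ K.toCycles (n + 1) n ≫ K.iCycles n = K.iCycles n :=
      ((σ (n + 1) n rfl).s_g_assoc _)
    have hid := (σ n (n - 1) (down_rel n)).id
    simp only [h, ← K.toCycles_i, Category.assoc, reassoc_of% hr, hs] at hid ⊢
    exact (add_comm _ _).trans hid
  exact ⟨(Homotopy.ofEq key.symm).trans (Homotopy.nullHomotopy' h)⟩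

lemma isSplitMono_of_mono {X Y : C} (i : X ⟶ Y) [Mono i] : IsSplitMono i :=
  (shortExact_cokernel i).splittingOfProjective.isSplitMono_f

lemma contractible_kernel (p : K ⟶ L) [Epi p] [QuasiIso p] : Contractible (kernel p) :=
  contractible_of_acyclic ((shortExact_kernel p).acyclic_X₁ ‹_›)

lemma Contractible.exists_extension_of_mono (hP : Contractible P) (i : A ⟶ B) [Mono i]
    (u : A ⟶ P) : ∃ h : B ⟶ P, i ≫ h = u :=
  hP.exists_extension i u fun n ↦ by
    have := isSplitMono_of_mono (i.f n)
    exact ⟨retraction (i.f n) ≫ u.f n, IsSplitMono.id_assoc _ _⟩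

lemma Contractible.exists_lift_of_epi (hP : Contractible P) (p : K ⟶ L) [Epi p] (v : P ⟶ L) :
    ∃ h : P ⟶ K, h ≫ p = v :=
  hP.exists_lift p v fun n ↦
    ⟨Projective.factorThru (v.f n) (p.f n), Projective.factorThru_comp _ _⟩

lemma nonempty_splitting_kernel (p : K ⟶ L) [Epi p] [QuasiIso p] :
    Nonempty (ShortComplex.mk (kernel.ι p) p (kernel.condition p)).Splitting := by
  obtain ⟨r, hr⟩ := (contractible_kernel p).exists_extension_of_mono (kernel.ι p) (𝟙 _)
  exact ⟨.ofExactOfRetraction _ (shortExact_kernel p).exact r hr ‹_›⟩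

lemma homotopyEquivalences_of_epi (p : K ⟶ L) [Epi p] [QuasiIso p] :
    homotopyEquivalences C _ p := by
  obtain ⟨σ⟩ := nonempty_splitting_kernel p
  exact (contractible_kernel p).homotopyEquivalences_of_section σ.s_g σ.id

/-- The target of a trivial fibration is a summand with contractible complement, so the two
components of a lift can be found separately. -/
lemma hasLiftingProperty_of_mono_of_epi (i : A ⟶ B) (p : K ⟶ L) [Mono i] [Epi p] [QuasiIso p] :
    HasLiftingProperty i p where
  sq_hasLift {u v} sq := by
    obtain ⟨σ⟩ := nonempty_splitting_kernel p
    obtain ⟨e, he⟩ := (contractible_kernel p).exists_extension_of_mono i (u ≫ σ.r)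
    have hσ : σ.r ≫ kernel.ι p + p ≫ σ.s = 𝟙 K := σ.id
    have hs : σ.s ≫ p = 𝟙 L := σ.s_g
    refine ⟨⟨⟨e ≫ kernel.ι p + v ≫ σ.s, ?_, ?_⟩⟩⟩
    · calc i ≫ (e ≫ kernel.ι p + v ≫ σ.s) = u ≫ (σ.r ≫ kernel.ι p + p ≫ σ.s) := by
            simp only [Preadditive.comp_add, reassoc_of% he, ← sq.w_assoc]
        _ = u := by rw [hσ, Category.comp_id]
    · simp only [Preadditive.add_comp, Category.assoc, kernel.condition, comp_zero, zero_add, hs,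
        Category.comp_id]

end Semisimple

section Retracts

def retractArrowInl {C : Type*} [Category* C] [Preadditive C] [HasBinaryBiproducts C] {A B P : C}
    (f : A ⟶ B) (q : P ⟶ B) [HasLiftingProperty f (biprod.desc f q)] :
    RetractArrow f (biprod.inl : A ⟶ A ⊞ P) :=
  .ofLeftLiftingProperty (p := biprod.desc f q) (biprod.inl_desc f q)

open HomologicalComplex

variable {C : Type*} [Category* C] [Abelian C] {A B K L P : ChainComplex C ℤ}

lemma Contractible.quasiIso_biprodDesc (hP : Contractible P) (f : A ⟶ B) (q : P ⟶ B)
    [QuasiIso f] : QuasiIso (biprod.desc f q) := by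
  have := hP.quasiIso_inl (A := A)
  have : QuasiIso (biprod.inl ≫ biprod.desc f q) := by rwa [biprod.inl_desc]
  exact quasiIso_of_comp_left biprod.inl _

lemma Contractible.quasiIso_of_hasLiftingProperty (hP : Contractible P) (f : A ⟶ B) (q : P ⟶ B)
    [HasLiftingProperty f (biprod.desc f q)] : QuasiIso f :=
  (quasiIso C _).of_retract (retractArrowInl f q) hP.quasiIso_inl

variable [∀ X : C, Projective X]

lemma Contractible.hasLiftingProperty_inl (hP : Contractible P) (p : K ⟶ L) [Epi p] :
    HasLiftingProperty (biprod.inl : A ⟶ A ⊞ P) p where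
  sq_hasLift {u v} sq := by
    obtain ⟨h, hh⟩ := hP.exists_lift_of_epi p (biprod.inr ≫ v)
    exact ⟨⟨⟨biprod.desc u h, by simp, biprod.hom_ext' _ _ (by simp [sq.w]) (by simp [hh])⟩⟩⟩

lemma Contractible.homotopyEquivalences_of_quasiIso (hP : Contractible P) (f : A ⟶ B) (q : P ⟶ B)
    [Epi q] [QuasiIso f] : homotopyEquivalences C _ f := by
  have := hP.quasiIso_biprodDesc f q
  have : Epi (biprod.desc f q) := epi_of_epi_fac (biprod.inr_desc f q)
  rw [← biprod.inl_desc f q]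
  exact (homotopyEquivalences C _).comp_mem _ _ hP.homotopyEquivalences_inl
    (homotopyEquivalences_of_epi _)

lemma Contractible.hasLiftingProperty_of_mono (hP : Contractible P) (f : A ⟶ B) (q : P ⟶ B)
    [Epi q] [Mono f] [QuasiIso f] (p : K ⟶ L) [Epi p] : HasLiftingProperty f p := by
  have := hP.quasiIso_biprodDesc f q
  have : Epi (biprod.desc f q) := epi_of_epi_fac (biprod.inr_desc f q)
  have := hasLiftingProperty_of_mono_of_epi f (biprod.desc f q)
  have := hP.hasLiftingProperty_inl (A := A) p
  exact (retractArrowInl f q).leftLiftingProperty p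

end Retracts

/-! ### Rational complexes -/

section Tensor

open MonoidalCategory

variable {C : Type*} [Category* C] [Abelian C] [MonoidalCategory C]

/-- Four lemma: the cokernels of `A ⊗ Y ⟶ P` and `A ⊗ Y ⟶ B ⊗ Y` are `D ⊗ X` and `D ⊗ Y`, where
`D` is the cokernel of `f`. -/
lemma mono_pushoutProduct [∀ X : C, (tensorRight X).PreservesMonomorphisms]
    [∀ X : C, (tensorLeft X).PreservesMonomorphisms]
    [∀ X : C, PreservesColimitsOfShape WalkingParallelPair (tensorRight X)]
    [∀ X : C, (tensorRight X).PreservesZeroMorphisms]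
    {A B X Y P : C} {f : A ⟶ B} {g : X ⟶ Y} [Mono f] [Mono g]
    {inl : B ⊗ X ⟶ P} {inr : A ⊗ Y ⟶ P} (sq : IsPushout (f ▷ X) (A ◁ g) inl inr)
    (ι : P ⟶ B ⊗ Y) (hl : inl ≫ ι = B ◁ g) (hr : inr ≫ ι = f ▷ Y) : Mono ι := by
  have : Mono (f ▷ X) := inferInstanceAs (Mono ((tensorRight X).map f))
  have : Mono (f ▷ Y) := inferInstanceAs (Mono ((tensorRight Y).map f))
  have : Mono (cokernel f ◁ g) := inferInstanceAs (Mono ((tensorLeft (cokernel f)).map g))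
  have : Mono inr := (MorphismProperty.monomorphisms C).of_isPushout sq.flip ‹Mono (f ▷ X)›
  have := isIso_cokernel_map_of_isPushout sq
  let eX : cokernel f ⊗ X ≅ cokernel (f ▷ X) := PreservesCokernel.iso (tensorRight X) f
  let eY : cokernel f ⊗ Y ≅ cokernel (f ▷ Y) := PreservesCokernel.iso (tensorRight Y) f
  have hX : cokernel.π f ▷ X ≫ eX.hom = cokernel.π (f ▷ X) :=
    PreservesCokernel.π_iso_hom (tensorRight X) f
  have hY : cokernel.π f ▷ Y ≫ eY.hom = cokernel.π (f ▷ Y) :=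
    PreservesCokernel.π_iso_hom (tensorRight Y) f
  let φ : ShortComplex.mk inr _ (cokernel.condition inr) ⟶
      ShortComplex.mk (f ▷ Y) _ (cokernel.condition (f ▷ Y)) :=
    { τ₁ := 𝟙 _, τ₂ := ι, τ₃ := cokernel.map _ _ (𝟙 _) ι (by simp [hr]) }
  have h₃ : cokernel.map _ _ _ _ sq.w ≫ φ.τ₃ = eX.inv ≫ cokernel f ◁ g ≫ eY.hom := by
    have : Epi (cokernel.π f ▷ X) := inferInstanceAs (Epi ((tensorRight X).map _))
    rw [← cancel_epi eX.hom, eX.hom_inv_id_assoc, ← cancel_epi (cokernel.π f ▷ X)]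
    simp only [reassoc_of% hX, φ, cokernel.π_desc, cokernel.π_desc_assoc, Category.assoc,
      ← whisker_exchange_assoc, hY, reassoc_of% hl]
  have : Mono φ.τ₃ := by
    rw [← IsIso.eq_inv_comp] at h₃
    rw [h₃]
    infer_instance
  have : Mono φ.τ₁ := inferInstanceAs (Mono (𝟙 _))
  exact ShortComplex.mono_τ₂_of_exact_of_mono φ (ShortComplex.exact_cokernel inr)

end Tensor

lemma hasLiftingProperty_kernel {C : Type*} [Category* C] [HasZeroMorphisms C] [HasZeroObject C]
    {A B X Y : C} (i : A ⟶ B) (p : X ⟶ Y) [HasKernel p] [HasLiftingProperty i p] :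
    HasLiftingProperty i (0 : kernel p ⟶ 0) where
  sq_hasLift {u v} _ := by
    have sq : CommSq (u ≫ kernel.ι p) i p 0 := ⟨by simp⟩
    exact ⟨⟨⟨kernel.lift p sq.lift sq.fac_right, by simp [← cancel_mono (kernel.ι p)],
      (isZero_zero C).eq_of_tgt _ _⟩⟩⟩

lemma mono_of_hasLiftingProperty_zero {C : Type*} [Category* C] [HasZeroMorphisms C]
    [HasZeroObject C] {A B T : C} (f : A ⟶ B) (j : A ⟶ T) [Mono j]
    [HasLiftingProperty f (0 : T ⟶ 0)] : Mono f := by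
  have sq : CommSq j f (0 : T ⟶ 0) 0 := ⟨by simp⟩
  exact mono_of_mono_fac sq.fac_left

instance (X : VectQ) : Projective X :=
  have : Module.Projective ℚ X := Module.Projective.of_free
  ModuleCat.projective_of_categoryTheory_projective X

namespace DgQ

open HomologicalComplex

variable {A B K L X Y : DgQ}

lemma epi_iff {f : K ⟶ L} : Epi f ↔ fibQ f := by
  simp only [fibQ, ← ModuleCat.epi_iff_surjective]
  exact ⟨fun _ n ↦ inferInstanceAs (Epi ((eval VectQ _ n).map f)), fun h ↦ epi_of_epi_f _ h⟩

instance (X : DgQ) : (MonoidalCategory.tensorRight X).PreservesMonomorphisms where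
  preserves f _ := by
    have (n : ℤ) : IsSplitMono (f.f n) := isSplitMono_of_mono _
    have : IsSplitMono ((forget VectQ (ComplexShape.down ℤ)).map f) :=
      ⟨⟨⟨fun n ↦ (this n).exists_splitMono.some.retraction,
        funext fun n ↦ (this n).exists_splitMono.some.id⟩⟩⟩
    have : Mono ((forget VectQ (ComplexShape.down ℤ)).map (f ▷ X)) :=
      inferInstanceAs (Mono ((MonoidalCategory.tensorRight (C := GradedObject ℤ VectQ) X.X).map
        ((forget VectQ (ComplexShape.down ℤ)).map f)))
    exact (forget VectQ (ComplexShape.down ℤ)).mono_of_mono_map this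

instance (X : DgQ) : (MonoidalCategory.tensorLeft X).PreservesMonomorphisms :=
  .of_iso (BraidedCategory.tensorLeftIsoTensorRight X).symm

def homotopyWhiskerRight {f g : A ⟶ B} (H : Homotopy f g) (X : DgQ) : Homotopy (f ▷ X) (g ▷ X) :=
  mapBifunctorMapHomotopy₁ H (𝟙 X) (MonoidalCategory.curriedTensor VectQ) (ComplexShape.down ℤ)

lemma homotopyEquivalences_whiskerRight {f : A ⟶ B}
    (hf : homotopyEquivalences VectQ (ComplexShape.down ℤ) f) (X : DgQ) :
    homotopyEquivalences VectQ (ComplexShape.down ℤ) (f ▷ X) := by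
  obtain ⟨e, rfl⟩ := hf
  exact ⟨{
    hom := e.hom ▷ X
    inv := e.inv ▷ X
    homotopyHomInvId := (Homotopy.ofEq (by simp)).trans
      ((homotopyWhiskerRight e.homotopyHomInvId X).trans (Homotopy.ofEq (by simp)))
    homotopyInvHomId := (Homotopy.ofEq (by simp)).trans
      ((homotopyWhiskerRight e.homotopyInvHomId X).trans (Homotopy.ofEq (by simp))) }, rfl⟩

lemma contractible_tensor_left (hK : Contractible K) (X : DgQ) : Contractible (K ⊗ X) := by
  obtain ⟨H⟩ := hK
  exact ⟨(Homotopy.ofEq (MonoidalCategory.id_whiskerRight K X).symm).trans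
    ((homotopyWhiskerRight H X).trans
      (Homotopy.ofEq (Functor.map_zero (MonoidalCategory.tensorRight X) K K)))⟩

lemma contractible_tensor_right (hK : Contractible K) (X : DgQ) : Contractible (X ⊗ K) :=
  (contractible_tensor_left hK X).of_iso (β_ K X)

lemma acyclic_disc (n : ℤ) (M : VectQ) : ((disc n).obj M).Acyclic := by
  intro j
  rw [exactAt_iff' _ (j + 1) j (j - 1) (by simp) (by simp)]
  have isIso_d {i : ℤ} (hi : i + 1 = n) : IsIso (((disc n).obj M).d n i) := by
    obtain rfl : i = n - 1 := by lia
    change IsIso ((double (𝟙 M) (down_rel n)).d n (n - 1))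
    rw [double_d _ _ (ne_sub_one n)]
    infer_instance
  rcases eq_or_ne j n with rfl | hn
  · have := isIso_d (i := j - 1) (by lia)
    exact (ShortComplex.exact_iff_mono _ (double_d_eq_zero₀ (𝟙 M) (down_rel j) _ _ (by lia))).2
      (inferInstanceAs (Mono (((disc j).obj M).d j (j - 1))))
  rcases eq_or_ne n (j + 1) with rfl | hn'
  · have := isIso_d (i := j) rfl
    exact (ShortComplex.exact_iff_epi _ (double_d_eq_zero₀ (𝟙 M) (down_rel _) _ _ (by lia))).2
      (inferInstanceAs (Epi (((disc (j + 1)).obj M).d (j + 1) j)))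
  · exact ShortComplex.exact_of_isZero_X₂ _ (isZero_double_X (𝟙 M) (down_rel n) j hn (by lia))

lemma contractible_disc (n : ℤ) (M : VectQ) : Contractible ((disc n).obj M) :=
  contractible_of_acyclic (acyclic_disc n M)

instance mono_sphereToDisc (n : ℤ) (M : VectQ) : Mono ((sphereToDisc n).app M) := by
  refine mono_of_mono_f _ fun i ↦ ?_
  by_cases hi : i = n - 1
  · subst hi
    change Mono ((sphereToDiscApp n M).f (n - 1))
    rw [sphereToDiscApp, mkHomFromSingle_f]
    infer_instance
  · have : IsZero (((sphere (n - 1)).obj M).X i) := isZero_single_obj_X _ _ _ _ hi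
    exact ⟨fun _ _ _ ↦ this.eq_of_tgt _ _⟩

/-- The unit, as a subcomplex of the contractible complex `D¹ ℚ`. -/
def unitToDisc : 𝟙_ DgQ ⟶ (disc 1).obj (ModuleCat.of ℚ ℚ) :=
  (sphereToDisc 1).app (ModuleCat.of ℚ ℚ)

instance : Mono unitToDisc := mono_sphereToDisc 1 _

/-- The unit, as a quotient of the contractible complex `D⁰ ℚ`. -/
def discToUnit : (disc 0).obj (ModuleCat.of ℚ ℚ) ⟶ 𝟙_ DgQ :=
  mkHomFromDouble (down_rel 0) (ne_sub_one 0)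
    (singleObjXSelf (ComplexShape.down ℤ) 0 (ModuleCat.of ℚ ℚ)).inv 0
    (((isZero_single_obj_X (ComplexShape.down ℤ) 0 (ModuleCat.of ℚ ℚ) (0 - 1)
      (by lia)).eq_of_tgt _ _)) (fun _ _ ↦ zero_comp)

instance : Epi discToUnit := by
  refine epi_of_epi_f _ fun i ↦ ?_
  by_cases hi : i = 0
  · subst hi
    rw [discToUnit, mkHomFromDouble_f₀]
    exact IsIso.epi_of_iso (doubleXIso₀ (𝟙 (ModuleCat.of ℚ ℚ)) (down_rel 0) ≪≫
      (singleObjXSelf (ComplexShape.down ℤ) 0 (ModuleCat.of ℚ ℚ)).symm).hom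
  · have : IsZero ((𝟙_ DgQ).X i) := isZero_single_obj_X _ _ _ _ hi
    exact ⟨fun _ _ _ ↦ this.eq_of_src _ _⟩

/-- The functorial contractible complex `K ⊗ D¹ ℚ` containing `K`, which plays the role of the
cone on `K`. -/
abbrev cone : DgQ ⥤ DgQ := MonoidalCategory.tensorRight ((disc 1).obj (ModuleCat.of ℚ ℚ))

/-- The inclusion of a complex into its cone. -/
def toCone : 𝟭 DgQ ⟶ cone where
  app K := (ρ_ K).inv ≫ K ◁ unitToDisc
  naturality K L f := by
    change f ≫ (ρ_ L).inv ≫ L ◁ unitToDisc = ((ρ_ K).inv ≫ K ◁ unitToDisc) ≫ f ▷ _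
    simp only [Category.assoc, MonoidalCategory.whisker_exchange,
      MonoidalCategory.rightUnitor_inv_naturality_assoc]

instance (K : DgQ) : Mono (toCone.app K) := by
  have : Mono (K ◁ unitToDisc) :=
    inferInstanceAs (Mono ((MonoidalCategory.tensorLeft K).map unitToDisc))
  exact mono_comp _ _

lemma contractible_cone (K : DgQ) : Contractible (cone.obj K) :=
  contractible_tensor_right (contractible_disc _ _) K

/-- The functorial contractible complex `K ⊗ D⁰ ℚ` mapping onto `K`, which plays the role of the
space of paths in `K` ending at `0`. -/
abbrev path : DgQ ⥤ DgQ := MonoidalCategory.tensorRight ((disc 0).obj (ModuleCat.of ℚ ℚ))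

/-- The projection of the path complex of `K` onto `K`. -/
def fromPath : path ⟶ 𝟭 DgQ where
  app K := K ◁ discToUnit ≫ (ρ_ K).hom
  naturality K L f := by
    change f ▷ _ ≫ L ◁ discToUnit ≫ _ = (K ◁ discToUnit ≫ _) ≫ f
    rw [← MonoidalCategory.whisker_exchange_assoc, MonoidalCategory.rightUnitor_naturality,
      Category.assoc]

instance (K : DgQ) : Epi (fromPath.app K) := by
  have : Epi (K ◁ discToUnit) :=
    inferInstanceAs (Epi ((MonoidalCategory.tensorLeft K).map discToUnit))
  exact epi_comp _ _

lemma contractible_path (K : DgQ) : Contractible (path.obj K) :=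
  contractible_tensor_right (contractible_disc _ _) K

end DgQ

instance : weqQ.HasTwoOutOfThreeProperty :=
  inferInstanceAs (HomologicalComplex.quasiIso VectQ (ComplexShape.down ℤ)).HasTwoOutOfThreeProperty

instance : weqQ.IsStableUnderRetracts :=
  inferInstanceAs (HomologicalComplex.quasiIso VectQ (ComplexShape.down ℤ)).IsStableUnderRetracts

instance : weqQ.RespectsIso :=
  inferInstanceAs (HomologicalComplex.quasiIso VectQ (ComplexShape.down ℤ)).RespectsIso

instance : weqQ.ContainsIdentities :=
  ⟨fun K ↦ inferInstanceAs (QuasiIso (𝟙 K))⟩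

lemma fibQ_eq_epimorphisms : fibQ = MorphismProperty.epimorphisms DgQ := by
  ext
  exact DgQ.epi_iff.symm

instance : fibQ.RespectsIso := by
  rw [fibQ_eq_epimorphisms]
  infer_instance

instance : fibQ.ContainsIdentities := by
  rw [fibQ_eq_epimorphisms]
  infer_instance

namespace DgQ

open HomologicalComplex

variable {A B K L X Y : DgQ}

lemma weqQ_whiskerRight {f : A ⟶ B} (hf : weqQ f) (X : DgQ) : weqQ (f ▷ X) := by
  have : QuasiIso f := hf
  exact homotopyEquivalences_le_quasiIso _ _ _ (homotopyEquivalences_whiskerRight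
    ((contractible_path B).homotopyEquivalences_of_quasiIso f (fromPath.app B)) X)

lemma weqQ_whiskerLeft {f : A ⟶ B} (hf : weqQ f) (X : DgQ) : weqQ (X ◁ f) :=
  (weqQ.arrow_mk_iso_iff (Arrow.isoMk (β_ X A) (β_ X B) (by simp))).2 (weqQ_whiskerRight hf X)

lemma llp_fibQ_of_mono {f : A ⟶ B} [Mono f] (hf : weqQ f) : fibQ.llp f := fun _ _ p hp ↦ by
  have : QuasiIso f := hf
  have : Epi p := epi_iff.2 hp
  exact (contractible_path B).hasLiftingProperty_of_mono f (fromPath.app B) p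

lemma hasLiftingProperty_of_mono (i : A ⟶ B) [Mono i] {p : K ⟶ L} (hp : (fibQ ⊓ weqQ) p) :
    HasLiftingProperty i p := by
  have : Epi p := epi_iff.2 hp.1
  have : QuasiIso p := hp.2
  exact hasLiftingProperty_of_mono_of_epi i p

lemma fibQ_inf_weqQ_of_contractible (hK : Contractible K) (hL : IsZero L) (p : K ⟶ L) :
    (fibQ ⊓ weqQ) p :=
  ⟨epi_iff.1 (hL.eq_of_tgt p 0 ▸ hL.epi 0),
    homotopyEquivalences_le_quasiIso _ _ _ (hK.homotopyEquivalences_of_isZero hL p)⟩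

lemma mono_of_llp {f : A ⟶ B} (hf : (fibQ ⊓ weqQ).llp f) : Mono f := by
  have := hf (0 : cone.obj A ⟶ 0)
    (fibQ_inf_weqQ_of_contractible (contractible_cone A) (isZero_zero _) 0)
  exact mono_of_hasLiftingProperty_zero f (toCone.app A)

lemma weqQ_of_llp {f : A ⟶ B} (hf : fibQ.llp f) : weqQ f := by
  have := hf (biprod.desc f (fromPath.app B))
    (epi_iff.1 (epi_of_epi_fac (biprod.inr_desc f (fromPath.app B))))
  exact (contractible_path B).quasiIso_of_hasLiftingProperty f (fromPath.app B)

lemma weqQ_pushoutProduct {f : A ⟶ B} {g : X ⟶ Y} [Mono f] [Mono g] (h : weqQ f ∨ weqQ g)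
    {P : DgQ} {inl : B ⊗ X ⟶ P} {inr : A ⊗ Y ⟶ P} (sq : IsPushout (f ▷ X) (A ◁ g) inl inr)
    (ι : P ⟶ B ⊗ Y) (hl : inl ≫ ι = B ◁ g) (hr : inr ≫ ι = f ▷ Y) : weqQ ι := by
  have : Mono (f ▷ X) := inferInstanceAs (Mono ((MonoidalCategory.tensorRight X).map f))
  have : Mono (A ◁ g) := inferInstanceAs (Mono ((MonoidalCategory.tensorLeft A).map g))
  obtain h | h := h
  · have : QuasiIso (f ▷ X) := weqQ_whiskerRight h X
    have : weqQ inr := quasiIso_of_isPushout_of_mono sq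
    exact weqQ.of_precomp inr ι this (hr ▸ weqQ_whiskerRight h Y)
  · have : QuasiIso (A ◁ g) := weqQ_whiskerLeft h A
    have : weqQ inl := quasiIso_of_isPushout_of_mono sq.flip
    exact weqQ.of_precomp inl ι this (hl ▸ weqQ_whiskerLeft h B)

section Generators

/-- The linear map `ℚ ⟶ M` with value `x` at `1`. -/
abbrev vec {M : VectQ} (x : M) : ModuleCat.of ℚ ℚ ⟶ M :=
  ModuleCat.ofHom (LinearMap.toSpanSingleton ℚ M x)

lemma vec_one {M : VectQ} (x : M) : vec x (1 : ℚ) = x := one_smul ℚ x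

lemma vec_ext {M : VectQ} {f g : ModuleCat.of ℚ ℚ ⟶ M} (h : f (1 : ℚ) = g (1 : ℚ)) : f = g :=
  ModuleCat.hom_ext (LinearMap.ext_ring h)

lemma exists_lift_of_hasLiftingProperty_sphereToDisc {p : K ⟶ L} {n : ℤ} {M : VectQ}
    [HasLiftingProperty ((sphereToDisc n).app M) p] (x : M ⟶ K.X (n - 1)) (y : M ⟶ L.X n)
    (hx : ∀ k, x ≫ K.d (n - 1) k = 0) (hxy : x ≫ p.f (n - 1) = y ≫ L.d n (n - 1)) :
    ∃ z : M ⟶ K.X n, z ≫ K.d n (n - 1) = x ∧ z ≫ p.f n = y := by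
  let u : (sphere (n - 1)).obj M ⟶ K := mkHomFromSingle x fun k _ ↦ hx k
  let v : (disc n).obj M ⟶ L :=
    mkHomFromDouble (down_rel n) (ne_sub_one n) y (y ≫ L.d n (n - 1)) (by simp) (by simp)
  let e₀ : ((disc n).obj M).X n ≅ M := doubleXIso₀ (𝟙 M) (down_rel n)
  let e₁ : ((disc n).obj M).X (n - 1) ≅ M := doubleXIso₁ (𝟙 M) (down_rel n) (ne_sub_one n)
  let e : ((sphere (n - 1)).obj M).X (n - 1) ≅ M := singleObjXSelf _ _ _
  have hd : ((disc n).obj M).d n (n - 1) = e₀.hom ≫ e₁.inv :=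
    (double_d (𝟙 M) (down_rel n) (ne_sub_one n)).trans (congrArg _ (Category.id_comp _))
  have hi : ((sphereToDisc n).app M).f (n - 1) = e.hom ≫ e₁.inv := by
    change (sphereToDiscApp n M).f (n - 1) = _
    exact mkHomFromSingle_f _ _
  have hu : u.f (n - 1) = e.hom ≫ x := mkHomFromSingle_f _ _
  have hv₀ : v.f n = e₀.hom ≫ y := mkHomFromDouble_f₀ _ _ _ _ _ _
  have hv₁ : v.f (n - 1) = e₁.hom ≫ y ≫ L.d n (n - 1) := mkHomFromDouble_f₁ _ _ _ _ _ _
  have sq : CommSq u ((sphereToDisc n).app M) p v :=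
    ⟨from_single_hom_ext (by rw [comp_f, comp_f, hu, hi, hv₁]; simp [hxy])⟩
  refine ⟨e₀.inv ≫ sq.lift.f n, ?_, ?_⟩
  · have := congr(e.inv ≫ $(congr_hom sq.fac_left (n - 1)))
    rw [comp_f, hi, hu, Category.assoc, e.inv_hom_id_assoc, e.inv_hom_id_assoc] at this
    rw [Category.assoc, sq.lift.comm, hd, Category.assoc, e₀.inv_hom_id_assoc, this]
  · rw [Category.assoc, ← comp_f, sq.fac_right, hv₀, e₀.inv_hom_id_assoc]

lemma d_eq_zero {n : ℤ} {x : K.X n} (hx : K.d n (n - 1) x = 0) (k : ℤ) : K.d n k x = 0 := by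
  by_cases hk : k = n - 1
  · exact hk ▸ hx
  · rw [K.shape n k (fun h : k + 1 = n ↦ hk (by lia))]
    rfl

lemma exists_d_eq_of_hasLiftingProperty_genCofQ {p : K ⟶ L} {n : ℤ}
    [HasLiftingProperty (genCofQ n) p] (x : K.X (n - 1)) (y : L.X n)
    (hx : ∀ k, K.d (n - 1) k x = 0) (hxy : p.f (n - 1) x = L.d n (n - 1) y) :
    ∃ z : K.X n, K.d n (n - 1) z = x ∧ p.f n z = y := by
  have : HasLiftingProperty ((sphereToDisc n).app (ModuleCat.of ℚ ℚ)) p :=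
    inferInstanceAs (HasLiftingProperty (genCofQ n) p)
  obtain ⟨z, hz, hz'⟩ := exists_lift_of_hasLiftingProperty_sphereToDisc (p := p) (vec x) (vec y)
    (fun k ↦ vec_ext (by simp [hx])) (vec_ext (by simp [hxy]))
  exact ⟨z (1 : ℚ), congr($hz (1 : ℚ)).trans (vec_one x), congr($hz' (1 : ℚ)).trans (vec_one y)⟩

lemma fibQ_of_hasLiftingProperty_genCofQ {p : K ⟶ L}
    (hp : ∀ n, HasLiftingProperty (genCofQ n) p) : fibQ p := fun n y ↦ by
  have exists_cycle : ∃ x : K.X (n - 1), (∀ k, K.d (n - 1) k x = 0) ∧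
      p.f (n - 1) x = L.d n (n - 1) y := by
    obtain ⟨x, hx, hxy⟩ := exists_d_eq_of_hasLiftingProperty_genCofQ (p := p)
      (0 : K.X (n - 1 - 1)) (L.d n (n - 1) y) (fun _ ↦ map_zero _)
      (by rw [map_zero, ← ModuleCat.comp_apply, L.d_comp_d]; rfl)
    exact ⟨x, d_eq_zero hx, hxy⟩
  obtain ⟨x, hx, hxy⟩ := exists_cycle
  obtain ⟨z, -, hz⟩ := exists_d_eq_of_hasLiftingProperty_genCofQ x y hx hxy
  exact ⟨z, hz⟩

lemma acyclic_of_hasLiftingProperty_genCofQ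
    (hK : ∀ n, HasLiftingProperty (genCofQ n) (0 : K ⟶ 0)) : K.Acyclic := fun j ↦ by
  rw [exactAt_iff' _ (j + 1) j (j - 1) (by simp) (by simp), ShortComplex.moduleCat_exact_iff]
  intro (x : K.X j) (hx : K.d j (j - 1) x = 0)
  obtain ⟨n, rfl⟩ : ∃ n, j = n - 1 := ⟨j + 1, by simp⟩
  obtain ⟨z, hz, -⟩ := exists_d_eq_of_hasLiftingProperty_genCofQ (p := (0 : K ⟶ 0)) x 0
    (d_eq_zero hx) (by simp)
  rw [sub_add_cancel]
  exact ⟨z, hz⟩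

lemma weqQ_of_hasLiftingProperty_genCofQ {p : K ⟶ L}
    (hp : ∀ n, HasLiftingProperty (genCofQ n) p) : weqQ p := by
  have : Epi p := epi_iff.2 (fibQ_of_hasLiftingProperty_genCofQ hp)
  refine quasiIso_of_epi_of_acyclic_kernel p (acyclic_of_hasLiftingProperty_genCofQ fun n ↦ ?_)
  exact hasLiftingProperty_kernel (genCofQ n) p

end Generators

end DgQ

/-! ### Complexes with an action of `W` -/

instance : weqQW.RespectsIso :=
  inferInstanceAs (weqQ.inverseImage (Action.forget DgQ W₂)).RespectsIso

instance : weqQW.ContainsIdentities :=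
  inferInstanceAs (weqQ.inverseImage (Action.forget DgQ W₂)).ContainsIdentities

instance : fibQW.RespectsIso :=
  inferInstanceAs (fibQ.inverseImage (Action.forget DgQ W₂)).RespectsIso

instance : fibQW.ContainsIdentities :=
  inferInstanceAs (fibQ.inverseImage (Action.forget DgQ W₂)).ContainsIdentities

namespace DgQW

open HomologicalComplex

variable {A B X Y : DgQW}

/-- The average of a map over the action of `W`. -/
def average (h : A.V ⟶ B.V) : A ⟶ B where
  hom := (1 / 2 : ℚ) • ∑ g : W₂, A.ρ g⁻¹ ≫ h ≫ B.ρ g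
  comm k := by
    rw [Linear.comp_smul, Linear.smul_comp, Preadditive.comp_sum, Preadditive.sum_comp]
    congr 1
    refine Fintype.sum_equiv (Equiv.mulLeft k⁻¹) _ _ fun g ↦ ?_
    have hA : A.ρ k ≫ A.ρ g⁻¹ = A.ρ (k⁻¹ * g)⁻¹ := by
      rw [mul_inv_rev, inv_inv, map_mul, End.mul_def]
    have hB : B.ρ (k⁻¹ * g) ≫ B.ρ k = B.ρ g := by
      rw [← End.mul_def, ← map_mul, mul_inv_cancel_left]
    rw [Equiv.coe_mulLeft, reassoc_of% hA, Category.assoc, Category.assoc, hB]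

lemma average_hom (f : A ⟶ B) : average f.hom = f := by
  ext : 1
  have h (g : W₂) : A.ρ g⁻¹ ≫ f.hom ≫ B.ρ g = f.hom := by
    rw [← f.comm g, ← Category.assoc, ← End.mul_def, ← map_mul, mul_inv_cancel, map_one,
      End.one_def, Category.id_comp]
  have hcard : Fintype.card W₂ = 2 := rfl
  simp only [average, h, Finset.sum_const, Finset.card_univ, hcard]
  rw [← Nat.cast_smul_eq_nsmul ℚ, smul_smul]
  norm_num

lemma comp_average (f : X ⟶ A) (h : A.V ⟶ B.V) : f ≫ average h = average (f.hom ≫ h) := by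
  ext : 1
  simp only [average, Action.comp_hom, Linear.comp_smul, Preadditive.comp_sum, Category.assoc,
    ← Action.Hom.comm_assoc]

lemma average_comp (h : A.V ⟶ B.V) (f : B ⟶ Y) : average h ≫ f = average (h ≫ f.hom) := by
  ext : 1
  simp only [average, Action.comp_hom, Linear.smul_comp, Preadditive.sum_comp, Category.assoc,
    Action.Hom.comm]

lemma hasLiftingProperty_of_hom (i : A ⟶ B) (p : X ⟶ Y) [HasLiftingProperty i.hom p.hom] :
    HasLiftingProperty i p where
  sq_hasLift {u v} sq := by
    have sq' : CommSq u.hom i.hom p.hom v.hom := ⟨congrArg Action.Hom.hom sq.w⟩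
    exact ⟨⟨⟨average sq'.lift, by rw [comp_average, sq'.fac_left, average_hom],
      by rw [average_comp, sq'.fac_right, average_hom]⟩⟩⟩

lemma mono_iff {i : A ⟶ B} : Mono i ↔ Mono i.hom :=
  ⟨fun _ ↦ inferInstanceAs (Mono ((Action.forget DgQ W₂).map i)),
    fun h ↦ (Action.forget DgQ W₂).mono_of_mono_map h⟩

lemma epi_iff {i : A ⟶ B} : Epi i ↔ fibQW i := by
  refine Iff.trans ?_ DgQ.epi_iff
  exact ⟨fun _ ↦ inferInstanceAs (Epi ((Action.forget DgQ W₂).map i)),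
    fun h ↦ (Action.forget DgQ W₂).epi_of_epi_map h⟩

lemma hasLiftingProperty_of_mono (i : A ⟶ B) [hi : Mono i] {p : X ⟶ Y}
    (hp : (fibQW ⊓ weqQW) p) : HasLiftingProperty i p := by
  have := mono_iff.1 hi
  have := DgQ.hasLiftingProperty_of_mono i.hom (p := p.hom) hp
  exact hasLiftingProperty_of_hom i p

lemma llp_fibQW_of_mono (i : A ⟶ B) [hi : Mono i] (hw : weqQW i) : fibQW.llp i := fun _ _ p hp ↦ by
  have := mono_iff.1 hi
  have := DgQ.llp_fibQ_of_mono hw p.hom hp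
  exact hasLiftingProperty_of_hom i p

/-- The projection of the path complex of `K` onto `K`, as a map of complexes with action. -/
def fromPath (K : DgQW) : (DgQ.path.mapAction W₂).obj K ⟶ K where
  hom := DgQ.fromPath.app K.V
  comm g := DgQ.fromPath.naturality (K.ρ g)

instance (K : DgQW) : Epi (fromPath K) :=
  epi_iff.2 (DgQ.epi_iff.1 (inferInstanceAs (Epi (DgQ.fromPath.app K.V))))

/-- The inclusion of `K` into its cone, as a map of complexes with action. -/
def toCone (K : DgQW) : K ⟶ (DgQ.cone.mapAction W₂).obj K where
  hom := DgQ.toCone.app K.V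
  comm g := DgQ.toCone.naturality (K.ρ g)

instance (K : DgQW) : Mono (toCone K) :=
  mono_iff.2 (inferInstanceAs (Mono (DgQ.toCone.app K.V)))

lemma weqQW_inl (hX : Contractible X.V) : weqQW (biprod.inl : A ⟶ A ⊞ X) := by
  have inl_fst : (biprod.inl : A ⟶ A ⊞ X).hom ≫ (biprod.fst : A ⊞ X ⟶ A).hom = 𝟙 A.V :=
    congrArg Action.Hom.hom (biprod.inl_fst (X := A) (Y := X))
  have total : (biprod.snd ≫ biprod.inr + biprod.fst ≫ biprod.inl : A ⊞ X ⟶ A ⊞ X) = 𝟙 _ :=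
    (add_comm _ _).trans biprod.total
  have hfst : weqQ (biprod.fst : A ⊞ X ⟶ A).hom :=
    homotopyEquivalences_le_quasiIso _ _ _ (hX.homotopyEquivalences_of_section inl_fst
      (congrArg Action.Hom.hom total))
  exact weqQ.of_postcomp _ _ hfst (inl_fst ▸ weqQ.id_mem _)

lemma weqQW_of_llp {f : A ⟶ B} (hf : fibQW.llp f) : weqQW f := by
  have := hf (biprod.desc f (fromPath B)) (epi_iff.1 (epi_of_epi_fac (biprod.inr_desc f _)))
  exact weqQ.of_retract ((retractArrowInl f (fromPath B)).map (Action.forget DgQ W₂))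
    (weqQW_inl (DgQ.contractible_path B.V))

lemma mono_of_llp {f : A ⟶ B} (hf : (fibQW ⊓ weqQW).llp f) : Mono f := by
  have := hf (0 : (DgQ.cone.mapAction W₂).obj A ⟶ 0) (DgQ.fibQ_inf_weqQ_of_contractible
    (DgQ.contractible_cone A.V) ((Action.forget DgQ W₂).map_isZero (isZero_zero DgQW)) _)
  exact mono_of_hasLiftingProperty_zero f (toCone A)

end DgQW

/-! ### Limits and colimits of germs and in `𝒜(𝒟)` -/

section Pi

open CategoryTheory.pi

universe v

variable {I J : Type v} [SmallCategory J] {C : I → Type*} [∀ i, Category.{v} (C i)]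

instance [∀ i, HasLimitsOfShape J (C i)] : HasLimitsOfShape J (∀ i, C i) where
  has_limit _ := hasLimit_of_hasLimit_comp_eval

instance [∀ i, HasColimitsOfShape J (C i)] : HasColimitsOfShape J (∀ i, C i) where
  has_colimit _ := hasColimit_of_hasColimit_comp_eval

instance [∀ i, HasLimitsOfShape J (C i)] (i : I) : PreservesLimitsOfShape J (Pi.eval C i) where
  preservesLimit := preservesLimit_of_preserves_limit_cone
    (coneOfConeEvalIsLimit fun _ ↦ limit.isLimit _) (limit.isLimit _)

instance [∀ i, HasColimitsOfShape J (C i)] (i : I) :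
    PreservesColimitsOfShape J (Pi.eval C i) where
  preservesColimit := preservesColimit_of_preserves_colimit_cocone
    (coconeOfCoconeEvalIsColimit fun _ ↦ colimit.isColimit _) (colimit.isColimit _)

end Pi

section Comma

variable {A B T J : Type*} [Category* A] [Category* B] [Category* T] [Category* J]
  {L : A ⥤ T} {R : B ⥤ T} [HasLimitsOfShape J A] [HasLimitsOfShape J B]
  [PreservesLimitsOfShape J R]

instance : PreservesLimitsOfShape J (Comma.fst L R) where
  preservesLimit := preservesLimit_of_preserves_limit_cone
    (Comma.coneOfPreservesIsLimit _ (limit.isLimit _) (limit.isLimit _)) (limit.isLimit _)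

instance : PreservesLimitsOfShape J (Comma.snd L R) where
  preservesLimit := preservesLimit_of_preserves_limit_cone
    (Comma.coneOfPreservesIsLimit _ (limit.isLimit _) (limit.isLimit _)) (limit.isLimit _)

end Comma

section Germs

instance {J : Type*} [Category* J] : PreservesColimitsOfShape J trivW :=
  Action.preservesColimitsOfShape_of_preserves _
    (inferInstanceAs (PreservesColimitsOfShape J (𝟭 DgQ)))

instance {J : Type*} [Category* J] : PreservesLimitsOfShape J trivW :=
  Action.preservesLimitsOfShape_of_preserves _
    (inferInstanceAs (PreservesLimitsOfShape J (𝟭 DgQ)))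

instance : HasExactColimitsOfShape ℕ+ DgQW :=
  HasExactColimitsOfShape.domain_of_functor ℕ+ (Action.forget DgQ W₂)

variable {D : Type*} [Category.{0} D]

/-- The functor sending a family `V` to the discrete diagram of the `V k` with `n ≤ k`, whose
limit is the tail product at `n`. -/
def tailDiagram (n : ℕ+) : (ℕ+ → D) ⥤ Discrete {k : ℕ+ // n ≤ k} ⥤ D where
  obj V := Discrete.functor fun k ↦ V k.1
  map f := Discrete.natTrans fun k ↦ f k.as.1

variable [HasCountableProducts D]

/-- The `n`-th tail product, as the limit of `tailDiagram n`. -/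
def tailsEvaluationIso (n : ℕ+) :
    tailDiagram n ⋙ lim ≅ tails D ⋙ (evaluation ℕ+ D).obj n :=
  NatIso.ofComponents (fun _ ↦ Iso.refl _) fun f ↦
    (Category.comp_id _).trans <| (tail_ext fun k ↦ (limMap_π _ _).trans
      (tailMap_π f n k).symm).trans (Category.id_comp _).symm

variable {J : Type} [SmallCategory J] [HasLimitsOfShape J D]

instance (n : ℕ+) : PreservesLimitsOfShape J (tailDiagram (D := D) n) :=
  preservesLimitsOfShape_of_evaluation _ _ fun k ↦
    inferInstanceAs (PreservesLimitsOfShape J (Pi.eval (fun _ : ℕ+ ↦ D) k.as.1))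

instance : PreservesLimitsOfShape J (tails D) :=
  preservesLimitsOfShape_of_evaluation _ _ fun n ↦
    preservesLimitsOfShape_of_natIso (tailsEvaluationIso n)

instance {J : Type} [SmallCategory J] [FinCategory J] : PreservesLimitsOfShape J germs :=
  inferInstanceAs (PreservesLimitsOfShape J (tails DgQW ⋙ colim))

end Germs

/-- The functor `V ↦ V_∞`. -/
abbrev stalkInf : AD ⥤ DgQ := Comma.fst trivW germs

/-- The functor `V ↦ V_k`. -/
abbrev stalk (k : ℕ+) : AD ⥤ DgQW := Comma.snd trivW germs ⋙ Pi.eval (fun _ : ℕ+ ↦ DgQW) k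

instance : HasColimitsOfSize.{0, 0} AD where
  has_colimits_of_shape _ _ := inferInstance

instance : HasPullbacks AD := inferInstanceAs (HasPullbacks (Comma trivW germs))

/-! ### Finitely presentable complexes -/

section Presentable

open Cardinal HomologicalComplex

attribute [local instance] Cardinal.fact_isRegular_aleph0

universe w

lemma isCardinalPresentable_of_exists_factorization {C : Type*} [Category.{w} C] (X : C)
    (κ : Cardinal.{w}) [Fact κ.IsRegular]
    (exists_hom : ∀ (J : Type w) [SmallCategory J] [IsCardinalFiltered J κ] (F : J ⥤ C)
      (c : Cocone F) (_ : IsColimit c) (f : X ⟶ c.pt),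
        ∃ (j : J) (g : X ⟶ F.obj j), g ≫ c.ι.app j = f)
    (exists_eq : ∀ (J : Type w) [SmallCategory J] [IsCardinalFiltered J κ] (F : J ⥤ C)
      (c : Cocone F) (_ : IsColimit c) (j : J) (f g : X ⟶ F.obj j),
        f ≫ c.ι.app j = g ≫ c.ι.app j → ∃ (k : J) (u : j ⟶ k), f ≫ F.map u = g ≫ F.map u) :
    IsCardinalPresentable X κ where
  preservesColimitOfShape J _ _ := ⟨fun {F} ↦ ⟨fun {c} hc ↦ ⟨by
    have := isFiltered_of_isCardinalFiltered J κ
    refine Types.FilteredColimit.isColimitOf' _ _ (fun f ↦ ?_) (exists_eq J F c hc)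
    obtain ⟨j, g, hg⟩ := exists_hom J F c hc f
    exact ⟨j, g, hg.symm⟩⟩⟩⟩

instance (T : Type) [Finite T] : IsFinitelyPresentable.{0} ((ModuleCat.free ℚ).obj T) := by
  have : IsFinitelyPresentable.{0} T :=
    (Types.isCardinalPresentable_iff _).2 (hasCardinalLT_aleph0_iff _ |>.2 inferInstance)
  have : (CategoryTheory.forget VectQ).IsCardinalAccessible ℵ₀ :=
    Functor.isFinitelyAccessible_iff_preservesFilteredColimits.2 inferInstance
  exact (ModuleCat.adj ℚ).isCardinalPresentable_leftAdjoint_obj ℵ₀ T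

instance : IsFinitelyPresentable.{0} (ModuleCat.of ℚ ℚ) :=
  isCardinalPresentable_of_iso (X := (ModuleCat.free ℚ).obj PUnit)
    (Finsupp.uniqueLinearEquiv ℚ ℚ PUnit.unit).toModuleIso ℵ₀

section Double

variable {C ι : Type*} [Category* C] [Preadditive C] [HasZeroObject C] {c : ComplexShape ι}
  [DecidableEq ι] {i j k : ι} (hij : c.Rel i j) (hjk : c.Rel j k) (hi : i ≠ j) (hj : j ≠ k) (M : C)

/-- The map from the disc in degrees `j` and `k` to the disc in degrees `i` and `j` which is the
identity in degree `j`. -/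
def doubleToDouble : double (𝟙 M) hjk ⟶ double (𝟙 M) hij :=
  mkHomFromDouble hjk hj (doubleXIso₁ (𝟙 M) hij hi).inv 0
    (by rw [double_d_eq_zero₀ _ _ _ _ hi.symm, comp_zero, comp_zero]) (fun _ _ ↦ zero_comp)

/-- The projection of the disc in degrees `i` and `j` onto the sphere in degree `i`. -/
def doubleToSingle : double (𝟙 M) hij ⟶ (single C c i).obj M :=
  mkHomFromDouble hij hi (singleObjXSelf c i M).inv 0 (by simp) (by simp)

lemma doubleToDouble_doubleToSingle :
    doubleToDouble hij hjk hi hj M ≫ doubleToSingle hij hi M = 0 := by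
  refine from_double_hom_ext ?_ ?_
  · simp [doubleToDouble, doubleToSingle]
  · simp [doubleToDouble]

instance : Epi (doubleToSingle hij hi M) where
  left_cancellation u v h := from_single_hom_ext
    (by simpa [doubleToSingle] using congr_hom h i)

def isColimitDoubleToSingle :
    IsColimit (CokernelCofork.ofπ _ (doubleToDouble_doubleToSingle hij hjk hi hj M)) :=
  CokernelCofork.IsColimit.ofπ' _ _ fun {Z} f hf ↦ by
    have hfj : (doubleXIso₁ (𝟙 M) hij hi).inv ≫ f.f j = 0 := by
      simpa [doubleToDouble] using congr_hom hf j
    refine ⟨mkHomFromSingle ((doubleXIso₀ _ hij).inv ≫ f.f i) fun l hl ↦ ?_, ?_⟩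
    · obtain rfl := c.next_eq hij hl
      simpa [double_d _ _ hi] using hfj
    · refine from_double_hom_ext ?_ ?_
      · simp [doubleToSingle]
      · simpa [doubleToSingle] using ((Iso.inv_comp_eq _).1 hfj).symm

end Double

namespace DgQ

instance (n : ℤ) (M : VectQ) [IsFinitelyPresentable.{0} M] :
    IsFinitelyPresentable.{0} ((disc n).obj M) := by
  have : (coyoneda.obj (Opposite.op M)).IsCardinalAccessible ℵ₀ := ‹_›
  have : (eval VectQ (ComplexShape.down ℤ) n).IsCardinalAccessible ℵ₀ :=
    ⟨fun J _ _ ↦ inferInstance⟩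
  exact Functor.isCardinalAccessible_of_natIso
    (evalCompCoyonedaCorepresentableByDoubleId (down_rel n) (ne_sub_one n) M).toIso.symm ℵ₀

instance (n : ℤ) (M : VectQ) [IsFinitelyPresentable.{0} M] :
    IsFinitelyPresentable.{0} ((sphere n).obj M) := by
  let φ : (disc (n - 1)).obj M ⟶ (disc n).obj M :=
    doubleToDouble (down_rel n) (down_rel (n - 1)) (ne_sub_one n) (ne_sub_one (n - 1)) M
  have : ∀ k, IsCardinalPresentable ((parallelPair φ 0).obj k) ℵ₀
    | .zero => inferInstanceAs (IsFinitelyPresentable.{0} ((disc (n - 1)).obj M))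
    | .one => inferInstanceAs (IsFinitelyPresentable.{0} ((disc n).obj M))
  exact isCardinalPresentable_of_isColimit (Y := parallelPair φ 0) _
    (isColimitDoubleToSingle ..) ℵ₀ ((hasCardinalLT_aleph0_iff _).2 inferInstance)

instance : IsFinitelyPresentable.{0} (0 : DgQ) :=
  isCardinalPresentable_of_iso (X := (sphere 0).obj ((ModuleCat.free ℚ).obj PEmpty))
    (((sphere 0).map_isZero (ModuleCat.isZero_of_iff_subsingleton.2
      (inferInstanceAs (Subsingleton (PEmpty →₀ ℚ))))).iso (isZero_zero _)) ℵ₀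

end DgQ

lemma DgQW.isFinitelyPresentable (X : DgQW) [IsFinitelyPresentable.{0} X.V] :
    IsFinitelyPresentable.{0} X := by
  apply isCardinalPresentable_of_exists_factorization
  · intro J _ _ F c hc f
    have := isFiltered_of_isCardinalFiltered J ℵ₀
    obtain ⟨j, g, hg⟩ : ∃ (j : J) (g : X.V ⟶ (F.obj j).V), g ≫ (c.ι.app j).hom = f.hom :=
      IsCardinalPresentable.exists_hom_of_isColimit ℵ₀
        (isColimitOfPreserves (Action.forget DgQ W₂) hc) f.hom
    refine ⟨j, average g, ?_⟩
    rw [average_comp, hg, average_hom]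
  · intro J _ _ F c hc j f g h
    have := isFiltered_of_isCardinalFiltered J ℵ₀
    obtain ⟨k, u, hu⟩ := IsCardinalPresentable.exists_eq_of_isColimit' ℵ₀
      (isColimitOfPreserves (Action.forget DgQ W₂) hc) f.hom g.hom (congrArg Action.Hom.hom h)
    exact ⟨k, u, Action.Hom.ext hu⟩

instance (M : DgQ) [h : IsFinitelyPresentable.{0} M] :
    IsFinitelyPresentable.{0} (trivW.obj M) :=
  haveI : IsFinitelyPresentable.{0} (trivW.obj M).V := h
  DgQW.isFinitelyPresentable _

end Presentable

section Germs

variable {M : DgQW} [IsFinitelyPresentable.{0} M]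

lemma exists_comp_toGerms_eq {V : ℕ+ → DgQW} (f : M ⟶ germs.obj V) :
    ∃ (m : ℕ+) (g : M ⟶ tailProd V m), g ≫ toGerms V m = f :=
  IsFinitelyPresentable.exists_hom_of_isColimit (colimit.isColimit ((tails DgQW).obj V)) f

lemma exists_comp_tailRes_eq {V : ℕ+ → DgQW} {m m' : ℕ+} (f : M ⟶ tailProd V m)
    (g : M ⟶ tailProd V m') (h : f ≫ toGerms V m = g ≫ toGerms V m') :
    ∃ (k : ℕ+) (u : m ≤ k) (v : m' ≤ k), f ≫ tailRes V u = g ≫ tailRes V v := by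
  obtain ⟨k, u, v, huv⟩ := IsFinitelyPresentable.exists_eq_of_isColimit
    (colimit.isColimit ((tails DgQW).obj V)) f g h
  exact ⟨k, leOfHom u, leOfHom v, huv⟩

end Germs

/-! ### Adjoints of the stalk functors -/

section GradedSingle

open GradedObject

variable {I D : Type*} [DecidableEq I] [Category* D] {k : I}

/-- The value at `k` of a map concentrated at `k`. -/
def singleMapIso [HasInitial D] {R S : D} (f : R ⟶ S) :
    Arrow.mk ((single k).map f k) ≅ Arrow.mk f :=
  Arrow.isoMk (singleObjApplyIso k R) (singleObjApplyIso k S) (by simp)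

variable [HasZeroObject D]

lemma isZero_single {l : I} (h : l ≠ k) (R : D) : IsZero ((single k).obj R l) :=
  (isZero_zero D).of_iso
    ((isInitialSingleObjApply k R l h).uniqueUpToIso HasZeroObject.zeroIsInitial)

lemma single_map_mem (P : MorphismProperty D) [P.ContainsIdentities] [P.RespectsIso] {R S : D}
    {f : R ⟶ S} (hf : P f) (l : I) : P ((single k).map f l) := by
  by_cases hl : l = k
  · subst hl
    exact (P.arrow_mk_iso_iff (singleMapIso f)).2 hf
  · rw [(isZero_single hl R).eq_of_src ((single k).map f l)
      ((isZero_single hl R).iso (isZero_single hl S)).hom]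
    exact P.of_isIso _

lemma single_hom_ext {R : D} {V : GradedObject I D} {f g : (single k).obj R ⟶ V}
    (h : f k = g k) : f = g := by
  ext l
  by_cases hl : l = k
  · subst hl
    exact h
  · exact (isZero_single hl R).eq_of_src _ _

lemma to_single_hom_ext {R : D} {V : GradedObject I D} {f g : V ⟶ (single k).obj R}
    (h : f k = g k) : f = g := by
  ext l
  by_cases hl : l = k
  · subst hl
    exact h
  · exact (isZero_single hl R).eq_of_tgt _ _

variable [HasZeroMorphisms D]

/-- A map out of an object concentrated at `k`. -/
def singleDesc {R : D} {V : GradedObject I D} (h : R ⟶ V k) : (single k).obj R ⟶ V := fun l ↦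
  if hl : l = k then (singleObjApplyIsoOfEq k R l hl).hom ≫ h ≫ eqToHom (by rw [hl]) else 0

lemma singleDesc_self {R : D} {V : GradedObject I D} (h : R ⟶ V k) :
    singleDesc h k = (singleObjApplyIso k R).hom ≫ h := by
  simp [singleDesc]

/-- A map to an object concentrated at `k`. -/
def singleLift {R : D} {V : GradedObject I D} (h : V k ⟶ R) : V ⟶ (single k).obj R := fun l ↦
  if hl : l = k then eqToHom (by rw [hl]) ≫ h ≫ (singleObjApplyIsoOfEq k R l hl).inv else 0

lemma singleLift_self {R : D} {V : GradedObject I D} (h : V k ⟶ R) :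
    singleLift h k = h ≫ (singleObjApplyIso k R).inv := by
  simp [singleLift]

variable (k)

def singleEvalAdj : single k ⊣ (eval k : GradedObject I D ⥤ D) :=
  Adjunction.mkOfHomEquiv
    { homEquiv R V :=
        { toFun f := (singleObjApplyIso k R).inv ≫ f k
          invFun h := singleDesc (k := k) h
          left_inv _ := single_hom_ext <|
            (singleDesc_self (V := V) _).trans (Iso.hom_inv_id_assoc _ _)
          right_inv h :=
            (congrArg (_ ≫ ·) (singleDesc_self (V := V) h)).trans (Iso.inv_hom_id_assoc _ _) }
      homEquiv_naturality_left_symm {_ _ V} f g :=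
        single_hom_ext <| (singleDesc_self (V := V) _).trans <|
          (single_map_singleObjApplyIso_hom_assoc k f g).symm.trans
            (congrArg ((single k).map f k ≫ ·) (singleDesc_self (V := V) g).symm)
      homEquiv_naturality_right f g := (Category.assoc _ (f k) (g k)).symm }

def evalSingleAdj : (eval k : GradedObject I D ⥤ D) ⊣ single k :=
  Adjunction.mkOfHomEquiv
    { homEquiv V R :=
        { toFun h := singleLift (k := k) h
          invFun f := f k ≫ (singleObjApplyIso k R).hom
          left_inv h := (congrArg (· ≫ _) (singleLift_self (V := V) h)).trans <|
            (Category.assoc _ _ _).trans <|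
              (congrArg (h ≫ ·) (Iso.inv_hom_id _)).trans (Category.comp_id h)
          right_inv f := to_single_hom_ext <|
            (singleLift_self (V := V) _).trans <| (Category.assoc _ _ _).trans <|
              (congrArg (f k ≫ ·) (Iso.hom_inv_id _)).trans (Category.comp_id _) }
      homEquiv_naturality_left_symm f g := Category.assoc (f k) (g k) _
      homEquiv_naturality_right {V _ _} f g :=
        to_single_hom_ext <| (singleLift_self (V := V) _).trans <|
          (Category.assoc _ _ _).trans <|
            (congrArg (f ≫ ·) (singleObjApplyIso_inv_single_map k g).symm).trans <|
              (Category.assoc _ _ _).symm.trans <|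
                congrArg (· ≫ (single k).map g k) (singleLift_self (V := V) f).symm }

end GradedSingle

section Germs

variable {V : ℕ+ → DgQW}

lemma isZero_tailProd {m : ℕ+} (h : ∀ l, m ≤ l → IsZero (V l)) : IsZero (tailProd V m) :=
  (IsZero.iff_id_eq_zero _).2 (tail_ext fun k ↦ (h k.1 k.2).eq_of_tgt _ _)

lemma tailRes_toGerms (V : ℕ+ → DgQW) {n m : ℕ+} (h : n ≤ m) :
    tailRes V h ≫ toGerms V m = toGerms V n :=
  colimit.w ((tails DgQW).obj V) (homOfLE h)

lemma isZero_germs (m : ℕ+) (h : ∀ l, m ≤ l → IsZero (V l)) : IsZero (germs.obj V) := by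
  have toGerms_eq_zero (n : ℕ+) : toGerms V n = 0 := by
    rw [← tailRes_toGerms V (le_max_left n m), (isZero_tailProd fun l hl ↦
      h l ((le_max_right n m).trans hl)).eq_zero_of_src (toGerms V _), comp_zero]
  refine (IsZero.iff_id_eq_zero _).2 (colimit.hom_ext fun n ↦ ?_)
  exact (congrArg (· ≫ _) (toGerms_eq_zero n)).trans
    (zero_comp.trans (comp_zero (X := tailProd V n)).symm)

lemma isZero_germs_single (k : ℕ+) (R : DgQW) :
    IsZero (germs.obj ((GradedObject.single k).obj R)) :=
  isZero_germs (k + 1) fun _ hl ↦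
    isZero_single ((PNat.lt_add_right k 1).trans_le hl).ne' R

lemma isZero_germs_zero : IsZero (germs.obj fun _ ↦ (0 : DgQW)) :=
  isZero_germs 1 fun _ _ ↦ isZero_zero _

end Germs

section Adjunctions

def skyStalkAdj (k : ℕ+) : skyAD k ⊣ stalk k :=
  Adjunction.mkOfHomEquiv
    { homEquiv R X :=
        { toFun f := (singleEvalAdj k).homEquiv R X.right f.right
          invFun h :=
            { left := 0
              right := ((singleEvalAdj k).homEquiv R X.right).symm h
              w := (trivW.map_isZero (isZero_zero DgQ)).eq_of_src _ _ }
          left_inv _ := CommaMorphism.ext ((isZero_zero DgQ).eq_of_src _ _)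
            (Equiv.symm_apply_apply _ _)
          right_inv _ := Equiv.apply_symm_apply _ _ }
      homEquiv_naturality_left_symm f g := CommaMorphism.ext ((isZero_zero DgQ).eq_of_src _ _)
        ((singleEvalAdj k).homEquiv_naturality_left_symm f g)
      homEquiv_naturality_right f g :=
        (singleEvalAdj k).homEquiv_naturality_right f.right g.right }

def stalkSkyAdj (k : ℕ+) : stalk k ⊣ skyAD k :=
  Adjunction.mkOfHomEquiv
    { homEquiv X R :=
        { toFun h :=
            { left := 0
              right := (evalSingleAdj k).homEquiv X.right R h
              w := (isZero_germs_single k R).eq_of_tgt _ _ }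
          invFun f := ((evalSingleAdj k).homEquiv X.right R).symm f.right
          left_inv _ := Equiv.symm_apply_apply _ _
          right_inv _ := CommaMorphism.ext ((isZero_zero DgQ).eq_of_tgt _ _)
            (Equiv.apply_symm_apply _ _) }
      homEquiv_naturality_left_symm f g :=
        (evalSingleAdj k).homEquiv_naturality_left_symm f.right g.right
      homEquiv_naturality_right f g := CommaMorphism.ext ((isZero_zero DgQ).eq_of_tgt _ _)
        ((evalSingleAdj k).homEquiv_naturality_right f g) }

instance (k : ℕ+) : (stalk k).IsLeftAdjoint := (stalkSkyAdj k).isLeftAdjoint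

/-- The functor sending `M` to the object with stalk `M` at `∞` and `0` at every `k`. -/
def infAD : DgQ ⥤ AD where
  obj M :=
    { left := M
      right := fun _ ↦ 0
      hom := 0 }
  map f :=
    { left := f
      right := 𝟙 _
      w := isZero_germs_zero.eq_of_tgt _ _ }

def stalkInfAdj : stalkInf ⊣ infAD :=
  Adjunction.mkOfHomEquiv
    { homEquiv _ _ :=
        { toFun h :=
            { left := h
              right := fun _ ↦ 0
              w := isZero_germs_zero.eq_of_tgt _ _ }
          invFun f := f.left
          left_inv _ := rfl
          right_inv _ := CommaMorphism.ext rfl (funext fun _ ↦ (isZero_zero DgQW).eq_of_tgt _ _) }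
      homEquiv_naturality_left_symm _ _ := rfl
      homEquiv_naturality_right _ _ :=
        CommaMorphism.ext rfl (funext fun _ ↦ (isZero_zero DgQW).eq_of_tgt _ _) }

end Adjunctions

section Stalkwise

lemma stalkFib_infAD {K L : DgQ} {f : K ⟶ L} (hf : fibQ f) : stalkFib (infAD.map f) :=
  ⟨hf, fun _ ↦ fibQW.id_mem _⟩

lemma stalkWeq_infAD {K L : DgQ} {f : K ⟶ L} (hf : weqQ f) : stalkWeq (infAD.map f) :=
  ⟨hf, fun _ ↦ weqQW.id_mem _⟩

lemma stalkFib_skyAD {K L : DgQW} {f : K ⟶ L} (hf : fibQW f) (k : ℕ+) :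
    stalkFib ((skyAD k).map f) :=
  have : IsIso ((skyAD k).map f).left := (isZero_zero DgQ).isIso (isZero_zero DgQ) _
  ⟨fibQ.of_isIso _, single_map_mem fibQW hf⟩

lemma stalkWeq_skyAD {K L : DgQW} {f : K ⟶ L} (hf : weqQW f) (k : ℕ+) :
    stalkWeq ((skyAD k).map f) :=
  have : IsIso ((skyAD k).map f).left := (isZero_zero DgQ).isIso (isZero_zero DgQ) _
  ⟨weqQ.of_isIso _, single_map_mem weqQW hf⟩

variable {X Y : AD} {f : X ⟶ Y}

lemma llp_left_of_llp_stalkFib (hf : stalkFib.llp f) : fibQ.llp f.left := fun _ _ p hp ↦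
  (stalkInfAdj.hasLiftingProperty_iff f p).2 (hf _ (stalkFib_infAD hp))

lemma llp_right_of_llp_stalkFib (hf : stalkFib.llp f) (k : ℕ+) : fibQW.llp (f.right k) :=
  fun _ _ p hp ↦ ((stalkSkyAdj k).hasLiftingProperty_iff f p).2 (hf _ (stalkFib_skyAD hp k))

lemma mono_left_of_llp (hf : (stalkFib ⊓ stalkWeq).llp f) : Mono f.left :=
  DgQ.mono_of_llp fun _ _ p hp ↦
    (stalkInfAdj.hasLiftingProperty_iff f p).2 (hf _ ⟨stalkFib_infAD hp.1, stalkWeq_infAD hp.2⟩)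

lemma mono_right_of_llp (hf : (stalkFib ⊓ stalkWeq).llp f) (k : ℕ+) : Mono (f.right k) :=
  DgQW.mono_of_llp fun _ _ p hp ↦ ((stalkSkyAdj k).hasLiftingProperty_iff f p).2
    (hf _ ⟨stalkFib_skyAD hp.1 k, stalkWeq_skyAD hp.2 k⟩)

end Stalkwise

/-! ### Lifting against maps of constant objects -/

section ConstHom

lemma tailLift_tailRes {V : ℕ+ → DgQW} {K : DgQW} (φ : ∀ k, K ⟶ V k) {n m : ℕ+} (h : n ≤ m) :
    tailLift (n := n) (fun k ↦ φ k.1) ≫ tailRes V h = tailLift fun k ↦ φ k.1 :=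
  tail_ext fun k ↦ by simp only [Category.assoc, tailRes_π, tailLift_π]

lemma diagGerm_map {V : ℕ+ → DgQW} {M : DgQ} (φ : ∀ k, trivW.obj M ⟶ V k) (m : ℕ+) :
    diagGerm M ≫ germs.map (X := fun _ ↦ trivW.obj M) (Y := V) φ =
      tailLift (n := m) (fun k ↦ φ k.1) ≫ toGerms V m := by
  have tailLift_id_tailMap : tailLift (V := fun _ ↦ trivW.obj M) (n := 1)
      (fun _ ↦ 𝟙 (trivW.obj M)) ≫ tailMap φ 1 = tailLift fun k ↦ φ k.1 :=
    tail_ext fun k ↦ by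
      simp only [Category.assoc, tailMap_π, tailLift_π, tailLift_π_assoc, Category.id_comp]
  rw [← tailLift_tailRes φ (one_le (a := m)), Category.assoc, tailRes_toGerms,
    ← tailLift_id_tailMap, Category.assoc, diagGerm, Category.assoc]
  exact congrArg (_ ≫ ·) (toGerms_naturality (V := fun _ ↦ trivW.obj M) (V' := V) φ 1).symm

variable {M : DgQ} {X : AD}

/-- A map out of a constant object, from its components and an identification of their germ. -/
def constHom (a : M ⟶ X.left) (φ : ∀ k, trivW.obj M ⟶ X.right k) (m : ℕ+)
    (h : trivW.map a ≫ X.hom = tailLift (n := m) (fun k ↦ φ k.1) ≫ toGerms X.right m) :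
    constAD.obj M ⟶ X where
  left := a
  right := φ
  w := h.trans (diagGerm_map φ m).symm

/-- The component at `∞` of a map out of a constant object. -/
def constLeft (u : constAD.obj M ⟶ X) : M ⟶ X.left := u.left

/-- The component at `k` of a map out of a constant object. -/
def constRight (u : constAD.obj M ⟶ X) (k : ℕ+) : trivW.obj M ⟶ X.right k := u.right k

lemma constHom_ext {u v : constAD.obj M ⟶ X} (h_left : constLeft u = constLeft v)
    (h_right : ∀ k, constRight u k = constRight v k) : u = v :=
  CommaMorphism.ext h_left (funext h_right)

lemma constHom_condition (u : constAD.obj M ⟶ X) (m : ℕ+) :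
    trivW.map (constLeft u) ≫ X.hom =
      tailLift (n := m) (fun k ↦ constRight u k.1) ≫ toGerms X.right m :=
  u.w.trans (diagGerm_map (V := X.right) (constRight u) m)

lemma exists_constRight_eq (u : constAD.obj M ⟶ X) (n : ℕ+)
    (φ : ∀ k, ¬ n ≤ k → (trivW.obj M ⟶ X.right k)) :
    ∃ w : constAD.obj M ⟶ X, constLeft w = constLeft u ∧
      (∀ k, n ≤ k → constRight w k = constRight u k) ∧
        ∀ k (hk : ¬ n ≤ k), constRight w k = φ k hk := by
  let ψ (k : ℕ+) : trivW.obj M ⟶ X.right k := if hk : n ≤ k then constRight u k else φ k hk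
  have tailLift_ψ : tailLift (n := n) (fun k ↦ ψ k.1) = tailLift fun k ↦ constRight u k.1 :=
    congrArg tailLift (funext fun k ↦ dif_pos k.2)
  exact ⟨constHom (constLeft u) ψ n (by rw [tailLift_ψ, constHom_condition u n]), rfl,
    fun k hk ↦ dif_pos hk, fun k hk ↦ dif_neg hk⟩

variable [IsFinitelyPresentable.{0} M]

lemma exists_constLeft_eq (a : M ⟶ X.left) : ∃ u : constAD.obj M ⟶ X, constLeft u = a := by
  obtain ⟨m, g, hg⟩ := exists_comp_toGerms_eq (trivW.map a ≫ X.hom)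
  let φ (k : ℕ+) : trivW.obj M ⟶ X.right k :=
    if hk : m ≤ k then g ≫ tailπ X.right m ⟨k, hk⟩ else 0
  have tailLift_φ : tailLift (fun k ↦ φ k.1) = g :=
    tail_ext fun k ↦ (tailLift_π _ _).trans (dif_pos k.2)
  exact ⟨constHom a φ m (by rw [tailLift_φ, hg]), rfl⟩

lemma exists_forall_constRight_eq {u v : constAD.obj M ⟶ X} (h : constLeft u = constLeft v) :
    ∃ n : ℕ+, ∀ k, n ≤ k → constRight u k = constRight v k := by
  obtain ⟨n, _, _, e⟩ := exists_comp_tailRes_eq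
    (tailLift (n := 1) fun k ↦ constRight u k.1) (tailLift (n := 1) fun k ↦ constRight v k.1)
    (by rw [← constHom_condition, ← constHom_condition, h])
  rw [tailLift_tailRes, tailLift_tailRes] at e
  refine ⟨n, fun k hk ↦ ?_⟩
  simpa only [tailLift_π] using congrArg (· ≫ tailπ X.right n ⟨k, hk⟩) e

end ConstHom

section Lifting

variable {M N : DgQ} [IsFinitelyPresentable.{0} M] [IsFinitelyPresentable.{0} N] (i : M ⟶ N)
  {X Y : AD} (f : X ⟶ Y)

lemma hasLiftingProperty_constAD (h_left : HasLiftingProperty i f.left)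
    (h_right : ∀ k, HasLiftingProperty (trivW.map i) (f.right k)) :
    HasLiftingProperty (constAD.map i) f where
  sq_hasLift {u v} sq := by
    have sq_left : CommSq (constLeft u) i f.left (constLeft v) :=
      ⟨congrArg CommaMorphism.left sq.w⟩
    have sq_right (k : ℕ+) :
        CommSq (constRight u k) (trivW.map i) (f.right k) (constRight v k) :=
      ⟨congrFun (congrArg CommaMorphism.right sq.w) k⟩
    obtain ⟨l, l_left⟩ := exists_constLeft_eq sq_left.lift
    obtain ⟨n₁, hn₁⟩ := exists_forall_constRight_eq (u := constAD.map i ≫ l) (v := u)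
      ((congrArg (i ≫ ·) l_left).trans sq_left.fac_left)
    obtain ⟨n₂, hn₂⟩ := exists_forall_constRight_eq (u := l ≫ f) (v := v)
      ((congrArg (· ≫ f.left) l_left).trans sq_left.fac_right)
    obtain ⟨w, w_left, w_ge, w_lt⟩ :=
      exists_constRight_eq l (max n₁ n₂) fun k _ ↦ (sq_right k).lift
    refine ⟨⟨⟨w, constHom_ext ?_ fun k ↦ ?_, constHom_ext ?_ fun k ↦ ?_⟩⟩⟩
    · exact (congrArg (i ≫ ·) (w_left.trans l_left)).trans sq_left.fac_left
    · by_cases hk : max n₁ n₂ ≤ k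
      · exact (congrArg (trivW.map i ≫ ·) (w_ge k hk)).trans
          (hn₁ k ((le_max_left _ _).trans hk))
      · exact (congrArg (trivW.map i ≫ ·) (w_lt k hk)).trans (sq_right k).fac_left
    · exact (congrArg (· ≫ f.left) (w_left.trans l_left)).trans sq_left.fac_right
    · by_cases hk : max n₁ n₂ ≤ k
      · exact (congrArg (· ≫ f.right k) (w_ge k hk)).trans
          (hn₂ k ((le_max_right _ _).trans hk))
      · exact (congrArg (· ≫ f.right k) (w_lt k hk)).trans (sq_right k).fac_right

lemma hasLiftingProperty_left_of_constAD [HasLiftingProperty (constAD.map i) f] :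
    HasLiftingProperty i f.left where
  sq_hasLift {a b} sq := by
    obtain ⟨u, u_left⟩ := exists_constLeft_eq a
    obtain ⟨v, v_left⟩ := exists_constLeft_eq b
    obtain ⟨n, hn⟩ := exists_forall_constRight_eq (u := u ≫ f) (v := constAD.map i ≫ v)
      ((congrArg (· ≫ f.left) u_left).trans (sq.w.trans (congrArg (i ≫ ·) v_left.symm)))
    obtain ⟨u', u'_left, u'_ge, u'_lt⟩ := exists_constRight_eq u n fun _ _ ↦ 0
    obtain ⟨v', v'_left, v'_ge, v'_lt⟩ := exists_constRight_eq v n fun _ _ ↦ 0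
    have sq' : CommSq u' (constAD.map i) f v' := by
      refine ⟨constHom_ext ?_ fun k ↦ ?_⟩
      · exact (congrArg (· ≫ f.left) (u'_left.trans u_left)).trans
          (sq.w.trans (congrArg (i ≫ ·) (v'_left.trans v_left).symm))
      · change constRight u' k ≫ f.right k = trivW.map i ≫ constRight v' k
        by_cases hk : n ≤ k
        · rw [u'_ge k hk, v'_ge k hk]
          exact hn k hk
        · rw [u'_lt k hk, v'_lt k hk, zero_comp, comp_zero]
    exact ⟨⟨⟨constLeft sq'.lift,
      (congrArg constLeft sq'.fac_left).trans (u'_left.trans u_left),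
      (congrArg constLeft sq'.fac_right).trans (v'_left.trans v_left)⟩⟩⟩

end Lifting

/-! ### Maps with lifting properties against the generators -/

namespace DgQ

open HomologicalComplex

instance (n : ℤ) : Mono (genCofQ n) := mono_sphereToDisc n _

instance (n : ℤ) : Mono (genTrivCofQ n) := (isZero_zero DgQ).mono _

lemma weqQ_of_isZero_of_contractible {A B : DgQ} (hA : IsZero A) (hB : Contractible B)
    (i : A ⟶ B) : weqQ i := by
  have h₀ : weqQ (0 : B ⟶ A) :=
    homotopyEquivalences_le_quasiIso _ _ _ (hB.homotopyEquivalences_of_isZero hA _)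
  exact weqQ.of_postcomp i (0 : B ⟶ A) h₀ (hA.eq_of_src (𝟙 A) (i ≫ 0) ▸ weqQ.id_mem A)

lemma weqQ_genTrivCofQ (n : ℤ) : weqQ (genTrivCofQ n) :=
  weqQ_of_isZero_of_contractible (isZero_zero DgQ) (contractible_disc n _) _

lemma fibQ_of_hasLiftingProperty_genTrivCofQ {K L : DgQ} {p : K ⟶ L}
    (hp : ∀ n, HasLiftingProperty (genTrivCofQ n) p) : fibQ p := fun n y ↦ by
  let v : (disc n).obj (ModuleCat.of ℚ ℚ) ⟶ L :=
    mkHomFromDouble (down_rel n) (ne_sub_one n) (vec y) (vec y ≫ L.d n (n - 1)) (by simp) (by simp)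
  have sq : CommSq 0 (genTrivCofQ n) p v := ⟨(isZero_zero DgQ).eq_of_src _ _⟩
  let e₀ : ((disc n).obj (ModuleCat.of ℚ ℚ)).X n ≅ ModuleCat.of ℚ ℚ :=
    doubleXIso₀ (𝟙 _) (down_rel n)
  have hv : v.f n = e₀.hom ≫ vec y := mkHomFromDouble_f₀ _ _ _ _ _ _
  have lift_f : e₀.inv ≫ sq.lift.f n ≫ p.f n = vec y := by
    rw [← comp_f, sq.fac_right, hv, e₀.inv_hom_id_assoc]
  exact ⟨_, congr($lift_f (1 : ℚ)).trans (vec_one y)⟩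

end DgQ

namespace DgQW

open HomologicalComplex

instance mono_genCofQW (n : ℤ) : Mono (genCofQW n) := mono_iff.2 (DgQ.mono_sphereToDisc n _)

instance mono_genTrivCofQW (n : ℤ) : Mono (genTrivCofQW n) := (isZero_zero DgQW).mono _

lemma weqQW_genTrivCofQW (n : ℤ) : weqQW (genTrivCofQW n) :=
  DgQ.weqQ_of_isZero_of_contractible ((Action.forget DgQ W₂).map_isZero (isZero_zero DgQW))
    (DgQ.contractible_disc n _) _

section FreeHom

/-- The coefficient of `g` of an element of the group ring `ℚ[W]`. -/
def coeff (g : W₂) : groupRingQW.V ⟶ ModuleCat.of ℚ ℚ :=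
  ModuleCat.ofHom (Finsupp.lapply g)

/-- The unit of the group ring `ℚ[W]`. -/
def groupRingOne : ModuleCat.of ℚ ℚ ⟶ groupRingQW.V :=
  ModuleCat.ofHom (Finsupp.lsingle (1 : W₂))

lemma groupRingOne_coeff (g : W₂) : groupRingOne ≫ coeff g = if g = 1 then 𝟙 _ else 0 := by
  apply DgQ.vec_ext
  change Finsupp.single (1 : W₂) (1 : ℚ) g = _
  split_ifs with h
  · exact h ▸ Finsupp.single_eq_same
  · exact Finsupp.single_eq_of_ne h

lemma ρ_coeff (k g : W₂) : groupRingQW.ρ k ≫ coeff g = coeff (k⁻¹ * g) := by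
  refine ModuleCat.hom_ext (Finsupp.lhom_ext fun (a : W₂) b ↦ ?_)
  change Finsupp.mapDomain (fun x : W₂ ↦ k * x) (Finsupp.single a b) g =
    Finsupp.single a b (k⁻¹ * g)
  simp only [Finsupp.mapDomain_single, Finsupp.single_apply, eq_inv_mul_iff_mul_eq]

variable {F : VectQ ⥤ DgQ} {X Y : DgQW}

/-- The equivariant map `F(ℚ[W]) ⟶ X` extending a map of complexes `F(ℚ) ⟶ X`. -/
def freeHom (h : F.obj (ModuleCat.of ℚ ℚ) ⟶ X.V) : (F.mapAction W₂).obj groupRingQW ⟶ X where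
  hom := ∑ g : W₂, F.map (coeff g) ≫ h ≫ X.ρ g
  comm k := by
    rw [Preadditive.comp_sum, Preadditive.sum_comp]
    refine Fintype.sum_equiv (Equiv.mulLeft k⁻¹) _ _ fun g ↦ ?_
    change F.map (groupRingQW.ρ k) ≫ F.map (coeff g) ≫ h ≫ X.ρ g =
      (F.map (coeff (k⁻¹ * g)) ≫ h ≫ X.ρ (k⁻¹ * g)) ≫ X.ρ k
    have hX : X.ρ (k⁻¹ * g) ≫ X.ρ k = X.ρ g := by
      rw [← End.mul_def, ← map_mul, mul_inv_cancel_left]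
    rw [Category.assoc, Category.assoc, hX, ← ρ_coeff, F.map_comp, Category.assoc]

lemma map_groupRingOne_freeHom [F.PreservesZeroMorphisms] (h : F.obj (ModuleCat.of ℚ ℚ) ⟶ X.V) :
    F.map groupRingOne ≫ (freeHom h).hom = h := by
  change F.map groupRingOne ≫ ∑ g : W₂, F.map (coeff g) ≫ h ≫ X.ρ g = h
  rw [Preadditive.comp_sum, Finset.sum_eq_single 1]
  · rw [← F.map_comp_assoc, groupRingOne_coeff, if_pos rfl, F.map_id, Category.id_comp, map_one]
    exact Category.comp_id h
  · intro g _ hg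
    rw [← F.map_comp_assoc, groupRingOne_coeff, if_neg hg, F.map_zero, zero_comp]
  · exact fun h₁ ↦ absurd (Finset.mem_univ 1) h₁

lemma freeHom_comp (h : F.obj (ModuleCat.of ℚ ℚ) ⟶ X.V) (f : X ⟶ Y) :
    freeHom h ≫ f = freeHom (h ≫ f.hom) := by
  ext : 1
  change (∑ g : W₂, F.map (coeff g) ≫ h ≫ X.ρ g) ≫ f.hom =
    ∑ g : W₂, F.map (coeff g) ≫ (h ≫ f.hom) ≫ Y.ρ g
  simp only [Preadditive.sum_comp, Category.assoc, f.comm]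

lemma app_freeHom {G : VectQ ⥤ DgQ} (τ : F ⟶ G) (h : G.obj (ModuleCat.of ℚ ℚ) ⟶ X.V) :
    τ.app groupRingQW.V ≫ (freeHom h).hom = (freeHom (τ.app _ ≫ h)).hom := by
  change τ.app _ ≫ ∑ g : W₂, G.map (coeff g) ≫ h ≫ X.ρ g =
    ∑ g : W₂, F.map (coeff g) ≫ (τ.app _ ≫ h) ≫ X.ρ g
  simp only [Preadditive.comp_sum, Category.assoc, NatTrans.naturality_assoc]

end FreeHom

instance (n : ℤ) : (disc n).PreservesZeroMorphisms where
  map_zero M N := by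
    refine from_double_hom_ext (hi₀₁ := down_rel n) ?_ ?_
    all_goals
      dsimp only [disc]
      simp only [mkHomFromDouble_f₀, mkHomFromDouble_f₁, zero_comp]
      exact comp_zero

variable {X Y : DgQW} {p : X ⟶ Y} {n : ℤ}

lemma hasLiftingProperty_genCofQ [HasLiftingProperty (genCofQW n) p] :
    HasLiftingProperty (genCofQ n) p.hom where
  sq_hasLift {u v} sq := by
    have sq' : CommSq (freeHom u) (genCofQW n) p (freeHom v) := ⟨by
      rw [freeHom_comp, sq.w]
      exact Action.Hom.ext (app_freeHom (sphereToDisc n) v).symm⟩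
    let l : (disc n).obj groupRingQW.V ⟶ X.V := sq'.lift.hom
    have hl : (sphereToDisc n).app groupRingQW.V ≫ l = (freeHom (F := sphere (n - 1)) u).hom :=
      congrArg Action.Hom.hom sq'.fac_left
    have hl' : l ≫ p.hom = (freeHom (F := disc n) v).hom := congrArg Action.Hom.hom sq'.fac_right
    refine ⟨⟨⟨(disc n).map groupRingOne ≫ l, ?_, ?_⟩⟩⟩
    · refine ((sphereToDisc n).naturality_assoc groupRingOne l).symm.trans ?_
      rw [hl, map_groupRingOne_freeHom]
    · rw [Category.assoc, hl', map_groupRingOne_freeHom]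

lemma hasLiftingProperty_genTrivCofQ [HasLiftingProperty (genTrivCofQW n) p] :
    HasLiftingProperty (genTrivCofQ n) p.hom where
  sq_hasLift {u v} sq := by
    have sq' : CommSq 0 (genTrivCofQW n) p (freeHom v) := ⟨(isZero_zero DgQW).eq_of_src _ _⟩
    let l : (disc n).obj groupRingQW.V ⟶ X.V := sq'.lift.hom
    have hl : l ≫ p.hom = (freeHom (F := disc n) v).hom := congrArg Action.Hom.hom sq'.fac_right
    refine ⟨⟨⟨(disc n).map groupRingOne ≫ l, (isZero_zero DgQ).eq_of_src _ _, ?_⟩⟩⟩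
    rw [Category.assoc, hl, map_groupRingOne_freeHom]

lemma fibQW_inf_weqQW_of_hasLiftingProperty_genCofQW
    [∀ n, HasLiftingProperty (genCofQW n) p] : (fibQW ⊓ weqQW) p :=
  have (n : ℤ) : HasLiftingProperty (genCofQ n) p.hom := hasLiftingProperty_genCofQ
  ⟨DgQ.fibQ_of_hasLiftingProperty_genCofQ this, DgQ.weqQ_of_hasLiftingProperty_genCofQ this⟩

lemma fibQW_of_hasLiftingProperty_genTrivCofQW
    [∀ n, HasLiftingProperty (genTrivCofQW n) p] : fibQW p :=
  DgQ.fibQ_of_hasLiftingProperty_genTrivCofQ fun _ ↦ hasLiftingProperty_genTrivCofQ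

end DgQW

section Generation

instance {M N : DgQ} (i : M ⟶ N) [Mono i] : Mono (trivW.map i) :=
  DgQW.mono_iff.2 (inferInstanceAs (Mono i))

lemma skyAD_map_llp_of_mono {A B : DgQW} (j : A ⟶ B) [Mono j] (k : ℕ+) :
    (stalkFib ⊓ stalkWeq).llp ((skyAD k).map j) := fun _ _ p hp ↦
  ((skyStalkAdj k).hasLiftingProperty_iff j p).2
    (DgQW.hasLiftingProperty_of_mono j ⟨hp.1.2 k, hp.2.2 k⟩)

lemma skyAD_map_llp_of_weqQW {A B : DgQW} {j : A ⟶ B} [Mono j] (hj : weqQW j) (k : ℕ+) :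
    stalkFib.llp ((skyAD k).map j) := fun _ _ p hp ↦
  ((skyStalkAdj k).hasLiftingProperty_iff j p).2 (DgQW.llp_fibQW_of_mono j hj _ (hp.2 k))

lemma genCof_le_llp : genCof ≤ (stalkFib ⊓ stalkWeq).llp := by
  rintro _ _ _ (⟨⟨n⟩⟩ | ⟨⟨k, n⟩⟩)
  · exact fun _ _ p hp ↦ hasLiftingProperty_constAD (genCofQ n) p
      (DgQ.hasLiftingProperty_of_mono _ ⟨hp.1.1, hp.2.1⟩)
      fun k ↦ DgQW.hasLiftingProperty_of_mono _ ⟨hp.1.2 k, hp.2.2 k⟩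
  · exact skyAD_map_llp_of_mono _ k

lemma genTrivCof_le_llp : genTrivCof ≤ stalkFib.llp := by
  rintro _ _ _ (⟨⟨n⟩⟩ | ⟨⟨k, n⟩⟩)
  · have hn : weqQ (genTrivCofQ n) := DgQ.weqQ_genTrivCofQ n
    exact fun _ _ p hp ↦ hasLiftingProperty_constAD (genTrivCofQ n) p
      (DgQ.llp_fibQ_of_mono hn _ hp.1)
      fun k ↦ DgQW.llp_fibQW_of_mono (trivW.map (genTrivCofQ n)) hn _ (hp.2 k)
  · exact skyAD_map_llp_of_weqQW (DgQW.weqQW_genTrivCofQW n) k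

lemma genCof_rlp : genCof.rlp = stalkFib ⊓ stalkWeq := by
  refine le_antisymm (fun X Y p hp ↦ ?_) (MorphismProperty.le_llp_iff_le_rlp _ _ |>.1 genCof_le_llp)
  have h_left (n : ℤ) : HasLiftingProperty (genCofQ n) p.left :=
    have := hp _ (Or.inl ⟨n⟩)
    hasLiftingProperty_left_of_constAD (genCofQ n) p
  have h_right (k : ℕ+) : (fibQW ⊓ weqQW) (p.right k) :=
    have (n : ℤ) : HasLiftingProperty (genCofQW n) (p.right k) :=
      ((skyStalkAdj k).hasLiftingProperty_iff _ p).1 (hp _ (Or.inr ⟨(k, n)⟩))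
    DgQW.fibQW_inf_weqQW_of_hasLiftingProperty_genCofQW
  exact ⟨⟨DgQ.fibQ_of_hasLiftingProperty_genCofQ h_left, fun k ↦ (h_right k).1⟩,
    ⟨DgQ.weqQ_of_hasLiftingProperty_genCofQ h_left, fun k ↦ (h_right k).2⟩⟩

lemma genTrivCof_rlp : genTrivCof.rlp = stalkFib := by
  refine le_antisymm (fun X Y p hp ↦ ?_)
    (MorphismProperty.le_llp_iff_le_rlp _ _ |>.1 genTrivCof_le_llp)
  have h_left (n : ℤ) : HasLiftingProperty (genTrivCofQ n) p.left :=
    have := hp _ (Or.inl ⟨n⟩)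
    hasLiftingProperty_left_of_constAD (genTrivCofQ n) p
  have h_right (k : ℕ+) (n : ℤ) : HasLiftingProperty (genTrivCofQW n) (p.right k) :=
    ((skyStalkAdj k).hasLiftingProperty_iff _ p).1 (hp _ (Or.inr ⟨(k, n)⟩))
  exact ⟨DgQ.fibQ_of_hasLiftingProperty_genTrivCofQ h_left, fun k ↦
    have := h_right k
    DgQW.fibQW_of_hasLiftingProperty_genTrivCofQW⟩

end Generation

/-! ### The small object argument -/

section FinitelyManyStalks

open Cardinal

attribute [local instance] Cardinal.fact_isRegular_aleph0

variable {C D : Type*} [Category* C] [Category.{0} D] {J : Type} [SmallCategory J]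
  [IsCardinalFiltered J (ℵ₀ : Cardinal.{0})] {F : J ⥤ C} {c : Cocone F} (hc : IsColimit c)
  {T : Type} [Finite T] (E : T → C ⥤ D) [∀ t, PreservesColimitsOfShape J (E t)]
  {R : D} [IsFinitelyPresentable.{0} R]

include hc

lemma exists_forall_map_ι_eq (j₀ : J) (f : ∀ t, R ⟶ (E t).obj c.pt) :
    ∃ (j : J) (_ : j₀ ⟶ j) (g : ∀ t, R ⟶ (E t).obj (F.obj j)),
      ∀ t, g t ≫ (E t).map (c.ι.app j) = f t := by
  have := isFiltered_of_isCardinalFiltered J ℵ₀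
  choose j g hg using fun t ↦
    IsFinitelyPresentable.exists_hom_of_isColimit (isColimitOfPreserves (E t) hc) (f t)
  have hT := (hasCardinalLT_aleph0_iff.{0} (Option T)).2 inferInstance
  let stage (o : Option T) : J := o.elim j₀ j
  let m : J := IsCardinalFiltered.max stage hT
  let v₀ : j₀ ⟶ m := IsCardinalFiltered.toMax stage hT none
  let v (t : T) : j t ⟶ m := IsCardinalFiltered.toMax stage hT (some t)
  refine ⟨m, v₀, fun t ↦ g t ≫ (E t).map (F.map (v t)), fun t ↦ ?_⟩
  rw [Category.assoc, ← Functor.map_comp, c.w]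
  exact hg t

lemma exists_forall_comp_map_eq {j : J} (f g : ∀ t, R ⟶ (E t).obj (F.obj j))
    (h : ∀ t, f t ≫ (E t).map (c.ι.app j) = g t ≫ (E t).map (c.ι.app j)) :
    ∃ (j' : J) (u : j ⟶ j'), ∀ t, f t ≫ (E t).map (F.map u) = g t ≫ (E t).map (F.map u) := by
  have exists_stage (t : T) : ∃ (l : J) (u : j ⟶ l),
      f t ≫ (E t).map (F.map u) = g t ≫ (E t).map (F.map u) :=
    IsCardinalPresentable.exists_eq_of_isColimit' ℵ₀ (isColimitOfPreserves (E t) hc) _ _ (h t)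
  choose l u hu using exists_stage
  obtain ⟨m, a, b, hab⟩ := IsCardinalFiltered.wideSpan u
    ((hasCardinalLT_aleph0_iff.{0} T).2 inferInstance)
  refine ⟨m, b, fun t ↦ ?_⟩
  rw [← hab t, F.map_comp, Functor.map_comp, reassoc_of% (hu t)]

end FinitelyManyStalks

section Smallness

open Cardinal

attribute [local instance] Cardinal.fact_isRegular_aleph0

instance (n : ℕ+) : Finite {k : ℕ+ // ¬ n ≤ k} :=
  (Set.finite_Iio n).subset fun _ ↦ not_le.1

section ConstAD

variable {M : DgQ} [IsFinitelyPresentable.{0} M] {J : Type} [SmallCategory J]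
  [IsCardinalFiltered J (ℵ₀ : Cardinal.{0})] {F : J ⥤ AD} {c : Cocone F} (hc : IsColimit c)

include hc

lemma exists_constAD_comp_ι_eq (f : constAD.obj M ⟶ c.pt) :
    ∃ (j : J) (g : constAD.obj M ⟶ F.obj j), g ≫ c.ι.app j = f := by
  have := isFiltered_of_isCardinalFiltered J ℵ₀
  obtain ⟨j, a, ha⟩ := IsFinitelyPresentable.exists_hom_of_isColimit
    (isColimitOfPreserves stalkInf hc) (constLeft f)
  obtain ⟨u, u_left⟩ := exists_constLeft_eq a
  have u_ι_left : constLeft (u ≫ c.ι.app j) = constLeft f :=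
    (congrArg (· ≫ (c.ι.app j).left) u_left).trans ha
  obtain ⟨n, hn⟩ := exists_forall_constRight_eq u_ι_left
  obtain ⟨j', v, φ, hφ⟩ := exists_forall_map_ι_eq hc (fun t : {k // ¬ n ≤ k} ↦ stalk t.1) j
    fun t ↦ constRight f t.1
  obtain ⟨w, w_left, w_ge, w_lt⟩ := exists_constRight_eq (u ≫ F.map v) n fun k hk ↦ φ ⟨k, hk⟩
  have u_map_ι : (u ≫ F.map v) ≫ c.ι.app j' = u ≫ c.ι.app j := by rw [Category.assoc, c.w]
  refine ⟨j', w, constHom_ext ?_ fun k ↦ ?_⟩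
  · exact (congrArg (· ≫ (c.ι.app j').left) w_left).trans
      ((congrArg constLeft u_map_ι).trans u_ι_left)
  · by_cases hk : n ≤ k
    · exact (congrArg (· ≫ (c.ι.app j').right k) (w_ge k hk)).trans
        ((congrArg (constRight · k) u_map_ι).trans (hn k hk))
    · exact (congrArg (· ≫ (c.ι.app j').right k) (w_lt k hk)).trans (hφ ⟨k, hk⟩)

lemma exists_constAD_comp_map_eq {j : J} {f g : constAD.obj M ⟶ F.obj j}
    (h : f ≫ c.ι.app j = g ≫ c.ι.app j) :
    ∃ (j' : J) (v : j ⟶ j'), f ≫ F.map v = g ≫ F.map v := by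
  have := isFiltered_of_isCardinalFiltered J ℵ₀
  obtain ⟨j₁, v₁, hv₁⟩ := IsCardinalPresentable.exists_eq_of_isColimit' ℵ₀
    (isColimitOfPreserves stalkInf hc) (constLeft f) (constLeft g) (congrArg constLeft h)
  obtain ⟨n, hn⟩ := exists_forall_constRight_eq (u := f ≫ F.map v₁) (v := g ≫ F.map v₁) hv₁
  have h₁ : (f ≫ F.map v₁) ≫ c.ι.app j₁ = (g ≫ F.map v₁) ≫ c.ι.app j₁ := by
    rw [Category.assoc, Category.assoc, c.w, h]
  obtain ⟨j₂, v₂, hv₂⟩ := exists_forall_comp_map_eq hc (fun t : {k // ¬ n ≤ k} ↦ stalk t.1)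
    (fun t ↦ constRight (f ≫ F.map v₁) t.1) (fun t ↦ constRight (g ≫ F.map v₁) t.1)
    fun t ↦ congrArg (constRight · t.1) h₁
  refine ⟨j₂, v₁ ≫ v₂, ?_⟩
  rw [F.map_comp, ← Category.assoc, ← Category.assoc]
  refine constHom_ext (congrArg (· ≫ (F.map v₂).left) hv₁) fun k ↦ ?_
  by_cases hk : n ≤ k
  · exact congrArg (· ≫ (F.map v₂).right k) (hn k hk)
  · exact hv₂ ⟨k, hk⟩

end ConstAD

instance (M : DgQ) [IsFinitelyPresentable.{0} M] : IsFinitelyPresentable.{0} (constAD.obj M) :=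
  isCardinalPresentable_of_exists_factorization _ _
    (fun _ _ _ _ _ hc ↦ exists_constAD_comp_ι_eq hc)
    fun _ _ _ _ _ hc _ _ _ ↦ exists_constAD_comp_map_eq hc

instance (k : ℕ+) (R : DgQW) [IsFinitelyPresentable.{0} R] :
    IsFinitelyPresentable.{0} ((skyAD k).obj R) := by
  have : (stalk k).IsCardinalAccessible (ℵ₀ : Cardinal.{0}) := ⟨fun J _ _ ↦ inferInstance⟩
  exact (skyStalkAdj k).isCardinalPresentable_leftAdjoint_obj ℵ₀ R

instance : IsFinitelyPresentable.{0} groupRingQW.V :=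
  inferInstanceAs (IsFinitelyPresentable.{0} ((ModuleCat.free ℚ).obj (Multiplicative (ZMod 2))))

instance (n : ℤ) : IsFinitelyPresentable.{0} (((sphere n).mapAction W₂).obj groupRingQW) :=
  have : IsFinitelyPresentable.{0} (((sphere n).mapAction W₂).obj groupRingQW).V :=
    inferInstanceAs (IsFinitelyPresentable.{0} ((sphere n).obj groupRingQW.V))
  DgQW.isFinitelyPresentable _

instance : IsFinitelyPresentable.{0} (0 : DgQW) :=
  have : IsFinitelyPresentable.{0} (0 : DgQW).V := isCardinalPresentable_of_iso
    ((Action.forget DgQ W₂).map_isZero (isZero_zero DgQW)).isoZero.symm ℵ₀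
  DgQW.isFinitelyPresentable _

lemma isFinitelyPresentable_of_genCof {A B : AD} (f : A ⟶ B) (hf : genCof f) :
    IsFinitelyPresentable.{0} A := by
  obtain ⟨⟨n⟩⟩ | ⟨⟨k, n⟩⟩ := hf <;> infer_instance

lemma isFinitelyPresentable_of_genTrivCof {A B : AD} (f : A ⟶ B) (hf : genTrivCof f) :
    IsFinitelyPresentable.{0} A := by
  obtain ⟨⟨n⟩⟩ | ⟨⟨k, n⟩⟩ := hf <;> infer_instance

end Smallness

section IsSmall

variable {C : Type*} [Category* C] (I I' : MorphismProperty C)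

lemma isSmall_sup [MorphismProperty.IsSmall.{0} I] [MorphismProperty.IsSmall.{0} I'] :
    MorphismProperty.IsSmall.{0} (I ⊔ I') where
  small_toSet := inferInstanceAs (Small.{0} (I.toSet ∪ I'.toSet :))

end IsSmall

section SmallObjectArgument

open Cardinal

attribute [local instance] Cardinal.fact_isRegular_aleph0

variable {C : Type*} [Category.{0} C]

lemma isSmallRel_of_isFinitelyPresentable (A : C) [IsFinitelyPresentable.{0} A]
    (P : MorphismProperty C) : IsSmallRel A P :=
  ⟨0, fun J _ _ _ _ _ _ X Y f h ↦ by
    have : IsCardinalFiltered J (ℵ₀ : Cardinal.{0}) :=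
      (isCardinalFiltered_aleph0_iff.{0} J).2 inferInstance
    have := preservesColimitsOfShape_of_isCardinalPresentable A ℵ₀ J
    infer_instance⟩

lemma hasSmallObjectArgument_of_isFinitelyPresentable [HasColimitsOfSize.{0, 0} C]
    (I : MorphismProperty C) [MorphismProperty.IsSmall.{0} I]
    (hI : ∀ ⦃A B : C⦄ (f : A ⟶ B), I f → IsFinitelyPresentable.{0} A) :
    MorphismProperty.HasSmallObjectArgument.{0} I where
  exists_cardinal := by
    have : Nonempty (ℵ₀ : Cardinal.{0}).ord.ToType := by
      simp
    have := WellFoundedLT.toOrderBot (ℵ₀ : Cardinal.{0}).ord.ToType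
    refine ⟨ℵ₀, inferInstance, inferInstance, { preservesColimit {A _ _ _} i hi f hf := ?_ }⟩
    have := hI i hi
    have := preservesColimitsOfShape_of_isCardinalPresentable A ℵ₀
      (ℵ₀ : Cardinal.{0}).ord.ToType
    infer_instance

instance : MorphismProperty.IsSmall.{0} genCof := isSmall_sup _ _

instance : MorphismProperty.IsSmall.{0} genTrivCof := isSmall_sup _ _

instance : MorphismProperty.HasSmallObjectArgument.{0} genCof :=
  hasSmallObjectArgument_of_isFinitelyPresentable _ fun _ _ ↦ isFinitelyPresentable_of_genCof

instance : MorphismProperty.HasSmallObjectArgument.{0} genTrivCof :=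
  hasSmallObjectArgument_of_isFinitelyPresentable _ fun _ _ ↦ isFinitelyPresentable_of_genTrivCof

end SmallObjectArgument

/-! ### Limits and internal homs -/

section Separating

lemma hasLiftingProperty_equalizer_ι {C : Type*} [Category* C] {A B X Y : C} (i : A ⟶ B)
    {f g : X ⟶ Y} [HasEqualizer f g] (h : ∀ v : B ⟶ X, v ≫ f = v ≫ g) :
    HasLiftingProperty i (equalizer.ι f g) where
  sq_hasLift {u v} sq :=
    ⟨⟨⟨equalizer.lift v (h v), by ext; simpa using sq.w.symm, equalizer.lift_ι v (h v)⟩⟩⟩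

lemma epi_of_stalkFib {X Y : AD} {f : X ⟶ Y} (hf : stalkFib f) : Epi f where
  left_cancellation u v h := by
    have : Epi f.left := DgQ.epi_iff.2 hf.1
    have (k : ℕ+) : Epi (f.right k) := DgQW.epi_iff.2 (hf.2 k)
    refine CommaMorphism.ext ((cancel_epi f.left).1 (congrArg CommaMorphism.left h)) ?_
    exact funext fun k ↦ (cancel_epi (f.right k)).1 (congrFun (congrArg CommaMorphism.right h) k)

instance : HasEqualizers AD :=
  inferInstanceAs (HasLimitsOfShape WalkingParallelPair (Comma trivW germs))

/-- The codomains of the generating acyclic cofibrations, which separate the maps of `𝒜(𝒟)`. -/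
def genDiscs : ObjectProperty AD :=
  ObjectProperty.ofObj (Sum.elim (fun n : ℤ ↦ constAD.obj ((disc n).obj (ModuleCat.of ℚ ℚ)))
    fun p : ℕ+ × ℤ ↦ (skyAD p.1).obj (((disc p.2).mapAction W₂).obj groupRingQW))

instance : ObjectProperty.Small.{0} genDiscs := by
  unfold genDiscs
  infer_instance

lemma isSeparating_genDiscs : genDiscs.IsSeparating := by
  intro X Y f g h
  have rlp_equalizer_ι : genTrivCof.rlp (equalizer.ι f g) := by
    rintro _ _ _ (⟨⟨n⟩⟩ | ⟨⟨k, n⟩⟩)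
    · exact hasLiftingProperty_equalizer_ι _ (h _ ⟨Sum.inl n⟩)
    · exact hasLiftingProperty_equalizer_ι _ (h _ ⟨Sum.inr (k, n)⟩)
  have : Epi (equalizer.ι f g) := epi_of_stalkFib (genTrivCof_rlp.le _ rlp_equalizer_ι)
  exact eq_of_epi_equalizer

end Separating

section Coseparating

lemma isIso_of_stalks {X Y : AD} (f : X ⟶ Y) [IsIso f.left] [∀ k, IsIso (f.right k)] :
    IsIso f := by
  have : IsIso f.right := (isIso_pi_iff _).2 inferInstance
  exact (Comma.isoMk (asIso f.left) (asIso f.right) f.w).isIso_hom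

instance : Balanced AD where
  isIso_of_mono_of_epi f _ _ := by
    have : IsIso f.left := isIso_of_mono_of_epi (stalkInf.map f)
    have (k : ℕ+) : IsIso (f.right k) := isIso_of_mono_of_epi ((stalk k).map f)
    exact isIso_of_stalks f

instance : (Action.forget DgQ W₂).IsLeftAdjoint :=
  Functor.isLeftAdjoint_of_iso (Action.functorCategoryEquivalenceCompEvaluation DgQ W₂)

lemma map_eq_of_adjunction {C D : Type*} [Category* C] [Category* D] {L : C ⥤ D} {R : D ⥤ C}
    (adj : L ⊣ R) {Z : D} (hZ : IsCoseparator Z) {X Y : C} {f g : X ⟶ Y}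
    (h : ∀ u : Y ⟶ R.obj Z, f ≫ u = g ≫ u) : L.map f = L.map g :=
  hZ.def _ _ fun v ↦ (adj.homEquiv _ _).injective <| by
    rw [adj.homEquiv_naturality_left, adj.homEquiv_naturality_left, h]

/-- The objects of `𝒜(𝒟)` cofreely generated at one stalk by a coseparator of complexes. -/
def cofreeCoseparators : ObjectProperty AD :=
  ObjectProperty.ofObj fun o : Option ℕ+ ↦ o.elim (infAD.obj (coseparator DgQ))
    fun k ↦ (skyAD k).obj ((Action.forget DgQ W₂).rightAdjoint.obj (coseparator DgQ))

instance : ObjectProperty.Small.{0} cofreeCoseparators := by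
  unfold cofreeCoseparators
  infer_instance

lemma isCoseparating_cofreeCoseparators : cofreeCoseparators.IsCoseparating := by
  intro X Y f g h
  refine CommaMorphism.ext ?_ (funext fun k ↦ Action.Hom.ext ?_)
  · exact map_eq_of_adjunction stalkInfAdj (isCoseparator_coseparator DgQ) (h _ ⟨none⟩)
  · exact map_eq_of_adjunction
      ((stalkSkyAdj k).comp (Adjunction.ofIsLeftAdjoint (Action.forget DgQ W₂)))
      (isCoseparator_coseparator DgQ) (h _ ⟨some k⟩)

instance : WellPowered.{0} ADᵒᵖ :=
  wellPowered_of_isDetecting ((ObjectProperty.isDetecting_op_iff _).2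
    isCoseparating_cofreeCoseparators.isCodetecting)

instance : HasLimitsOfSize.{0, 0} AD :=
  hasLimits_of_hasColimits_of_isSeparating isSeparating_genDiscs

end Coseparating

section PreservesColimits

variable {J : Type} [SmallCategory J] {D : Type*} [Category* D]

def isColimitOfStalks {F : J ⥤ AD} {c : Cocone F} (h_left : IsColimit (stalkInf.mapCocone c))
    (h_right : ∀ k, IsColimit ((stalk k).mapCocone c)) : IsColimit c := by
  let φ : colimit.cocone F ⟶ c := (colimit.isColimit F).descCoconeMorphism c
  have isIso_map {E : Type 1} [Category.{0} E] (G : AD ⥤ E) [PreservesColimitsOfShape J G]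
      (h : IsColimit (G.mapCocone c)) : IsIso (G.map φ.hom) := by
    have := IsColimit.hom_isIso (isColimitOfPreserves G (colimit.isColimit F)) h
      ((Cocone.functoriality F G).map φ)
    exact inferInstanceAs (IsIso ((Cocone.forget _).map ((Cocone.functoriality F G).map φ)))
  have : IsIso φ.hom.left := isIso_map stalkInf h_left
  have (k : ℕ+) : IsIso (φ.hom.right k) := isIso_map (stalk k) (h_right k)
  have : IsIso ((colimit.isColimit F).desc c) := isIso_of_stalks φ.hom
  exact IsColimit.ofPointIso (colimit.isColimit F)

lemma preservesColimitsOfShape_of_stalks (H : D ⥤ AD)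
    [PreservesColimitsOfShape J (H ⋙ stalkInf)]
    [∀ k, PreservesColimitsOfShape J (H ⋙ stalk k)] : PreservesColimitsOfShape J H where
  preservesColimit := ⟨fun hc ↦ ⟨isColimitOfStalks
    (isColimitOfPreserves (H ⋙ stalkInf) hc) fun k ↦ isColimitOfPreserves (H ⋙ stalk k) hc⟩⟩

instance (X : AD) : PreservesColimitsOfShape J (MonoidalCategory.tensorLeft X) := by
  have : PreservesColimitsOfShape J (MonoidalCategory.tensorLeft X ⋙ stalkInf) :=
    inferInstanceAs (PreservesColimitsOfShape J (stalkInf ⋙ MonoidalCategory.tensorLeft X.left))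
  have (k : ℕ+) : PreservesColimitsOfShape J (MonoidalCategory.tensorLeft X ⋙ stalk k) :=
    inferInstanceAs (PreservesColimitsOfShape J
      (stalk k ⋙ MonoidalCategory.tensorLeft (C := DgQW) (X.right k)))
  exact preservesColimitsOfShape_of_stalks _

instance : PreservesColimitsOfShape J constAD := by
  have : PreservesColimitsOfShape J (constAD ⋙ stalkInf) :=
    inferInstanceAs (PreservesColimitsOfShape J (𝟭 DgQ))
  have (k : ℕ+) : PreservesColimitsOfShape J (constAD ⋙ stalk k) :=
    inferInstanceAs (PreservesColimitsOfShape J trivW)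
  exact preservesColimitsOfShape_of_stalks _

instance (X : AD) : (MonoidalCategory.tensorLeft X).IsLeftAdjoint :=
  haveI : PreservesColimits (MonoidalCategory.tensorLeft X) := ⟨inferInstance⟩
  isLeftAdjoint_of_preservesColimits_of_isSeparating isSeparating_genDiscs _

instance monoidalClosed_AD : MonoidalClosed AD where
  closed X :=
    { rightAdj := (MonoidalCategory.tensorLeft X).rightAdjoint
      adj := Adjunction.ofIsLeftAdjoint _ }

end PreservesColimits

/-! ### The pushout-product axiom -/

section PushoutProduct

open MonoidalCategory

variable {C : Type*} [Category* C] [MonoidalCategory C] {I P : MorphismProperty C}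
  {X₁ X₂ Y₁ Y₂ : C} {i : X₁ ⟶ X₂} {j : Y₁ ⟶ Y₂}

lemma flipTensor_llp [BraidedCategory C] (sq : (curriedTensor C).PushoutObjObj i j)
    (h : P.llp sq.ι) : P.llp sq.flipTensor.ι :=
  P.llp.comp_mem _ _ h (P.llp.of_isIso _)

variable [MonoidalClosed C] [HasPullbacks C]

lemma pushoutProduct_llp_of_rlp_llp_right
    (h : ∀ ⦃A B : C⦄ (g : A ⟶ B), I g → ∃ sq : (curriedTensor C).PushoutObjObj i g, P.llp sq.ι)
    (hj : I.rlp.llp j) (sq : (curriedTensor C).PushoutObjObj i j) : P.llp sq.ι := by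
  intro U V p hp
  let pullbackHom := Functor.PullbackObjObj.ofHasPullback MonoidalClosed.internalHom i p
  refine (MonoidalClosed.internalHomAdjunction₂.hasLiftingProperty_iff sq pullbackHom).2
    (hj _ fun A B g hg ↦ ?_)
  obtain ⟨sq', hsq'⟩ := h g hg
  exact (MonoidalClosed.internalHomAdjunction₂.hasLiftingProperty_iff sq' pullbackHom).1
    (hsq' p hp)

lemma pushoutProduct_llp_of_rlp_llp [BraidedCategory C] [HasPushouts C]
    (h : ∀ ⦃A B A' B' : C⦄ (f : A ⟶ B) (g : A' ⟶ B'), I f → I g →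
      ∃ sq : (curriedTensor C).PushoutObjObj f g, P.llp sq.ι)
    (hi : I.rlp.llp i) (hj : I.rlp.llp j) (sq : (curriedTensor C).PushoutObjObj i j) :
    P.llp sq.ι :=
  pushoutProduct_llp_of_rlp_llp_right (fun _ _ g hg ↦ ⟨_, flipTensor_llp _ <|
    pushoutProduct_llp_of_rlp_llp_right (fun _ _ f hf ↦ h g f hg hf) hi
      (Functor.PushoutObjObj.ofHasPushout _ _ _)⟩) hj sq

end PushoutProduct

section Concentrated

open MonoidalCategory

lemma isZero_of_isPushout {C : Type*} [Category* C] [HasZeroMorphisms C] {A X Y Z : C} {f : A ⟶ X}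
    {g : A ⟶ Y} {inl : X ⟶ Z} {inr : Y ⟶ Z} (sq : IsPushout f g inl inr) (hX : IsZero X)
    (hY : IsZero Y) : IsZero Z :=
  (IsZero.iff_id_eq_zero _).2 (sq.hom_ext (hX.eq_of_src _ _) (hY.eq_of_src _ _))

/-- An object of `𝒜(𝒟)` is concentrated at `k` if all its other stalks, including the one at
`∞`, vanish. -/
structure IsConcentrated (k : ℕ+) (X : AD) : Prop where
  left : IsZero X.left
  right : ∀ l, l ≠ k → IsZero (X.right l)

lemma isConcentrated_skyAD (k : ℕ+) (R : DgQW) : IsConcentrated k ((skyAD k).obj R) :=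
  ⟨isZero_zero _, fun _ hl ↦ isZero_single hl R⟩

namespace IsConcentrated

variable {k : ℕ+} {A B X Y Z : AD}

lemma tensor (h : IsConcentrated k X) (Y : AD) : IsConcentrated k (X ⊗ Y) :=
  ⟨(tensorRight Y.left).map_isZero h.left,
    fun l hl ↦ (tensorRight (Y.right l)).map_isZero (h.right l hl)⟩

lemma of_isPushout {f : A ⟶ X} {g : A ⟶ Y} {inl : X ⟶ Z} {inr : Y ⟶ Z}
    (sq : IsPushout f g inl inr) (hX : IsConcentrated k X) (hY : IsConcentrated k Y) :
    IsConcentrated k Z :=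
  ⟨isZero_of_isPushout (sq.map stalkInf) hX.left hY.left,
    fun l hl ↦ isZero_of_isPushout (sq.map (stalk l)) (hX.right l hl) (hY.right l hl)⟩

lemma isIso_counit (h : IsConcentrated k X) : IsIso ((skyStalkAdj k).counit.app X) := by
  have : IsIso ((skyStalkAdj k).counit.app X).left := (isZero_zero _).isIso h.left _
  have (l : ℕ+) : IsIso (((skyStalkAdj k).counit.app X).right l) := by
    by_cases hl : l = k
    · subst hl
      have : IsIso ((skyStalkAdj l).unit.app ((stalk l).obj X)) :=
        inferInstanceAs (IsIso ((GradedObject.singleObjApplyIso l (X.right l)).inv ≫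
          𝟙 ((GradedObject.single l).obj (X.right l) l)))
      exact (IsIso.of_isIso_fac_left ((skyStalkAdj l).right_triangle_components X) :)
    · exact (isZero_single hl _).isIso (h.right l hl) _
  exact isIso_of_stalks _

lemma hasLiftingProperty (hA : IsConcentrated k A) (hB : IsConcentrated k B) (i : A ⟶ B)
    (p : X ⟶ Y) [HasLiftingProperty (i.right k) (p.right k)] : HasLiftingProperty i p := by
  have := hA.isIso_counit
  have := hB.isIso_counit
  have h : HasLiftingProperty ((skyAD k).map ((stalk k).map i)) p :=
    ((skyStalkAdj k).hasLiftingProperty_iff _ p).2 ‹_›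
  exact HasLiftingProperty.of_arrow_iso_left (Arrow.isoMk (asIso ((skyStalkAdj k).counit.app A))
    (asIso ((skyStalkAdj k).counit.app B)) ((skyStalkAdj k).counit.naturality i).symm) p

end IsConcentrated

end Concentrated

section Stalks

open MonoidalCategory

instance {A B : DgQW} (i : A ⟶ B) [Mono i] : Mono i.hom := DgQW.mono_iff.1 ‹_›

/-- The complex underlying the stalk at `k`. -/
abbrev underlyingStalk (k : ℕ+) : AD ⥤ DgQ := stalk k ⋙ Action.forget DgQ W₂

variable {X₁ X₂ Y₁ Y₂ : AD} {i : X₁ ⟶ X₂} {j : Y₁ ⟶ Y₂}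
    (sq : (curriedTensor AD).PushoutObjObj i j)

lemma mono_right_pushoutProduct (k : ℕ+) [Mono (i.right k)] [Mono (j.right k)] :
    Mono (sq.ι.right k) :=
  DgQW.mono_iff.2 (mono_pushoutProduct (f := (i.right k).hom) (g := (j.right k).hom)
    (sq.isPushout.map (underlyingStalk k)) _
    (congrArg (underlyingStalk k).map sq.inl_ι) (congrArg (underlyingStalk k).map sq.inr_ι))

lemma stalkWeq_pushoutProduct [Mono i.left] [Mono j.left] [∀ k, Mono (i.right k)]
    [∀ k, Mono (j.right k)] (h : stalkWeq i ∨ stalkWeq j) : stalkWeq sq.ι := by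
  refine ⟨DgQ.weqQ_pushoutProduct (h.imp And.left And.left) (sq.isPushout.map stalkInf) _
    (congrArg CommaMorphism.left sq.inl_ι) (congrArg CommaMorphism.left sq.inr_ι), fun k ↦ ?_⟩
  exact DgQ.weqQ_pushoutProduct (f := (i.right k).hom) (g := (j.right k).hom)
    (h.imp (fun h ↦ h.2 k) fun h ↦ h.2 k) (sq.isPushout.map (underlyingStalk k)) _
    (congrArg (underlyingStalk k).map sq.inl_ι) (congrArg (underlyingStalk k).map sq.inr_ι)

end Stalks

section Const

open MonoidalCategory

lemma toGerms_μ (V V' : ℕ+ → DgQW) (n : ℕ+) :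
    (toGerms V n ⊗ₘ toGerms V' n) ≫ Functor.LaxMonoidal.μ germs V V' =
      tailMu V V' n ≫ toGerms (fun k ↦ V k ⊗ V' k) n :=
  (ι_colimMu_assoc _ _ n (colim.map (Functor.LaxMonoidal.μ (tails DgQW) V V'))).trans
    (ι_colimMap (Functor.LaxMonoidal.μ (tails DgQW) V V') n)

lemma tailLift_tensorHom_tailMu {K L : DgQW} {V V' : ℕ+ → DgQW} {n : ℕ+}
    (φ : ∀ k : {k : ℕ+ // n ≤ k}, K ⟶ V k) (ψ : ∀ k : {k : ℕ+ // n ≤ k}, L ⟶ V' k) :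
    (tailLift φ ⊗ₘ tailLift ψ) ≫ tailMu V V' n =
      tailLift (V := fun k ↦ V k ⊗ V' k) fun k ↦ φ k ⊗ₘ ψ k :=
  tail_ext fun k ↦ by
    rw [Category.assoc, tailMu_π, tensorHom_comp_tensorHom, tailLift_π, tailLift_π, tailLift_π]

lemma diagGerm_tensorHom_μ (K L : DgQ) :
    (diagGerm K ⊗ₘ diagGerm L) ≫
        Functor.LaxMonoidal.μ germs (fun _ ↦ trivW.obj K) (fun _ ↦ trivW.obj L) =
      tailLift (n := 1) (V := fun _ ↦ trivW.obj K ⊗ trivW.obj L) (fun _ ↦ 𝟙 _) ≫ toGerms _ 1 := by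
  have h := tailLift_tensorHom_tailMu (n := 1) (V := fun _ ↦ trivW.obj K)
    (V' := fun _ ↦ trivW.obj L) (fun _ ↦ 𝟙 _) fun _ ↦ 𝟙 _
  simp only [id_tensorHom_id] at h
  rw [← h, Category.assoc, ← toGerms_μ, tensorHom_comp_tensorHom_assoc]
  rfl

/-- The comparison `c (K ⊗ L) ⟶ c K ⊗ c L`. -/
def constTensor (K L : DgQ) : constAD.obj (K ⊗ L) ⟶ constAD.obj K ⊗ constAD.obj L :=
  constHom (X := constAD.obj K ⊗ constAD.obj L) (𝟙 _)
    (fun _ ↦ Functor.OplaxMonoidal.δ trivW K L) 1 (by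
    refine (congrArg (· ≫ _) (trivW.map_id _)).trans ((Category.id_comp _).trans ?_)
    refine (congrArg (Functor.OplaxMonoidal.δ trivW K L ≫ ·) (diagGerm_tensorHom_μ K L)).trans ?_
    refine (Category.assoc _ _ _).symm.trans (congrArg (· ≫ _) (tail_ext fun k ↦ ?_))
    rw [Category.assoc, tailLift_π, Category.comp_id]
    exact (tailLift_π (V := fun _ ↦ trivW.obj K ⊗ trivW.obj L)
      (fun _ ↦ Functor.OplaxMonoidal.δ trivW K L) k).symm)

instance (K L : DgQ) : IsIso (constTensor K L) := by
  have : IsIso (constTensor K L).left := inferInstanceAs (IsIso (𝟙 (K ⊗ L)))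
  have (k : ℕ+) : IsIso ((constTensor K L).right k) := by
    have : IsIso ((Action.forget DgQ W₂).map ((constTensor K L).right k)) :=
      inferInstanceAs (IsIso (𝟙 (K ⊗ L)))
    exact isIso_of_reflects_iso _ (Action.forget DgQ W₂)
  exact isIso_of_stalks _

lemma constTensor_naturality {K K' L L' : DgQ} (f : K ⟶ K') (g : L ⟶ L') :
    constAD.map (f ⊗ₘ g) ≫ constTensor K' L' =
      constTensor K L ≫ (constAD.map f ⊗ₘ constAD.map g) :=
  constHom_ext ((Category.comp_id _).trans (Category.id_comp _).symm)
    fun _ ↦ Action.Hom.ext ((Category.comp_id _).trans (Category.id_comp _).symm)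

/-- The pushout-product of constant maps is constant. -/
def constPushoutObjObj {K K' L L' : DgQ} {f : K ⟶ K'} {g : L ⟶ L'}
    (sq : (curriedTensor DgQ).PushoutObjObj f g) :
    (curriedTensor AD).PushoutObjObj (constAD.map f) (constAD.map g) where
  pt := constAD.obj sq.pt
  inl := inv (constTensor K' L) ≫ constAD.map sq.inl
  inr := inv (constTensor K L') ≫ constAD.map sq.inr
  isPushout := (sq.isPushout.map constAD).of_iso (asIso (constTensor K L))
    (asIso (constTensor K' L)) (asIso (constTensor K L')) (Iso.refl _)
    (by simpa using constTensor_naturality f (𝟙 L)) (by simpa using constTensor_naturality (𝟙 K) g)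
    (by simp) (by simp)
  ι := constAD.map sq.ι ≫ constTensor K' L'
  inl_ι := by
    rw [Category.assoc, ← Functor.map_comp_assoc, sq.inl_ι, IsIso.inv_comp_eq]
    simpa using constTensor_naturality (𝟙 K') g
  inr_ι := by
    rw [Category.assoc, ← Functor.map_comp_assoc, sq.inr_ι, IsIso.inv_comp_eq]
    simpa using constTensor_naturality f (𝟙 L')

instance : constAD.IsLeftAdjoint :=
  haveI : PreservesColimits constAD := ⟨inferInstance⟩
  isLeftAdjoint_of_preservesColimits_of_isSeparating (isSeparator_separator DgQ) constAD

lemma constAD_map_llp_of_mono {K L : DgQ} (i : K ⟶ L) [Mono i] :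
    (stalkFib ⊓ stalkWeq).llp (constAD.map i) := by
  intro X Y p hp
  let adj := Adjunction.ofIsLeftAdjoint constAD
  have (n : ℤ) : HasLiftingProperty (genCofQ n) (constAD.rightAdjoint.map p) :=
    (adj.hasLiftingProperty_iff _ p).1 (genCof_le_llp _ (Or.inl ⟨n⟩) _ hp)
  exact (adj.hasLiftingProperty_iff i p).2 (DgQ.hasLiftingProperty_of_mono i
    ⟨DgQ.fibQ_of_hasLiftingProperty_genCofQ this, DgQ.weqQ_of_hasLiftingProperty_genCofQ this⟩)

end Const

section Cofibrations

open MonoidalCategory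

lemma pushoutProduct_skyAD_llp {k : ℕ+} {R R' : DgQW} {f : R ⟶ R'} [Mono f] {Y₁ Y₂ : AD}
    {g : Y₁ ⟶ Y₂} [Mono (g.right k)]
    (sq : (curriedTensor AD).PushoutObjObj ((skyAD k).map f) g) :
    (stalkFib ⊓ stalkWeq).llp sq.ι := by
  intro U V p hp
  have : Mono (((skyAD k).map f).right k) :=
    ((MorphismProperty.monomorphisms DgQW).arrow_mk_iso_iff (singleMapIso f)).2 ‹Mono f›
  have := mono_right_pushoutProduct sq k
  have : HasLiftingProperty (sq.ι.right k) (p.right k) :=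
    DgQW.hasLiftingProperty_of_mono _ ⟨hp.1.2 k, hp.2.2 k⟩
  have hR := isConcentrated_skyAD k R
  have hR' := isConcentrated_skyAD k R'
  exact (IsConcentrated.of_isPushout sq.isPushout (hR'.tensor _) (hR.tensor _)).hasLiftingProperty
    (hR'.tensor _) sq.ι p

lemma pushoutProduct_constAD_llp {K K' L L' : DgQ} (f : K ⟶ K') (g : L ⟶ L') [Mono f] [Mono g] :
    ∃ sq : (curriedTensor AD).PushoutObjObj (constAD.map f) (constAD.map g),
      (stalkFib ⊓ stalkWeq).llp sq.ι := by
  let sq := Functor.PushoutObjObj.ofHasPushout (curriedTensor DgQ) f g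
  have : Mono sq.ι := mono_pushoutProduct sq.isPushout sq.ι sq.inl_ι sq.inr_ι
  exact ⟨constPushoutObjObj sq,
    MorphismProperty.comp_mem _ _ _ (constAD_map_llp_of_mono sq.ι)
      (MorphismProperty.of_isIso _ _)⟩

lemma pushoutProduct_llp {X₁ X₂ Y₁ Y₂ : AD} {i : X₁ ⟶ X₂} {j : Y₁ ⟶ Y₂}
    (hi : (stalkFib ⊓ stalkWeq).llp i) (hj : (stalkFib ⊓ stalkWeq).llp j)
    (sq : (curriedTensor AD).PushoutObjObj i j) : (stalkFib ⊓ stalkWeq).llp sq.ι := by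
  rw [← genCof_rlp] at hi hj
  refine pushoutProduct_llp_of_rlp_llp (fun A B A' B' f g hf hg ↦ ?_) hi hj sq
  have := mono_right_of_llp (genCof_le_llp _ hf)
  have := mono_right_of_llp (genCof_le_llp _ hg)
  obtain ⟨⟨n⟩⟩ | ⟨⟨k, n⟩⟩ := hf
  · obtain ⟨⟨m⟩⟩ | ⟨⟨k, m⟩⟩ := hg
    · exact pushoutProduct_constAD_llp (genCofQ n) (genCofQ m)
    · exact ⟨_, flipTensor_llp _ <| pushoutProduct_skyAD_llp <|
        Functor.PushoutObjObj.ofHasPushout _ ((skyAD k).map (genCofQW m)) _⟩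
  · exact ⟨Functor.PushoutObjObj.ofHasPushout _ _ _, pushoutProduct_skyAD_llp _⟩

end Cofibrations

/-! ### The model structure -/

instance : weqQW.HasTwoOutOfThreeProperty :=
  inferInstanceAs (weqQ.inverseImage (Action.forget DgQ W₂)).HasTwoOutOfThreeProperty

instance : stalkWeq.HasTwoOutOfThreeProperty where
  comp_mem _ _ hf hg := ⟨weqQ.comp_mem _ _ hf.1 hg.1, fun k ↦ weqQW.comp_mem _ _ (hf.2 k) (hg.2 k)⟩
  of_postcomp f g hg hfg := ⟨weqQ.of_postcomp f.left g.left hg.1 hfg.1,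
    fun k ↦ weqQW.of_postcomp (f.right k) (g.right k) (hg.2 k) (hfg.2 k)⟩
  of_precomp f g hf hfg := ⟨weqQ.of_precomp f.left g.left hf.1 hfg.1,
    fun k ↦ weqQW.of_precomp (f.right k) (g.right k) (hf.2 k) (hfg.2 k)⟩

lemma stalkWeq_of_llp {X Y : AD} {f : X ⟶ Y} (hf : stalkFib.llp f) : stalkWeq f :=
  ⟨DgQ.weqQ_of_llp (llp_left_of_llp_stalkFib hf),
    fun k ↦ DgQW.weqQW_of_llp (llp_right_of_llp_stalkFib hf k)⟩

lemma hasFunctorialFactorization_cof :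
    MorphismProperty.HasFunctorialFactorization (stalkFib ⊓ stalkWeq).llp
      (stalkFib ⊓ stalkWeq) := by
  rw [← genCof_rlp]
  infer_instance

lemma hasFunctorialFactorization_trivCof :
    MorphismProperty.HasFunctorialFactorization stalkFib.llp stalkFib := by
  rw [← genTrivCof_rlp]
  infer_instance

instance : (stalkFib ⊓ stalkWeq).IsStableUnderRetracts :=
  genCof_rlp ▸ MorphismProperty.rlp_isStableUnderRetracts genCof

instance : stalkFib.IsStableUnderRetracts :=
  genTrivCof_rlp ▸ MorphismProperty.rlp_isStableUnderRetracts genTrivCof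

lemma stalkFib_llp : stalkFib.llp = (stalkFib ⊓ stalkWeq).llp ⊓ stalkWeq := by
  refine le_antisymm (fun X Y f hf ↦
    ⟨MorphismProperty.antitone_llp inf_le_left _ hf, stalkWeq_of_llp hf⟩) fun X Y f hf ↦ ?_
  have := hasFunctorialFactorization_trivCof
  let fac := MorphismProperty.factorizationData stalkFib.llp stalkFib f
  have hp : stalkWeq fac.p := stalkWeq.of_precomp fac.i fac.p (stalkWeq_of_llp fac.hi) (by
    rw [fac.fac]
    exact hf.2)
  have : HasLiftingProperty f fac.p := hf.1 _ ⟨fac.hp, hp⟩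
  exact MorphismProperty.of_retract (RetractArrow.ofLeftLiftingProperty fac.fac) fac.hi

/-- The model structure on `𝒜(𝒟)` with the stalkwise projective weak equivalences and
fibrations. -/
abbrev modelCategoryAD : ModelCategory AD :=
  letI : CategoryWithFibrations AD := ⟨stalkFib⟩
  letI : CategoryWithCofibrations AD := ⟨(stalkFib ⊓ stalkWeq).llp⟩
  letI : CategoryWithWeakEquivalences AD := ⟨stalkWeq⟩
  haveI : (weakEquivalences AD).HasTwoOutOfThreeProperty :=
    inferInstanceAs stalkWeq.HasTwoOutOfThreeProperty
  haveI : (cofibrations AD).IsWeakFactorizationSystem (trivialFibrations AD) :=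
    haveI := hasFunctorialFactorization_cof
    .mk' (stalkFib ⊓ stalkWeq).llp (stalkFib ⊓ stalkWeq) fun _ p hi hp ↦ hi p hp
  haveI : (trivialCofibrations AD).IsWeakFactorizationSystem (fibrations AD) := by
    have := hasFunctorialFactorization_trivCof
    rw [show trivialCofibrations AD = stalkFib.llp from stalkFib_llp.symm]
    exact .mk' stalkFib.llp stalkFib fun _ p hi hp ↦ hi p hp
  ModelCategory.mk' AD

section Axioms

attribute [local instance] modelCategoryAD

lemma trivialCofibrations_AD : trivialCofibrations AD = stalkFib.llp := stalkFib_llp.symm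

lemma isCompleteFunctorial_AD : IsCompleteFunctorial AD where
  hasLimits := inferInstance
  hasColimits := inferInstance
  factor_cof := hasFunctorialFactorization_cof
  factor_trivCof := by
    rw [trivialCofibrations_AD]
    exact hasFunctorialFactorization_trivCof

lemma isCofibrantlyGeneratedBy_AD : IsCofibrantlyGeneratedBy genCof genTrivCof where
  isSmall_cof := inferInstance
  isSmall_trivCof := inferInstance
  small_cof A _ f hf :=
    haveI := isFinitelyPresentable_of_genCof f hf
    isSmallRel_of_isFinitelyPresentable A _
  small_trivCof A _ f hf :=
    haveI := isFinitelyPresentable_of_genTrivCof f hf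
    isSmallRel_of_isFinitelyPresentable A _
  fibrations_eq := genTrivCof_rlp.symm
  trivialFibrations_eq := genCof_rlp.symm

lemma stalkWeq_whiskerRight {X Y : AD} {f : X ⟶ Y} (hf : stalkWeq f) (Z : AD) :
    stalkWeq (f ▷ Z) :=
  ⟨DgQ.weqQ_whiskerRight hf.1 _, fun k ↦ DgQ.weqQ_whiskerRight (hf.2 k) _⟩

lemma stalkWeq_whiskerLeft {X Y : AD} {f : X ⟶ Y} (hf : stalkWeq f) (Z : AD) :
    stalkWeq (Z ◁ f) :=
  ⟨DgQ.weqQ_whiskerLeft hf.1 _, fun k ↦ DgQ.weqQ_whiskerLeft (hf.2 k) _⟩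

lemma isMonoidalModel_AD : IsMonoidalModel AD where
  closed := ⟨inferInstance⟩
  pushoutProduct_cof _ _ _ _ _ _ sq hi hj := ⟨pushoutProduct_llp hi.mem hj.mem sq⟩
  pushoutProduct_weq _ _ _ _ _ _ sq hi hj h :=
    have := mono_left_of_llp hi.mem
    have := mono_left_of_llp hj.mem
    have := mono_right_of_llp hi.mem
    have := mono_right_of_llp hj.mem
    ⟨stalkWeq_pushoutProduct sq (h.imp (·.mem) (·.mem))⟩
  unit_left _ _ X _ hq _ := ⟨stalkWeq_whiskerRight hq.mem X⟩
  unit_right _ _ X _ hq _ := ⟨stalkWeq_whiskerLeft hq.mem X⟩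

lemma isProperModel_AD : IsProperModel AD where
  left _ _ _ _ f i i' f' sq hf hi := by
    have : Mono (stalkInf.map i) := mono_left_of_llp hi.mem
    have : QuasiIso (stalkInf.map f) := hf.mem.1
    refine ⟨quasiIso_of_isPushout_of_mono (sq.map stalkInf), fun k ↦ ?_⟩
    have := mono_right_of_llp hi.mem k
    have : QuasiIso (f.right k).hom := hf.mem.2 k
    exact quasiIso_of_isPushout_of_mono (f := (f.right k).hom) (i := (i.right k).hom)
      (sq.map (underlyingStalk k))
  right _ _ _ _ f' p' p f sq hf hp := by
    have : Epi (stalkInf.map p) := DgQ.epi_iff.2 hp.mem.1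
    have : QuasiIso (stalkInf.map f) := hf.mem.1
    refine ⟨quasiIso_of_isPullback_of_epi (sq.map stalkInf), fun k ↦ ?_⟩
    have : Epi (p.right k).hom := DgQ.epi_iff.2 (hp.mem.2 k)
    have : QuasiIso (f.right k).hom := hf.mem.2 k
    exact quasiIso_of_isPullback_of_epi (p := (p.right k).hom) (f := (f.right k).hom)
      (sq.map (underlyingStalk k))

lemma relCell_le_inverseImage_llp {C D : Type*} [Category.{0} C] [Category.{0} D]
    {P : MorphismProperty D} {I : MorphismProperty C} (F : C ⥤ D) [PreservesColimits F]
    (h : I ≤ P.llp.inverseImage F) : relCell I ≤ P.llp.inverseImage F := by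
  have pushouts_le : I.pushouts ≤ P.llp.inverseImage F := by
    rintro X Y f ⟨X', Y', g, u, v, hg, sq⟩
    exact P.llp.of_isPushout (sq.map F) (h _ hg)
  intro X Y f hf
  obtain ⟨J, _, _, _, _, ⟨hJ⟩⟩ := (MorphismProperty.transfiniteCompositions_iff _ _).1 hf
  have : PreservesWellOrderContinuousOfShape J F := ⟨fun _ _ ↦ inferInstance⟩
  exact MorphismProperty.transfiniteCompositionsOfShape_le P.llp J _
    ((hJ.ofLE pushouts_le).map (W := P.llp) (F := F)).mem

lemma monoidAxiom_AD : MonoidAxiom AD := by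
  intro X Y f hf
  have llp_left : trivCofTensor AD ≤ fibQ.llp.inverseImage stalkInf := by
    rintro _ _ _ ⟨j, Z, hj⟩
    have := mono_left_of_llp hj.1
    have : Mono (j.left ▷ Z.left) :=
      inferInstanceAs (Mono ((MonoidalCategory.tensorRight Z.left).map j.left))
    exact DgQ.llp_fibQ_of_mono (f := j.left ▷ Z.left) (DgQ.weqQ_whiskerRight hj.2.1 _)
  have llp_right (k : ℕ+) : trivCofTensor AD ≤ fibQ.llp.inverseImage (underlyingStalk k) := by
    rintro _ _ _ ⟨j, Z, hj⟩
    have := mono_right_of_llp hj.1 k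
    have : Mono ((j.right k).hom ▷ (Z.right k).V) :=
      inferInstanceAs (Mono ((MonoidalCategory.tensorRight (Z.right k).V).map (j.right k).hom))
    exact DgQ.llp_fibQ_of_mono (f := (j.right k).hom ▷ (Z.right k).V)
      (DgQ.weqQ_whiskerRight (hj.2.2 k) _)
  have : PreservesColimits stalkInf := stalkInfAdj.leftAdjoint_preservesColimits
  exact ⟨DgQ.weqQ_of_llp (relCell_le_inverseImage_llp _ llp_left _ hf),
    fun k ↦ DgQ.weqQ_of_llp (relCell_le_inverseImage_llp _ (llp_right k) _ hf)⟩

end Axioms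

end DihedralModel

end

theorem mainTheorem4 :
    ∃ _ : ModelCategory AD,
      weakEquivalences AD = stalkWeq ∧
      fibrations AD = stalkFib ∧
      IsCompleteFunctorial AD ∧
      IsMonoidalModel AD ∧
      IsCofibrantlyGeneratedBy genCof genTrivCof ∧
      IsProperModel AD ∧
      MonoidAxiom AD := by
  exact ⟨modelCategoryAD, rfl, rfl, isCompleteFunctorial_AD, isMonoidalModel_AD,
    isCofibrantlyGeneratedBy_AD, isProperModel_AD, monoidAxiom_AD⟩
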